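/- Let $\mathcal A$ be an abelian category with a torsion pair $(\mathcal T,\mathcal F)$: two full subcategories closed under isomorphisms, with $\mathrm{Hom}(T,F)=0$ for $T\in\mathcal T$, $F\in\mathcal F$, such that every $Z\in\mathcal A$ sits in a short exact sequence $0\to T\to Z\to F\to 0$ with $T\in\mathcal T$, $F\in\mathcal F$. The pair is *tilting* if every object of $\mathcal A$ embeds into an object of $\mathcal T$, and *cotilting* if every object of $\mathcal A$ is a quotient of an object of $\mathcal F$. *Tilting.* The category $\mathcal B$ obtained by tilting $\mathcal A$ with respect to $(\mathcal T,\mathcal F)$ has as objects the morphisms $X=[d\colon X^{-1}\to X^0]$ of $\mathcal A$ with $\ker d\in\mathcal F$ and $\mathrm{coker}\, d\in\mathcal T$. A morphism $X\to Y$ is an isomorphism class of butterflies $(E,\kappa,\iota,\sigma,\rho)$, where $\kappa\colon X^{-1}\to E$, $\iota\colon Y^{-1}\to E$, $\sigma\colon E\to X^0$, $\rho\colon E\to Y^0$ satisfy $\sigma\kappa=d_X$, $\rho\iota=d_Y$, $\rho\kappa=0$, and $0\to Y^{-1}\xrightarrow{\iota}E\xrightarrow{\sigma}X^0\to 0$ is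 exact. The composite of $(E,\kappa,\iota,\sigma,\rho)\colon X\to Y$ and $(E',\kappa',\iota',\sigma',\rho')\colon Y\to Z$ has middle object $(E\times_{Y^0}E')/Y^{-1}$, where $Y^{-1}$ is embedded by $(\iota,\kappa')$; the sum of $(E,\ldots)$ and $(E',\ldots)\colon X\to Y$ has middle object $(E\times_{X^0}E')/Y^{-1}$, where $Y^{-1}$ is embedded by $(\iota,-\iota')$. A morphism of complexes $(f^{-1},f^0)\colon X\to Y$ induces the *strict* butterfly with $E=X^0\oplus Y^{-1}$, $\kappa=(d_X,-f^{-1})$, $\iota=(0,\mathrm{id})$, $\sigma=\mathrm{pr}_1$, $\rho=f^0\circ\mathrm{pr}_1+d_Y\circ\mathrm{pr}_2$. *Iteration.* Let $\mathcal T'=\mathcal F[1]$ and $\mathcal F'=\mathcal T$ be the full subcategories of $\mathcal B$ of the objects isomorphic to some $[F\to 0]$ with $F\in\mathcal F$, respectively to some $[0\to T]$ with $T\in\mathcal T$. Let $\mathcal C^{\mathrm{st}}$ be the category of quadruples $[K_1\subseteq K_2\subseteq E\supseteq M]$ in $\mathcal A$ with $K_2\cap M\in\mathcal F$ and $E/(K_1+M)\in\mathcal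 T$; its morphisms are the morphisms $E\to E'$ that map $K_1,K_2,M$ into $K_1',K_2',M'$. **Theorem.** Suppose that $(\mathcal T,\mathcal F)$ is tilting or cotilting. Then $\mathcal B$, with the above addition of morphisms, is abelian and $(\mathcal T',\mathcal F')$ is a torsion pair in it; let $\mathcal C$ be the category obtained by tilting $\mathcal B$ with respect to $(\mathcal T',\mathcal F')$. Sending a quadruple to the morphism $[K_1\to E/M]\to[M\to E/K_2]$ of $\mathcal B$ given by the butterfly with middle object $E$ (and the inclusions and projections as wings), and a morphism of quadruples to the induced strict morphism, defines a functor $i\colon\mathcal C^{\mathrm{st}}\to\mathcal C$. There is a functor $H\colon\mathcal C\to\mathcal A$, unique up to isomorphism, such that $H\circ i$ is isomorphic to the functor $[K_1\subseteq K_2\subseteq E\supseteq M]\mapsto K_2/K_1$, and $H$ is an additive equivalence. -/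

import Mathlib

open CategoryTheory CategoryTheory.Limits

universe v u

/-- A torsion pair in an abelian category: two full subcategories (closed under isomorphisms) with
no nonzero morphisms from the first to the second, such that every object is an extension of an
object of the second by an object of the first. (Both are then automatically additive
subcategories.) -/
structure IsTorsionPair {A : Type u} [Category.{v} A] [Abelian A]
    (T F : ObjectProperty A) : Prop where
  tors_iso : T.IsClosedUnderIsomorphisms
  free_iso : F.IsClosedUnderIsomorphisms
  hom_eq_zero : ∀ {X Y : A}, T X → F Y → ∀ f : X ⟶ Y, f = 0
  exists_shortExact : ∀ Z : A, ∃ (X Y : A) (i : X ⟶ Z) (p : Z ⟶ Y) (w : i ≫ p = 0),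
    T X ∧ F Y ∧ (ShortComplex.mk i p w).ShortExact

/-- The torsion pair `(T, F)` is tilting: every object embeds into an object of `T`. -/
def IsTilting {A : Type u} [Category.{v} A] (T : ObjectProperty A) : Prop :=
  ∀ X : A, ∃ (Y : A) (i : X ⟶ Y), T Y ∧ Mono i

/-- The torsion pair `(T, F)` is cotilting: every object is a quotient of an object of `F`. -/
def IsCotilting {A : Type u} [Category.{v} A] (F : ObjectProperty A) : Prop :=
  ∀ X : A, ∃ (Y : A) (p : Y ⟶ X), F Y ∧ Epi p

namespace IsTorsionPair

variable {A : Type u} [Category.{v} A] [Abelian A] {T F : ObjectProperty A}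

lemma free_of_forall (h : IsTorsionPair T F) {Y : A}
    (hY : ∀ X : A, T X → ∀ f : X ⟶ Y, f = 0) : F Y := by
  obtain ⟨X, Z, i, p, w, hX, hZ, hs⟩ := h.exists_shortExact Y
  have := hs.mono_f
  have := hs.epi_g
  have hi : i = 0 := hY X hX i
  have : Mono p := hs.exact.mono_g hi
  have : IsIso p := isIso_of_mono_of_epi p
  have := h.free_iso
  exact F.prop_of_iso (asIso p).symm hZ

lemma tors_of_forall (h : IsTorsionPair T F) {X : A}
    (hX : ∀ Y : A, F Y → ∀ f : X ⟶ Y, f = 0) : T X := by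
  obtain ⟨Y, Z, i, p, w, hY, hZ, hs⟩ := h.exists_shortExact X
  have := hs.mono_f
  have := hs.epi_g
  have hp : p = 0 := hX Z hZ p
  have : Epi i := hs.exact.epi_f hp
  have : IsIso i := isIso_of_mono_of_epi i
  have := h.tors_iso
  exact T.prop_of_iso (asIso i) hY

lemma free_of_mono (h : IsTorsionPair T F) {X Y : A} (i : X ⟶ Y) [Mono i] (hY : F Y) : F X :=
  h.free_of_forall fun Z hZ f => by
    rw [← cancel_mono i, h.hom_eq_zero hZ hY (f ≫ i), zero_comp]

lemma tors_of_epi (h : IsTorsionPair T F) {X Y : A} (p : X ⟶ Y) [Epi p] (hX : T X) : T Y :=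
  h.tors_of_forall fun Z hZ f => by
    rw [← cancel_epi p, h.hom_eq_zero hX hZ (p ≫ f), comp_zero]

end IsTorsionPair

/-- A two-term complex `d : X⁻¹ ⟶ X⁰`, with `src = X⁻¹` and `tgt = X⁰`. -/
structure TwoTerm (A : Type u) [Category.{v} A] where
  src : A
  tgt : A
  d : src ⟶ tgt

section Butterflies

variable {A : Type u} [Category.{v} A] [Abelian A]

/-- A butterfly from `X` to `Y`: a commutative diagram with wings `κ : X⁻¹ ⟶ E`, `ι : Y⁻¹ ⟶ E`,
`σ : E ⟶ X⁰`, `ρ : E ⟶ Y⁰`, whose diagonals are complexes and whose NE-SW diagonal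
`0 ⟶ Y⁻¹ ⟶ E ⟶ X⁰ ⟶ 0` is short exact. -/
structure Butterfly (X Y : TwoTerm A) where
  E : A
  κ : X.src ⟶ E
  ι : Y.src ⟶ E
  σ : E ⟶ X.tgt
  ρ : E ⟶ Y.tgt
  κ_σ : κ ≫ σ = X.d
  ι_ρ : ι ≫ ρ = Y.d
  κ_ρ : κ ≫ ρ = 0
  ι_σ : ι ≫ σ = 0
  shortExact : (ShortComplex.mk ι σ ι_σ).ShortExact

/-- Presentation of a butterfly as a quotient `E = L / J`. -/
structure PreButterfly (X Y : TwoTerm A) where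
  L : A
  J : A
  j : J ⟶ L
  k : X.src ⟶ L
  i : Y.src ⟶ L
  s : L ⟶ X.tgt
  r : L ⟶ Y.tgt
  j_s : j ≫ s = 0
  j_r : j ≫ r = 0
  k_s : k ≫ s = X.d
  i_r : i ≫ r = Y.d
  k_r : k ≫ r = 0
  i_s : i ≫ s = 0
  epi_s : Epi s
  exact : ∀ {T : A} (t : T ⟶ L), t ≫ s = 0 → ∃ (y : T ⟶ J) (z : T ⟶ Y.src), t = y ≫ j + z ≫ i
  inj : ∀ {T : A} (y : T ⟶ J) (z : T ⟶ Y.src), y ≫ j + z ≫ i = 0 → y = 0 ∧ z = 0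

namespace Butterfly

attribute [simp] κ_σ ι_ρ κ_ρ ι_σ

variable {X Y Z W : TwoTerm A}

@[simp] lemma κ_σ_assoc (P : Butterfly X Y) {V : A} (h : X.tgt ⟶ V) :
    P.κ ≫ P.σ ≫ h = X.d ≫ h := by rw [← Category.assoc, κ_σ]

@[simp] lemma ι_ρ_assoc (P : Butterfly X Y) {V : A} (h : Y.tgt ⟶ V) :
    P.ι ≫ P.ρ ≫ h = Y.d ≫ h := by rw [← Category.assoc, ι_ρ]

@[simp] lemma κ_ρ_assoc (P : Butterfly X Y) {V : A} (h : Y.tgt ⟶ V) :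
    P.κ ≫ P.ρ ≫ h = 0 := by rw [← Category.assoc, κ_ρ, zero_comp]

@[simp] lemma ι_σ_assoc (P : Butterfly X Y) {V : A} (h : X.tgt ⟶ V) :
    P.ι ≫ P.σ ≫ h = 0 := by rw [← Category.assoc, ι_σ, zero_comp]

instance (P : Butterfly X Y) : Mono P.ι := P.shortExact.mono_f
instance (P : Butterfly X Y) : Epi P.σ := P.shortExact.epi_g

lemma exists_lift (P : Butterfly X Y) {T : A} (t : T ⟶ P.E) (h : t ≫ P.σ = 0) :
    ∃ z : T ⟶ Y.src, t = z ≫ P.ι :=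
  ⟨P.shortExact.exact.lift t h, (P.shortExact.exact.lift_f t h).symm⟩

lemma zero_of_ι (P : Butterfly X Y) {T : A} {z : T ⟶ Y.src} (h : z ≫ P.ι = 0) : z = 0 :=
  zero_of_comp_mono P.ι h

/-- Two butterflies are isomorphic when there is an isomorphism between the middle objects that
is compatible with the four wings. -/
def Equiv (P Q : Butterfly X Y) : Prop :=
  ∃ e : P.E ≅ Q.E, P.κ ≫ e.hom = Q.κ ∧ P.ι ≫ e.hom = Q.ι ∧ e.hom ≫ Q.σ = P.σ ∧ e.hom ≫ Q.ρ = P.ρ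

lemma Equiv.of_map {P Q : Butterfly X Y} (f : P.E ⟶ Q.E) (h₁ : P.κ ≫ f = Q.κ)
    (h₂ : P.ι ≫ f = Q.ι) (h₃ : f ≫ Q.σ = P.σ) (h₄ : f ≫ Q.ρ = P.ρ) : P.Equiv Q := by
  have : IsIso f := by
    let φ : ShortComplex.mk P.ι P.σ P.ι_σ ⟶ ShortComplex.mk Q.ι Q.σ Q.ι_σ :=
      { τ₁ := 𝟙 _, τ₂ := f, τ₃ := 𝟙 _
        comm₁₂ := by simp [h₂]
        comm₂₃ := by simp [h₃] }
    have h1 : IsIso φ.τ₁ := inferInstanceAs (IsIso (𝟙 _))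
    have h3 : IsIso φ.τ₃ := inferInstanceAs (IsIso (𝟙 _))
    exact ShortComplex.isIso₂_of_shortExact_of_isIso₁₃ φ P.shortExact Q.shortExact
  exact ⟨asIso f, h₁, h₂, h₃, h₄⟩

lemma Equiv.refl (P : Butterfly X Y) : P.Equiv P := ⟨Iso.refl _, by simp⟩

lemma Equiv.symm {P Q : Butterfly X Y} (h : P.Equiv Q) : Q.Equiv P := by
  obtain ⟨e, h₁, h₂, h₃, h₄⟩ := h
  exact ⟨e.symm, by simp [← h₁], by simp [← h₂], by simp [← h₃], by simp [← h₄]⟩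

lemma Equiv.trans {P Q R : Butterfly X Y} (h : P.Equiv Q) (h' : Q.Equiv R) : P.Equiv R := by
  obtain ⟨e, h₁, h₂, h₃, h₄⟩ := h
  obtain ⟨e', h₁', h₂', h₃', h₄'⟩ := h'
  exact ⟨e ≪≫ e', by simp [← h₁', ← h₁], by simp [← h₂', ← h₂], by simp [← h₃, ← h₃'],
    by simp [← h₄, ← h₄']⟩

instance setoid (X Y : TwoTerm A) : Setoid (Butterfly X Y) where
  r := Equiv
  iseqv := ⟨Equiv.refl, Equiv.symm, Equiv.trans⟩

end Butterfly

namespace PreButterfly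

variable {X Y Z W : TwoTerm A}

lemma mono_j (p : PreButterfly X Y) : Mono p.j :=
  Preadditive.mono_of_cancel_zero _ fun y h => (p.inj y 0 (by simp [h])).1

/-- The butterfly presented by `p`, with middle object `L / J`. -/
noncomputable def toButterfly (p : PreButterfly X Y) : Butterfly X Y where
  E := cokernel p.j
  κ := p.k ≫ cokernel.π p.j
  ι := p.i ≫ cokernel.π p.j
  σ := cokernel.desc p.j p.s p.j_s
  ρ := cokernel.desc p.j p.r p.j_r
  κ_σ := by simp [p.k_s]
  ι_ρ := by simp [p.i_r]
  κ_ρ := by simp [p.k_r]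
  ι_σ := by simp [p.i_s]
  shortExact := by
    have := p.mono_j
    have := p.epi_s
    refine ShortComplex.ShortExact.mk' ?_ ?_ ?_
    · rw [ShortComplex.exact_iff_exact_up_to_refinements]
      intro T x hx
      obtain ⟨T', π, hπ, t, ht⟩ := surjective_up_to_refinements_of_epi (cokernel.π p.j) x
      have hts : t ≫ p.s = 0 := by
        have := congrArg (fun f => f ≫ cokernel.desc p.j p.s p.j_s) ht
        have hx' : x ≫ cokernel.desc p.j p.s p.j_s = 0 := hx
        simpa [hx'] using this.symm
      obtain ⟨y, z, rfl⟩ := p.exact t hts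
      exact ⟨T', π, hπ, z, by simp [ht]⟩
    · refine Preadditive.mono_of_cancel_zero _ fun {T} z hz => ?_
      have hz' : (z ≫ p.i) ≫ cokernel.π p.j = 0 := by simpa using hz
      have h := (ShortComplex.exact_cokernel p.j).lift_f (z ≫ p.i) hz'
      refine (p.inj (-(ShortComplex.exact_cokernel p.j).lift (z ≫ p.i) hz') z ?_).2
      have h' : (ShortComplex.exact_cokernel p.j).lift (z ≫ p.i) hz' ≫ p.j = z ≫ p.i := h
      simp [h']
    · exact epi_of_epi_fac (f := cokernel.π p.j) (h := p.s) (by simp)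

lemma equiv_of_map (p : PreButterfly X Y) (Q : Butterfly X Y) (g : p.L ⟶ Q.E)
    (hj : p.j ≫ g = 0) (hk : p.k ≫ g = Q.κ) (hi : p.i ≫ g = Q.ι) (hs : g ≫ Q.σ = p.s)
    (hr : g ≫ Q.ρ = p.r) : p.toButterfly.Equiv Q :=
  Butterfly.Equiv.of_map (cokernel.desc p.j g hj : cokernel p.j ⟶ Q.E)
    (by simp [toButterfly, hk]) (by simp [toButterfly, hi])
    ((cancel_epi (cokernel.π p.j)).1 (by simp [toButterfly, hs]))
    ((cancel_epi (cokernel.π p.j)).1 (by simp [toButterfly, hr]))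

end PreButterfly

attribute [local simp] pullback.lift_fst pullback.lift_snd pullback.lift_fst_assoc pullback.lift_snd_assoc

namespace Butterfly

variable {X Y Z W : TwoTerm A}

/-- The strict butterfly of a morphism of complexes `(f, g)`, with middle object `X⁰ ⊞ Y⁻¹`. -/
noncomputable def strict (f : X.src ⟶ Y.src) (g : X.tgt ⟶ Y.tgt) (w : f ≫ Y.d = X.d ≫ g) :
    Butterfly X Y where
  E := X.tgt ⊞ Y.src
  κ := biprod.lift X.d (-f)
  ι := biprod.inr
  σ := biprod.fst
  ρ := biprod.desc g Y.d
  κ_σ := by simp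
  ι_ρ := by simp
  κ_ρ := by simp [w]
  ι_σ := by simp
  shortExact := ShortComplex.shortExact_of_iso
    (S₁ := ShortComplex.mk (biprod.inl : Y.src ⟶ Y.src ⊞ X.tgt) biprod.snd (by simp))
    (ShortComplex.isoMk (Iso.refl _) (biprod.braiding Y.src X.tgt) (Iso.refl _)
      (by ext <;> simp) (by simp))
    (ShortComplex.Splitting.ofHasBinaryBiproduct Y.src X.tgt).shortExact

section strict

variable (f : X.src ⟶ Y.src) (g : X.tgt ⟶ Y.tgt) (w : f ≫ Y.d = X.d ≫ g) {T T' : A}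

/-- The second projection of the middle object `X⁰ ⊞ Y⁻¹` of a strict butterfly. -/
noncomputable def strictSnd : (strict f g w).E ⟶ Y.src := (biprod.snd : X.tgt ⊞ Y.src ⟶ Y.src)

@[simp] lemma strict_κ_snd : (strict f g w).κ ≫ strictSnd f g w = -f := biprod.lift_snd _ _
@[simp] lemma strict_ι_snd : (strict f g w).ι ≫ strictSnd f g w = 𝟙 _ := biprod.inr_snd

lemma strict_ρ : (strict f g w).ρ = (strict f g w).σ ≫ g + strictSnd f g w ≫ Y.d :=
  biprod.desc_eq

/-- The generalized element `(a, b)` of the middle object of a strict butterfly. -/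
noncomputable def strictMk (a : T ⟶ X.tgt) (b : T ⟶ Y.src) : T ⟶ (strict f g w).E :=
  (biprod.lift a b : T ⟶ X.tgt ⊞ Y.src)

@[simp] lemma strictMk_σ (a : T ⟶ X.tgt) (b : T ⟶ Y.src) :
    strictMk f g w a b ≫ (strict f g w).σ = a := biprod.lift_fst _ _

@[simp] lemma strictMk_snd (a : T ⟶ X.tgt) (b : T ⟶ Y.src) :
    strictMk f g w a b ≫ strictSnd f g w = b := biprod.lift_snd _ _

variable {f g w} in
lemma strict_ext {a b : T ⟶ (strict f g w).E} (h₁ : a ≫ (strict f g w).σ = b ≫ (strict f g w).σ)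
    (h₂ : a ≫ strictSnd f g w = b ≫ strictSnd f g w) : a = b :=
  biprod.hom_ext (X := X.tgt) (Y := Y.src) a b h₁ h₂

@[simp] lemma strictMk_ρ (a : T ⟶ X.tgt) (b : T ⟶ Y.src) :
    strictMk f g w a b ≫ (strict f g w).ρ = a ≫ g + b ≫ Y.d := by
  rw [strict_ρ, Preadditive.comp_add, ← Category.assoc, ← Category.assoc, strictMk_σ, strictMk_snd]

lemma precomp_strictMk (h : T' ⟶ T) (a : T ⟶ X.tgt) (b : T ⟶ Y.src) :
    h ≫ strictMk f g w a b = strictMk f g w (h ≫ a) (h ≫ b) :=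
  strict_ext (by simp) (by simp)

end strict

/-- Presentation of the composite of two butterflies. -/
noncomputable def preComp (P : Butterfly X Y) (Q : Butterfly Y Z) : PreButterfly X Z where
  L := pullback P.ρ Q.σ
  J := Y.src
  j := pullback.lift P.ι Q.κ (by simp)
  k := pullback.lift P.κ 0 (by simp)
  i := pullback.lift 0 Q.ι (by simp)
  s := pullback.fst _ _ ≫ P.σ
  r := pullback.snd _ _ ≫ Q.ρ
  j_s := by simp
  j_r := by simp
  k_s := by simp
  i_r := by simp
  k_r := by simp
  i_s := by simp
  epi_s := inferInstance
  exact := fun t ht => by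
    obtain ⟨y, hy⟩ := P.exists_lift (t ≫ pullback.fst _ _) (by simpa using ht)
    have c : t ≫ pullback.fst _ _ ≫ P.ρ = t ≫ pullback.snd _ _ ≫ Q.σ := by
      rw [pullback.condition]
    rw [← Category.assoc, hy] at c
    obtain ⟨z, hz⟩ := Q.exists_lift (t ≫ pullback.snd _ _ - y ≫ Q.κ)
      (by simpa [sub_eq_zero] using c.symm)
    rw [sub_eq_iff_eq_add] at hz
    refine ⟨y, z, pullback.hom_ext ?_ ?_⟩
    · simp [hy]
    · simp [hz]
      exact add_comm _ _
  inj := fun y z h => by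
    have h₁ := congrArg (fun f => f ≫ pullback.fst _ _) h
    have h₂ := congrArg (fun f => f ≫ pullback.snd _ _) h
    obtain rfl : y = 0 := P.zero_of_ι (by simpa using h₁)
    exact ⟨rfl, Q.zero_of_ι (by simpa using h₂)⟩

/-- The composite of two butterflies: the fibre product of the middle objects over `Y⁰`, modulo
the image of `Y⁻¹` under `(ι, κ')`. -/
noncomputable def comp (P : Butterfly X Y) (Q : Butterfly Y Z) : Butterfly X Z :=
  (P.preComp Q).toButterfly

/-- Presentation of the sum of two butterflies. -/
noncomputable def preAdd (P Q : Butterfly X Y) : PreButterfly X Y where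
  L := pullback P.σ Q.σ
  J := Y.src
  j := pullback.lift P.ι (-Q.ι) (by simp)
  k := pullback.lift P.κ Q.κ (by simp)
  i := pullback.lift 0 Q.ι (by simp)
  s := pullback.fst _ _ ≫ P.σ
  r := pullback.fst _ _ ≫ P.ρ + pullback.snd _ _ ≫ Q.ρ
  j_s := by simp
  j_r := by simp
  k_s := by simp
  i_r := by simp
  k_r := by simp
  i_s := by simp
  epi_s := inferInstance
  exact := fun t ht => by
    have c : t ≫ pullback.fst _ _ ≫ P.σ = t ≫ pullback.snd _ _ ≫ Q.σ := by
      rw [pullback.condition]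
    rw [ht] at c
    obtain ⟨y, hy⟩ := P.exists_lift (t ≫ pullback.fst _ _) (by simpa using ht)
    obtain ⟨z, hz⟩ := Q.exists_lift (t ≫ pullback.snd _ _) (by simpa using c.symm)
    refine ⟨y, y + z, pullback.hom_ext ?_ ?_⟩
    · simp [hy]
    · simp [hz]
  inj := fun y z h => by
    have h₁ := congrArg (fun f => f ≫ pullback.fst _ _) h
    have h₂ := congrArg (fun f => f ≫ pullback.snd _ _) h
    obtain rfl : y = 0 := P.zero_of_ι (by simpa using h₁)
    exact ⟨rfl, Q.zero_of_ι (by simpa using h₂)⟩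

/-- The (Baer) sum of two butterflies: the fibre product of the middle objects over `X⁰`, modulo
the antidiagonal image of `Y⁻¹`. -/
noncomputable def add (P Q : Butterfly X Y) : Butterfly X Y :=
  (P.preAdd Q).toButterfly

/-- The negative `(E, κ, -ι, σ, -ρ)` of a butterfly. -/
noncomputable def neg (P : Butterfly X Y) : Butterfly X Y where
  E := P.E
  κ := P.κ
  ι := -P.ι
  σ := P.σ
  ρ := -P.ρ
  κ_σ := by simp
  ι_ρ := by simp
  κ_ρ := by simp
  ι_σ := by simp
  shortExact := ShortComplex.shortExact_of_iso
    (S₁ := ShortComplex.mk P.ι P.σ P.ι_σ)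
    (ShortComplex.isoMk { hom := -𝟙 Y.src, inv := -𝟙 Y.src } (Iso.refl _) (Iso.refl _)
      (by simp) (by simp)) P.shortExact

/-- The projection from the fibre product to the middle object of a composite. -/
noncomputable def compπ (P : Butterfly X Y) (Q : Butterfly Y Z) :
    pullback P.ρ Q.σ ⟶ (P.comp Q).E :=
  cokernel.π (P.preComp Q).j

/-- The generalized element of the middle object of `P.comp Q` given by the pair `(a, b)`. -/
noncomputable def compMk (P : Butterfly X Y) (Q : Butterfly Y Z) {T : A} (a : T ⟶ P.E) (b : T ⟶ Q.E)
    (h : a ≫ P.ρ = b ≫ Q.σ) : T ⟶ (P.comp Q).E :=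
  pullback.lift a b h ≫ compπ P Q

section compMk

variable (P : Butterfly X Y) (Q : Butterfly Y Z) {T T' : A}

lemma comp_κ : (P.comp Q).κ = compMk P Q P.κ 0 (by simp) := rfl
lemma comp_ι : (P.comp Q).ι = compMk P Q 0 Q.ι (by simp) := rfl
lemma compπ_σ : compπ P Q ≫ (P.comp Q).σ = pullback.fst _ _ ≫ P.σ := cokernel.π_desc _ _ _
lemma compπ_ρ : compπ P Q ≫ (P.comp Q).ρ = pullback.snd _ _ ≫ Q.ρ := cokernel.π_desc _ _ _
lemma compπ_cond : pullback.lift P.ι Q.κ (by simp) ≫ compπ P Q = 0 := cokernel.condition _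

@[simp] lemma compMk_σ (a : T ⟶ P.E) (b : T ⟶ Q.E) (h : a ≫ P.ρ = b ≫ Q.σ) :
    compMk P Q a b h ≫ (P.comp Q).σ = a ≫ P.σ := by
  simp [compMk, compπ_σ]

@[simp] lemma compMk_ρ (a : T ⟶ P.E) (b : T ⟶ Q.E) (h : a ≫ P.ρ = b ≫ Q.σ) :
    compMk P Q a b h ≫ (P.comp Q).ρ = b ≫ Q.ρ := by
  simp [compMk, compπ_ρ]

lemma precomp_compMk (f : T' ⟶ T) (a : T ⟶ P.E) (b : T ⟶ Q.E) (h : a ≫ P.ρ = b ≫ Q.σ) :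
    f ≫ compMk P Q a b h = compMk P Q (f ≫ a) (f ≫ b) (by simp [h]) := by
  have : f ≫ pullback.lift a b h = pullback.lift (f ≫ a) (f ≫ b) (by simp [h]) :=
    pullback.hom_ext (by simp) (by simp)
  rw [compMk, compMk, ← this, Category.assoc]

lemma compMk_eq (y : T ⟶ Y.src) {a a' : T ⟶ P.E} {b b' : T ⟶ Q.E} {h : a ≫ P.ρ = b ≫ Q.σ}
    {h' : a' ≫ P.ρ = b' ≫ Q.σ} (ha : a = a' + y ≫ P.ι) (hb : b = b' + y ≫ Q.κ) :
    compMk P Q a b h = compMk P Q a' b' h' := by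
  have e : pullback.lift a b h = pullback.lift a' b' h' +
      y ≫ (pullback.lift P.ι Q.κ (by simp) : Y.src ⟶ pullback P.ρ Q.σ) :=
    pullback.hom_ext (by simp [ha]) (by simp [hb])
  rw [compMk, compMk, e, Preadditive.add_comp, Category.assoc, compπ_cond, comp_zero, add_zero]

lemma compMk_eq_zero (y : T ⟶ Y.src) {a : T ⟶ P.E} {b : T ⟶ Q.E} {h : a ≫ P.ρ = b ≫ Q.σ}
    (ha : a = y ≫ P.ι) (hb : b = y ≫ Q.κ) : compMk P Q a b h = 0 := by
  have e : pullback.lift a b h =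
      y ≫ (pullback.lift P.ι Q.κ (by simp) : Y.src ⟶ pullback P.ρ Q.σ) :=
    pullback.hom_ext (by simp [ha]) (by simp [hb])
  rw [compMk, e, Category.assoc, compπ_cond, comp_zero]

lemma compMk_add {a a' : T ⟶ P.E} {b b' : T ⟶ Q.E} (h : a ≫ P.ρ = b ≫ Q.σ)
    (h' : a' ≫ P.ρ = b' ≫ Q.σ) : compMk P Q a b h + compMk P Q a' b' h' =
      compMk P Q (a + a') (b + b') (by simp [h, h']) := by
  have e : pullback.lift (a + a') (b + b') (by simp [h, h']) =
      pullback.lift a b h + pullback.lift a' b' h' :=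
    pullback.hom_ext (by simp) (by simp)
  rw [compMk, compMk, compMk, e, Preadditive.add_comp]

/-- A butterfly is isomorphic to a composite as soon as it receives a compatible map from the
fibre product. -/
lemma comp_equiv (R : Butterfly X Z) (g : pullback P.ρ Q.σ ⟶ R.E)
    (hj : pullback.lift P.ι Q.κ (by simp) ≫ g = 0)
    (hk : pullback.lift P.κ 0 (by simp) ≫ g = R.κ)
    (hi : pullback.lift 0 Q.ι (by simp) ≫ g = R.ι)
    (hs : g ≫ R.σ = pullback.fst _ _ ≫ P.σ)
    (hr : g ≫ R.ρ = pullback.snd _ _ ≫ Q.ρ) : (P.comp Q).Equiv R :=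
  (P.preComp Q).equiv_of_map R g hj hk hi hs hr

end compMk

/-- The projection from the fibre product to the middle object of a sum. -/
noncomputable def addπ (P Q : Butterfly X Y) : pullback P.σ Q.σ ⟶ (P.add Q).E :=
  cokernel.π (P.preAdd Q).j

/-- The generalized element of the middle object of `P.add Q` given by the pair `(a, b)`. -/
noncomputable def addMk (P Q : Butterfly X Y) {T : A} (a : T ⟶ P.E) (b : T ⟶ Q.E)
    (h : a ≫ P.σ = b ≫ Q.σ) : T ⟶ (P.add Q).E :=
  pullback.lift a b h ≫ addπ P Q

section addMk

variable (P Q : Butterfly X Y) {T T' : A}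

lemma add_κ : (P.add Q).κ = addMk P Q P.κ Q.κ (by simp) := rfl
lemma add_ι : (P.add Q).ι = addMk P Q 0 Q.ι (by simp) := rfl
lemma addπ_σ : addπ P Q ≫ (P.add Q).σ = pullback.fst _ _ ≫ P.σ := cokernel.π_desc _ _ _
lemma addπ_ρ : addπ P Q ≫ (P.add Q).ρ = pullback.fst _ _ ≫ P.ρ + pullback.snd _ _ ≫ Q.ρ :=
  cokernel.π_desc _ _ _
lemma addπ_cond : pullback.lift P.ι (-Q.ι) (by simp) ≫ addπ P Q = 0 := cokernel.condition _

@[simp] lemma addMk_σ (a : T ⟶ P.E) (b : T ⟶ Q.E) (h : a ≫ P.σ = b ≫ Q.σ) :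
    addMk P Q a b h ≫ (P.add Q).σ = a ≫ P.σ := by
  simp [addMk, addπ_σ]

@[simp] lemma addMk_ρ (a : T ⟶ P.E) (b : T ⟶ Q.E) (h : a ≫ P.σ = b ≫ Q.σ) :
    addMk P Q a b h ≫ (P.add Q).ρ = a ≫ P.ρ + b ≫ Q.ρ := by
  simp [addMk, addπ_ρ]

lemma precomp_addMk (f : T' ⟶ T) (a : T ⟶ P.E) (b : T ⟶ Q.E) (h : a ≫ P.σ = b ≫ Q.σ) :
    f ≫ addMk P Q a b h = addMk P Q (f ≫ a) (f ≫ b) (by simp [h]) := by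
  have : f ≫ pullback.lift a b h = pullback.lift (f ≫ a) (f ≫ b) (by simp [h]) :=
    pullback.hom_ext (by simp) (by simp)
  rw [addMk, addMk, ← this, Category.assoc]

lemma addMk_eq (y : T ⟶ Y.src) {a a' : T ⟶ P.E} {b b' : T ⟶ Q.E} {h : a ≫ P.σ = b ≫ Q.σ}
    {h' : a' ≫ P.σ = b' ≫ Q.σ} (ha : a = a' + y ≫ P.ι) (hb : b = b' - y ≫ Q.ι) :
    addMk P Q a b h = addMk P Q a' b' h' := by
  have e : pullback.lift a b h = pullback.lift a' b' h' +
      y ≫ (pullback.lift P.ι (-Q.ι) (by simp) : Y.src ⟶ pullback P.σ Q.σ) :=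
    pullback.hom_ext (by simp [ha]) (by simp [hb, sub_eq_add_neg])
  rw [addMk, addMk, e, Preadditive.add_comp, Category.assoc, addπ_cond, comp_zero, add_zero]

lemma addMk_eq_zero (y : T ⟶ Y.src) {a : T ⟶ P.E} {b : T ⟶ Q.E} {h : a ≫ P.σ = b ≫ Q.σ}
    (ha : a = y ≫ P.ι) (hb : b = -(y ≫ Q.ι)) : addMk P Q a b h = 0 := by
  have e : pullback.lift a b h =
      y ≫ (pullback.lift P.ι (-Q.ι) (by simp) : Y.src ⟶ pullback P.σ Q.σ) :=
    pullback.hom_ext (by simp [ha]) (by simp [hb])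
  rw [addMk, e, Category.assoc, addπ_cond, comp_zero]

lemma add_equiv (R : Butterfly X Y) (g : pullback P.σ Q.σ ⟶ R.E)
    (hj : pullback.lift P.ι (-Q.ι) (by simp) ≫ g = 0)
    (hk : pullback.lift P.κ Q.κ (by simp) ≫ g = R.κ)
    (hi : pullback.lift 0 Q.ι (by simp) ≫ g = R.ι)
    (hs : g ≫ R.σ = pullback.fst _ _ ≫ P.σ)
    (hr : g ≫ R.ρ = pullback.fst _ _ ≫ P.ρ + pullback.snd _ _ ≫ Q.ρ) : (P.add Q).Equiv R :=
  (P.preAdd Q).equiv_of_map R g hj hk hi hs hr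

end addMk

lemma Equiv.comp {P P' : Butterfly X Y} {Q Q' : Butterfly Y Z} (h : P.Equiv P') (h' : Q.Equiv Q') :
    (P.comp Q).Equiv (P'.comp Q') := by
  obtain ⟨e, h₁, h₂, h₃, h₄⟩ := h
  obtain ⟨f, k₁, k₂, k₃, k₄⟩ := h'
  refine comp_equiv P Q _ (compMk P' Q' (pullback.fst _ _ ≫ e.hom) (pullback.snd _ _ ≫ f.hom)
    (by simp [h₄, k₃, pullback.condition])) ?_ ?_ ?_ ?_ ?_
  · rw [precomp_compMk]
    exact compMk_eq_zero _ _ (𝟙 _) (by simp [h₂]) (by simp [k₁])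
  · rw [precomp_compMk, comp_κ]
    simp [h₁]
  · rw [precomp_compMk, comp_ι]
    simp [k₂]
  · simp [h₃]
  · simp [k₄]

lemma Equiv.add {P P' Q Q' : Butterfly X Y} (h : P.Equiv P') (h' : Q.Equiv Q') :
    (P.add Q).Equiv (P'.add Q') := by
  obtain ⟨e, h₁, h₂, h₃, h₄⟩ := h
  obtain ⟨f, k₁, k₂, k₃, k₄⟩ := h'
  refine add_equiv P Q _ (addMk P' Q' (pullback.fst _ _ ≫ e.hom) (pullback.snd _ _ ≫ f.hom)
    (by simp [h₃, k₃, pullback.condition])) ?_ ?_ ?_ ?_ ?_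
  · rw [precomp_addMk]
    exact addMk_eq_zero _ _ (𝟙 _) (by simp [h₂]) (by simp [k₂])
  · rw [precomp_addMk, add_κ]
    simp [h₁, k₁]
  · rw [precomp_addMk, add_ι]
    simp [k₂]
  · simp [h₃]
  · simp [h₄, k₄]

lemma Equiv.neg {P P' : Butterfly X Y} (h : P.Equiv P') : P.neg.Equiv P'.neg := by
  obtain ⟨e, h₁, h₂, h₃, h₄⟩ := h
  refine ⟨e, h₁, ?_, h₃, ?_⟩
  · change (-P.ι) ≫ e.hom = -P'.ι
    rw [Preadditive.neg_comp, h₂]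
  · change e.hom ≫ (-P'.ρ) = -P.ρ
    rw [Preadditive.comp_neg, h₄]

/-- The identity butterfly. -/
noncomputable abbrev id (X : TwoTerm A) : Butterfly X X := strict (𝟙 _) (𝟙 _) (by simp)

/-- The zero butterfly. -/
noncomputable abbrev zero (X Y : TwoTerm A) : Butterfly X Y := strict 0 0 (by simp)

/-- A compatible triple of a map of middle objects and two morphisms of complexes gives a
commutative square. -/
lemma strict_square (P : Butterfly X Y) (P' : Butterfly Z W)
    {a : X.src ⟶ Z.src} {a' : X.tgt ⟶ Z.tgt} (ha : a ≫ Z.d = X.d ≫ a')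
    {b : Y.src ⟶ W.src} {b' : Y.tgt ⟶ W.tgt} (hb : b ≫ W.d = Y.d ≫ b') (f : P.E ⟶ P'.E)
    (hκ : P.κ ≫ f = a ≫ P'.κ) (hι : P.ι ≫ f = b ≫ P'.ι) (hσ : f ≫ P'.σ = P.σ ≫ a')
    (hρ : f ≫ P'.ρ = P.ρ ≫ b') :
    (P.comp (strict b b' hb)).Equiv ((strict a a' ha).comp P') := by
  have c := pullback.condition (f := P.ρ) (g := (strict b b' hb).σ)
  refine comp_equiv _ _ _ (compMk (strict a a' ha) P'
    (strictMk _ _ _ (pullback.fst _ _ ≫ P.σ) 0)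
    (pullback.fst _ _ ≫ f + pullback.snd P.ρ (strict b b' hb).σ ≫ strictSnd _ _ _ ≫ P'.ι)
    (by simp [hσ])) ?_ ?_ ?_ ?_ ?_
  · rw [precomp_compMk]
    exact compMk_eq_zero _ _ 0 (strict_ext (by simp [precomp_strictMk]) (by simp [precomp_strictMk]))
      (by simp [hι, reassoc_of% (strict_κ_snd b b' hb)])
  · rw [precomp_compMk, comp_κ]
    exact compMk_eq _ _ a (strict_ext (by simp [precomp_strictMk]) (by simp [precomp_strictMk]))
      (by simp [hκ])
  · rw [precomp_compMk, comp_ι]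
    exact compMk_eq _ _ 0 (strict_ext (by simp [precomp_strictMk]) (by simp [precomp_strictMk]))
      (by simp [reassoc_of% (strict_ι_snd b b' hb)])
  · simp
  · simp [hρ, strict_ρ, ← reassoc_of% c]

lemma id_comp (P : Butterfly X Y) : ((id X).comp P).Equiv P := by
  have c := pullback.condition (f := (id X).ρ) (g := P.σ)
  have h₁ := strict_κ_snd (𝟙 X.src) (𝟙 X.tgt) (by simp)
  have h₂ := strict_ι_snd (𝟙 X.src) (𝟙 X.tgt) (by simp)
  refine comp_equiv _ _ _
    (pullback.snd _ _ - pullback.fst (id X).ρ P.σ ≫ strictSnd _ _ _ ≫ P.κ) ?_ ?_ ?_ ?_ ?_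
  · simp [reassoc_of% h₂]
  · simp [reassoc_of% h₁]
  · simp
  · simp [← c, strict_ρ]
  · simp

lemma comp_id (P : Butterfly X Y) : (P.comp (id Y)).Equiv P := by
  have c := pullback.condition (f := P.ρ) (g := (id Y).σ)
  have h₁ := strict_κ_snd (𝟙 Y.src) (𝟙 Y.tgt) (by simp)
  have h₂ := strict_ι_snd (𝟙 Y.src) (𝟙 Y.tgt) (by simp)
  refine comp_equiv _ _ _ (pullback.fst _ _ + pullback.snd P.ρ (id Y).σ ≫ strictSnd _ _ _ ≫ P.ι)
    ?_ ?_ ?_ ?_ ?_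
  · simp [reassoc_of% h₁]
  · simp
  · simp [reassoc_of% h₂]
  · simp
  · simp [c, strict_ρ]

lemma strict_comp (f : X.src ⟶ Y.src) (g : X.tgt ⟶ Y.tgt) (w : f ≫ Y.d = X.d ≫ g)
    (f' : Y.src ⟶ Z.src) (g' : Y.tgt ⟶ Z.tgt) (w' : f' ≫ Z.d = Y.d ≫ g') :
    ((strict f g w).comp (strict f' g' w')).Equiv
      (strict (f ≫ f') (g ≫ g') (by simp [w', reassoc_of% w])) := by
  have c := pullback.condition (f := (strict f g w).ρ) (g := (strict f' g' w').σ)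
  have h₁ := strict_κ_snd f g w
  have h₂ := strict_ι_snd f g w
  refine comp_equiv _ _ _ (strictMk _ _ _ (pullback.fst _ _ ≫ (strict f g w).σ)
    (pullback.snd _ _ ≫ strictSnd f' g' w' + pullback.fst _ _ ≫ strictSnd f g w ≫ f'))
    ?_ ?_ ?_ ?_ ?_
  · exact strict_ext (by simp [precomp_strictMk])
      (by simp [precomp_strictMk, reassoc_of% h₂])
  · exact strict_ext (by simp [precomp_strictMk])
      (by simp [precomp_strictMk, reassoc_of% h₁])
  · exact strict_ext (by simp [precomp_strictMk])
      (by simp [precomp_strictMk])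
  · simp
  · rw [strictMk_ρ, strict_ρ f' g' w', Preadditive.comp_add, ← reassoc_of% c, strict_ρ f g w]
    simp [w']
    abel

end Butterfly
namespace Butterfly

variable {X Y Z W : TwoTerm A}

lemma biprod_eq_zero {U V T : A} (f : U ⊞ V ⟶ T) (h₁ : biprod.inl ≫ f = 0)
    (h₂ : biprod.inr ≫ f = 0) : f = 0 :=
  biprod.hom_ext' _ _ (by rw [h₁, comp_zero]) (by rw [h₂, comp_zero])

lemma biprod₃_eq_zero {U V S T : A} (f : (U ⊞ V) ⊞ S ⟶ T) (h₁ : biprod.inl ≫ biprod.inl ≫ f = 0)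
    (h₂ : biprod.inr ≫ biprod.inl ≫ f = 0) (h₃ : biprod.inr ≫ f = 0) : f = 0 :=
  biprod_eq_zero _ (biprod_eq_zero _ h₁ h₂) h₃

/-- A common presentation of `(P.comp Q).comp R` and `P.comp (Q.comp R)`. -/
noncomputable def preComp₃ (P : Butterfly X Y) (Q : Butterfly Y Z) (R : Butterfly Z W) :
    PreButterfly X W where
  L := pullback (pullback.snd P.ρ Q.σ ≫ Q.ρ) R.σ
  J := Y.src ⊞ Z.src
  j := biprod.desc (pullback.lift (pullback.lift P.ι Q.κ (by simp)) 0 (by simp))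
    (pullback.lift (pullback.lift 0 Q.ι (by simp)) R.κ (by simp))
  k := pullback.lift (pullback.lift P.κ 0 (by simp)) 0 (by simp)
  i := pullback.lift 0 R.ι (by simp)
  s := pullback.fst _ _ ≫ pullback.fst _ _ ≫ P.σ
  r := pullback.snd _ _ ≫ R.ρ
  j_s := by ext <;> simp
  j_r := by ext <;> simp
  k_s := by simp
  i_r := by simp
  k_r := by simp
  i_s := by simp
  epi_s := inferInstance
  exact := fun t ht => by
    have c : t ≫ pullback.fst _ _ ≫ pullback.fst _ _ ≫ P.ρ =
        t ≫ pullback.fst _ _ ≫ pullback.snd _ _ ≫ Q.σ := by rw [pullback.condition]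
    have c' : t ≫ pullback.fst _ _ ≫ pullback.snd _ _ ≫ Q.ρ = t ≫ pullback.snd _ _ ≫ R.σ := by
      rw [pullback.condition]
    obtain ⟨y, hy⟩ := P.exists_lift (t ≫ pullback.fst _ _ ≫ pullback.fst _ _) (by simpa using ht)
    have hy' := congrArg (fun f => f ≫ P.ρ) hy
    obtain ⟨z, hz⟩ := Q.exists_lift (t ≫ pullback.fst _ _ ≫ pullback.snd _ _ - y ≫ Q.κ)
      (by simp [← c] at hy' ⊢; simp [hy'])
    rw [sub_eq_iff_eq_add] at hz
    have hz' := congrArg (fun f => f ≫ Q.ρ) hz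
    obtain ⟨w, hw⟩ := R.exists_lift (t ≫ pullback.snd _ _ - z ≫ R.κ)
      (by simp [← c'] at hz' ⊢; simp [hz'])
    rw [sub_eq_iff_eq_add] at hw
    refine ⟨biprod.lift y z, w, pullback.hom_ext (pullback.hom_ext ?_ ?_) ?_⟩
    · simp [hy]
    · simp [hz]
      exact add_comm _ _
    · simp [hw]
      exact add_comm _ _
  inj := fun y w h => by
    have h₁ := congrArg (fun f => f ≫ pullback.fst _ _ ≫ pullback.fst _ _) h
    have h₂ := congrArg (fun f => f ≫ pullback.fst _ _ ≫ pullback.snd _ _) h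
    have h₃ := congrArg (fun f => f ≫ pullback.snd _ _) h
    obtain ⟨y, z, rfl⟩ : ∃ a b, y = biprod.lift a b :=
      ⟨y ≫ biprod.fst, y ≫ biprod.snd, by ext <;> simp⟩
    obtain rfl : y = 0 := P.zero_of_ι (by simpa using h₁)
    obtain rfl : z = 0 := Q.zero_of_ι (by simpa using h₂)
    obtain rfl : w = 0 := R.zero_of_ι (by simpa using h₃)
    exact ⟨by ext <;> simp, rfl⟩

lemma comp_assoc (P : Butterfly X Y) (Q : Butterfly Y Z) (R : Butterfly Z W) :
    ((P.comp Q).comp R).Equiv (P.comp (Q.comp R)) := by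
  have c := pullback.condition (f := P.ρ) (g := Q.σ)
  have c' := pullback.condition (f := pullback.snd P.ρ Q.σ ≫ Q.ρ) (g := R.σ)
  refine Equiv.trans (Equiv.symm (Q := _) ((preComp₃ P Q R).equiv_of_map _
    (compMk (P.comp Q) R (compMk P Q (pullback.fst _ _ ≫ pullback.fst _ _)
      (pullback.fst _ _ ≫ pullback.snd _ _) (by simp [c])) (pullback.snd _ _)
        (by simpa using c') : pullback (pullback.snd P.ρ Q.σ ≫ Q.ρ) R.σ ⟶ _)
    ?_ ?_ ?_ ?_ ?_)) ((preComp₃ P Q R).equiv_of_map _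
    (compMk P (Q.comp R) (pullback.fst _ _ ≫ pullback.fst _ _)
      (compMk Q R (pullback.fst _ _ ≫ pullback.snd _ _) (pullback.snd _ _)
        (by simpa using c')) (by simp [c]) : pullback (pullback.snd P.ρ Q.σ ≫ Q.ρ) R.σ ⟶ _)
    ?_ ?_ ?_ ?_ ?_)
  all_goals dsimp only [preComp₃]
  · refine biprod_eq_zero _ ?_ ?_
    · rw [biprod.inl_desc_assoc, precomp_compMk]
      refine compMk_eq_zero _ _ 0 ?_ (by simp)
      rw [precomp_compMk, zero_comp]
      exact compMk_eq_zero _ _ (𝟙 _) (by simp) (by simp)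
    · rw [biprod.inr_desc_assoc, precomp_compMk]
      refine compMk_eq_zero _ _ (𝟙 _) ?_ (by simp)
      rw [precomp_compMk, comp_ι, Category.id_comp]
      congr 1 <;> simp
  · rw [precomp_compMk, comp_κ]
    congr 1
    · rw [precomp_compMk, comp_κ]
      congr 1 <;> simp
    · simp
  · rw [precomp_compMk, comp_ι]
    congr 1
    · rw [precomp_compMk]
      exact compMk_eq_zero _ _ 0 (by simp) (by simp)
    · simp
  · simp
  · simp
  · refine biprod_eq_zero _ ?_ ?_
    · rw [biprod.inl_desc_assoc, precomp_compMk]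
      refine compMk_eq_zero _ _ (𝟙 _) (by simp) ?_
      rw [precomp_compMk, comp_κ, Category.id_comp]
      congr 1 <;> simp
    · rw [biprod.inr_desc_assoc, precomp_compMk]
      refine compMk_eq_zero _ _ 0 (by simp) ?_
      rw [precomp_compMk, zero_comp]
      exact compMk_eq_zero _ _ (𝟙 _) (by simp) (by simp)
  · rw [precomp_compMk, comp_κ]
    congr 1
    · simp
    · rw [precomp_compMk]
      exact compMk_eq_zero _ _ 0 (by simp) (by simp)
  · rw [precomp_compMk, comp_ι]
    congr 1
    · simp
    · rw [precomp_compMk, comp_ι]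
      congr 1 <;> simp
  · simp
  · simp

/-- A common presentation of `(P.add Q).add R` and `P.add (Q.add R)`. -/
noncomputable def preAdd₃ (P Q R : Butterfly X Y) : PreButterfly X Y where
  L := pullback (pullback.fst P.σ Q.σ ≫ P.σ) R.σ
  J := Y.src ⊞ Y.src
  j := biprod.desc (pullback.lift (pullback.lift P.ι (-Q.ι) (by simp)) 0 (by simp))
    (pullback.lift (pullback.lift 0 Q.ι (by simp)) (-R.ι) (by simp))
  k := pullback.lift (pullback.lift P.κ Q.κ (by simp)) R.κ (by simp)
  i := pullback.lift 0 R.ι (by simp)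
  s := pullback.snd _ _ ≫ R.σ
  r := pullback.fst _ _ ≫ pullback.fst _ _ ≫ P.ρ + pullback.fst _ _ ≫ pullback.snd _ _ ≫ Q.ρ +
    pullback.snd _ _ ≫ R.ρ
  j_s := by ext <;> simp
  j_r := by ext <;> simp
  k_s := by simp
  i_r := by simp
  k_r := by simp
  i_s := by simp
  epi_s := by rw [← pullback.condition]; infer_instance
  exact := fun t ht => by
    have c := congrArg (fun f => t ≫ pullback.fst (pullback.fst P.σ Q.σ ≫ P.σ) R.σ ≫ f)
      (pullback.condition (f := P.σ) (g := Q.σ))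
    have c' := congrArg (fun f => t ≫ f)
      (pullback.condition (f := pullback.fst P.σ Q.σ ≫ P.σ) (g := R.σ))
    obtain ⟨a, ha⟩ := P.exists_lift (t ≫ pullback.fst _ _ ≫ pullback.fst _ _) (by simp [c', ht])
    obtain ⟨b, hb⟩ := Q.exists_lift (t ≫ pullback.fst _ _ ≫ pullback.snd _ _)
      (by simp [← c, c', ht])
    obtain ⟨z, hz⟩ := R.exists_lift (t ≫ pullback.snd _ _) (by simp [ht])
    refine ⟨biprod.lift a (a + b), a + b + z, pullback.hom_ext (pullback.hom_ext ?_ ?_) ?_⟩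
    · simp [ha]
    · simp [hb]
    · simp [hz]
      abel
  inj := fun y w h => by
    have h₁ := congrArg (fun f => f ≫ pullback.fst _ _ ≫ pullback.fst _ _) h
    have h₂ := congrArg (fun f => f ≫ pullback.fst _ _ ≫ pullback.snd _ _) h
    have h₃ := congrArg (fun f => f ≫ pullback.snd _ _) h
    obtain ⟨y, z, rfl⟩ : ∃ a b, y = biprod.lift a b :=
      ⟨y ≫ biprod.fst, y ≫ biprod.snd, by ext <;> simp⟩
    obtain rfl : y = 0 := P.zero_of_ι (by simpa using h₁)
    obtain rfl : z = 0 := Q.zero_of_ι (by simpa using h₂)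
    obtain rfl : w = 0 := R.zero_of_ι (by simpa using h₃)
    exact ⟨by ext <;> simp, rfl⟩

lemma add_assoc (P Q R : Butterfly X Y) : ((P.add Q).add R).Equiv (P.add (Q.add R)) := by
  have c := pullback.condition (f := P.σ) (g := Q.σ)
  have c' := pullback.condition (f := pullback.fst P.σ Q.σ ≫ P.σ) (g := R.σ)
  refine Equiv.trans (Equiv.symm (Q := _) ((preAdd₃ P Q R).equiv_of_map _
    (addMk (P.add Q) R (addMk P Q (pullback.fst _ _ ≫ pullback.fst _ _)
      (pullback.fst _ _ ≫ pullback.snd _ _) (by simp [c])) (pullback.snd _ _)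
        (by simpa using c') : pullback (pullback.fst P.σ Q.σ ≫ P.σ) R.σ ⟶ _)
    ?_ ?_ ?_ ?_ ?_)) ((preAdd₃ P Q R).equiv_of_map _
    (addMk P (Q.add R) (pullback.fst _ _ ≫ pullback.fst _ _)
      (addMk Q R (pullback.fst _ _ ≫ pullback.snd _ _) (pullback.snd _ _)
        (by simpa [c] using c')) (by simp [c]) : pullback (pullback.fst P.σ Q.σ ≫ P.σ) R.σ ⟶ _)
    ?_ ?_ ?_ ?_ ?_)
  all_goals dsimp only [preAdd₃]
  · refine biprod_eq_zero _ ?_ ?_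
    · rw [biprod.inl_desc_assoc, precomp_addMk]
      refine addMk_eq_zero _ _ 0 ?_ (by simp)
      rw [precomp_addMk, zero_comp]
      exact addMk_eq_zero _ _ (𝟙 _) (by simp) (by simp)
    · rw [biprod.inr_desc_assoc, precomp_addMk]
      refine addMk_eq_zero _ _ (𝟙 _) ?_ (by simp)
      rw [precomp_addMk, add_ι, Category.id_comp]
      congr 1 <;> simp
  · rw [precomp_addMk, add_κ]
    congr 1
    · rw [precomp_addMk, add_κ]
      congr 1 <;> simp
    · simp
  · rw [precomp_addMk, add_ι]
    congr 1
    · rw [precomp_addMk]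
      exact addMk_eq_zero _ _ 0 (by simp) (by simp)
    · simp
  · simp [c']
  · simp
  · refine biprod_eq_zero _ ?_ ?_
    · rw [biprod.inl_desc_assoc, precomp_addMk]
      refine addMk_eq_zero _ _ (𝟙 _) (by simp) ?_
      have e : -(Q.add R).ι = (-𝟙 Y.src) ≫ (Q.add R).ι := by simp
      rw [Category.id_comp, e, add_ι, precomp_addMk, precomp_addMk]
      exact addMk_eq _ _ (-𝟙 _) (by simp) (by simp)
    · rw [biprod.inr_desc_assoc, precomp_addMk]
      refine addMk_eq_zero _ _ 0 (by simp) ?_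
      rw [precomp_addMk, zero_comp, neg_zero]
      exact addMk_eq_zero _ _ (𝟙 _) (by simp) (by simp)
  · rw [precomp_addMk, add_κ]
    congr 1
    · simp
    · rw [precomp_addMk, add_κ]
      congr 1 <;> simp
  · rw [precomp_addMk, add_ι]
    congr 1
    · simp
    · rw [precomp_addMk, add_ι]
      congr 1 <;> simp
  · simp [c']
  · simp [_root_.add_assoc]

lemma add_comm (P Q : Butterfly X Y) : (P.add Q).Equiv (Q.add P) := by
  have c := pullback.condition (f := P.σ) (g := Q.σ)
  refine add_equiv P Q _ (addMk Q P (pullback.snd _ _) (pullback.fst _ _) c.symm) ?_ ?_ ?_ ?_ ?_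
  · rw [precomp_addMk]
    exact addMk_eq_zero _ _ (-𝟙 _) (by simp) (by simp)
  · rw [precomp_addMk, add_κ]
    congr 1 <;> simp
  · rw [precomp_addMk, add_ι]
    exact addMk_eq _ _ (𝟙 _) (by simp) (by simp)
  · simp [c]
  · rw [addMk_ρ]
    exact _root_.add_comm _ _

lemma zero_add (P : Butterfly X Y) : ((zero X Y).add P).Equiv P := by
  have c := pullback.condition (f := (zero X Y).σ) (g := P.σ)
  have h₁ := strict_κ_snd (0 : X.src ⟶ Y.src) (0 : X.tgt ⟶ Y.tgt) (by simp)
  have h₂ := strict_ι_snd (0 : X.src ⟶ Y.src) (0 : X.tgt ⟶ Y.tgt) (by simp)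
  refine add_equiv _ _ _
    (pullback.snd _ _ + pullback.fst (zero X Y).σ P.σ ≫ strictSnd _ _ _ ≫ P.ι) ?_ ?_ ?_ ?_ ?_
  · simp [reassoc_of% h₂]
  · simp [reassoc_of% h₁]
  · simp
  · simp [← c]
  · simp only [Preadditive.add_comp, Category.assoc, strict_ρ, comp_zero, _root_.zero_add, ι_ρ]
    exact _root_.add_comm _ _

/-- The identification of the middle object of `P.neg` with that of `P`. -/
noncomputable def negπ (P : Butterfly X Y) : P.neg.E ⟶ P.E := 𝟙 P.E

lemma negπ_κ (P : Butterfly X Y) : P.neg.κ ≫ negπ P = P.κ := Category.comp_id _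
lemma negπ_ι (P : Butterfly X Y) : P.neg.ι ≫ negπ P = -P.ι := Category.comp_id _
lemma negπ_σ (P : Butterfly X Y) : negπ P ≫ P.σ = P.neg.σ := Category.id_comp _
lemma negπ_ρ (P : Butterfly X Y) : negπ P ≫ P.ρ = -P.neg.ρ :=
  (Category.id_comp _).trans (neg_neg _).symm

lemma neg_add_cancel (P : Butterfly X Y) : (P.neg.add P).Equiv (zero X Y) := by
  have c := pullback.condition (f := P.neg.σ) (g := P.σ)
  obtain ⟨w, hw⟩ := P.exists_lift
    (pullback.snd _ _ - pullback.fst P.neg.σ P.σ ≫ negπ P) (by simp [negπ_σ, c])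
  have h {T : A} (t : T ⟶ pullback P.neg.σ P.σ) (z : T ⟶ Y.src)
      (h : t ≫ pullback.snd _ _ = t ≫ pullback.fst P.neg.σ P.σ ≫ negπ P + z ≫ P.ι) :
      t ≫ w = z := by
    rw [← cancel_mono P.ι, Category.assoc, ← hw, Preadditive.comp_sub, h, add_sub_cancel_left]
  refine add_equiv _ _ _ (strictMk _ _ _ (pullback.fst _ _ ≫ P.neg.σ) w) ?_ ?_ ?_ ?_ ?_
  · refine strict_ext (by simp [precomp_strictMk]) ?_
    rw [precomp_strictMk, strictMk_snd, h _ 0 (by simp [negπ_ι]), zero_comp]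
  · refine strict_ext (by simp [precomp_strictMk]) ?_
    rw [precomp_strictMk, strictMk_snd, h _ 0 (by simp [negπ_κ]), strict_κ_snd, neg_zero]
  · refine strict_ext (by simp [precomp_strictMk]) ?_
    rw [precomp_strictMk, strictMk_snd, h _ (𝟙 _) (by simp), strict_ι_snd]
  · simp
  · rw [strictMk_ρ, comp_zero, _root_.zero_add, ← P.ι_ρ, ← Category.assoc, ← hw]
    simp [negπ_ρ]
    exact _root_.add_comm _ _

/-- A common presentation of `(P.add P').comp Q` and `(P.comp Q).add (P'.comp Q)`. -/
noncomputable def preAddComp (P P' : Butterfly X Y) (Q : Butterfly Y Z) : PreButterfly X Z where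
  L := pullback (pullback.fst P.ρ Q.σ ≫ P.σ) (pullback.fst P'.ρ Q.σ ≫ P'.σ)
  J := (Y.src ⊞ Y.src) ⊞ Z.src
  j := biprod.desc (biprod.desc
      (pullback.lift (pullback.lift P.ι Q.κ (by simp)) 0 (by simp))
      (pullback.lift 0 (pullback.lift P'.ι Q.κ (by simp)) (by simp)))
    (pullback.lift (pullback.lift 0 Q.ι (by simp)) (pullback.lift 0 (-Q.ι) (by simp)) (by simp))
  k := pullback.lift (pullback.lift P.κ 0 (by simp)) (pullback.lift P'.κ 0 (by simp)) (by simp)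
  i := pullback.lift 0 (pullback.lift 0 Q.ι (by simp)) (by simp)
  s := pullback.fst _ _ ≫ pullback.fst _ _ ≫ P.σ
  r := pullback.fst _ _ ≫ pullback.snd _ _ ≫ Q.ρ + pullback.snd _ _ ≫ pullback.snd _ _ ≫ Q.ρ
  j_s := by ext <;> simp
  j_r := by ext <;> simp
  k_s := by simp
  i_r := by simp
  k_r := by simp
  i_s := by simp
  epi_s := inferInstance
  exact := fun t ht => by
    have c : t ≫ pullback.fst _ _ ≫ pullback.fst _ _ ≫ P.σ =
        t ≫ pullback.snd _ _ ≫ pullback.fst _ _ ≫ P'.σ := by rw [pullback.condition]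
    have c₁ : t ≫ pullback.fst _ _ ≫ pullback.fst _ _ ≫ P.ρ =
        t ≫ pullback.fst _ _ ≫ pullback.snd _ _ ≫ Q.σ := by rw [pullback.condition]
    have c₂ : t ≫ pullback.snd _ _ ≫ pullback.fst _ _ ≫ P'.ρ =
        t ≫ pullback.snd _ _ ≫ pullback.snd _ _ ≫ Q.σ := by rw [pullback.condition]
    obtain ⟨y, hy⟩ := P.exists_lift (t ≫ pullback.fst _ _ ≫ pullback.fst _ _) (by simpa using ht)
    obtain ⟨y', hy'⟩ := P'.exists_lift (t ≫ pullback.snd _ _ ≫ pullback.fst _ _)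
      (by simpa [← c] using ht)
    have e := congrArg (fun f => f ≫ P.ρ) hy
    have e' := congrArg (fun f => f ≫ P'.ρ) hy'
    obtain ⟨z, hz⟩ := Q.exists_lift (t ≫ pullback.fst _ _ ≫ pullback.snd _ _ - y ≫ Q.κ)
      (by simp [← c₁] at e ⊢; simp [e])
    obtain ⟨z', hz'⟩ := Q.exists_lift (t ≫ pullback.snd _ _ ≫ pullback.snd _ _ - y' ≫ Q.κ)
      (by simp [← c₂] at e' ⊢; simp [e'])
    rw [sub_eq_iff_eq_add] at hz hz'
    refine ⟨biprod.lift (biprod.lift y y') z, z + z',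
      pullback.hom_ext (pullback.hom_ext ?_ ?_) (pullback.hom_ext ?_ ?_)⟩
    · simp [hy]
    · simp [hz]
      abel
    · simp [hy']
    · simp [hz']
      abel
  inj := fun y w h => by
    have h₁ := congrArg (fun f => f ≫ pullback.fst _ _ ≫ pullback.fst _ _) h
    have h₂ := congrArg (fun f => f ≫ pullback.snd _ _ ≫ pullback.fst _ _) h
    have h₃ := congrArg (fun f => f ≫ pullback.fst _ _ ≫ pullback.snd _ _) h
    have h₄ := congrArg (fun f => f ≫ pullback.snd _ _ ≫ pullback.snd _ _) h
    obtain ⟨y, y', z, rfl⟩ : ∃ a b c, y = biprod.lift (biprod.lift a b) c :=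
      ⟨y ≫ biprod.fst ≫ biprod.fst, y ≫ biprod.fst ≫ biprod.snd, y ≫ biprod.snd,
        by ext <;> simp⟩
    obtain rfl : y = 0 := P.zero_of_ι (by simpa using h₁)
    obtain rfl : y' = 0 := P'.zero_of_ι (by simpa using h₂)
    obtain rfl : z = 0 := Q.zero_of_ι (by simpa using h₃)
    obtain rfl : w = 0 := Q.zero_of_ι (by simpa using h₄)
    exact ⟨by ext <;> simp, rfl⟩

set_option maxHeartbeats 1000000 in
lemma preAddComp_left (P P' : Butterfly X Y) (Q : Butterfly Y Z) :
    (preAddComp P P' Q).toButterfly.Equiv ((P.add P').comp Q) := by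
  have c := pullback.condition (f := pullback.fst P.ρ Q.σ ≫ P.σ)
    (g := pullback.fst P'.ρ Q.σ ≫ P'.σ)
  have c₁ := pullback.condition (f := P.ρ) (g := Q.σ)
  have c₂ := pullback.condition (f := P'.ρ) (g := Q.σ)
  refine (preAddComp P P' Q).equiv_of_map _
    (compMk (P.add P') Q (addMk P P' (pullback.fst _ _ ≫ pullback.fst _ _)
      (pullback.snd _ _ ≫ pullback.fst _ _) (by simpa using c))
      (pullback.fst _ _ ≫ pullback.snd _ _ + pullback.snd _ _ ≫ pullback.snd _ _)
        (by simp [c₁, c₂]) :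
      pullback (pullback.fst P.ρ Q.σ ≫ P.σ) (pullback.fst P'.ρ Q.σ ≫ P'.σ) ⟶ _)
    ?_ ?_ ?_ ?_ ?_
  all_goals dsimp only [preAddComp]
  · refine biprod₃_eq_zero _ ?_ ?_ ?_
    · rw [biprod.inl_desc_assoc, biprod.inl_desc_assoc, precomp_compMk]
      refine compMk_eq_zero _ _ (𝟙 _) ?_ (by simp)
      rw [precomp_addMk, add_ι, Category.id_comp]
      exact addMk_eq _ _ (𝟙 _) (by simp) (by simp)
    · rw [biprod.inl_desc_assoc, biprod.inr_desc_assoc, precomp_compMk]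
      refine compMk_eq_zero _ _ (𝟙 _) ?_ (by simp)
      rw [precomp_addMk, add_ι, Category.id_comp]
      congr 1 <;> simp
    · rw [biprod.inr_desc_assoc, precomp_compMk]
      refine compMk_eq_zero _ _ 0 ?_ (by simp)
      rw [precomp_addMk, zero_comp]
      exact addMk_eq_zero _ _ 0 (by simp) (by simp)
  · rw [precomp_compMk, comp_κ]
    congr 1
    · rw [precomp_addMk, add_κ]
      congr 1 <;> simp
    · simp
  · rw [precomp_compMk, comp_ι]
    congr 1
    · rw [precomp_addMk]
      exact addMk_eq_zero _ _ 0 (by simp) (by simp)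
    · simp
  · simp
  · simp

set_option maxHeartbeats 1000000 in
lemma preAddComp_right (P P' : Butterfly X Y) (Q : Butterfly Y Z) :
    (preAddComp P P' Q).toButterfly.Equiv ((P.comp Q).add (P'.comp Q)) := by
  have c := pullback.condition (f := pullback.fst P.ρ Q.σ ≫ P.σ)
    (g := pullback.fst P'.ρ Q.σ ≫ P'.σ)
  have c₁ := pullback.condition (f := P.ρ) (g := Q.σ)
  have c₂ := pullback.condition (f := P'.ρ) (g := Q.σ)
  refine (preAddComp P P' Q).equiv_of_map _
    (addMk (P.comp Q) (P'.comp Q)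
      (compMk P Q (pullback.fst _ _ ≫ pullback.fst _ _) (pullback.fst _ _ ≫ pullback.snd _ _)
        (by simp [c₁]))
      (compMk P' Q (pullback.snd _ _ ≫ pullback.fst _ _) (pullback.snd _ _ ≫ pullback.snd _ _)
        (by simp [c₂])) (by simpa using c) :
      pullback (pullback.fst P.ρ Q.σ ≫ P.σ) (pullback.fst P'.ρ Q.σ ≫ P'.σ) ⟶ _)
    ?_ ?_ ?_ ?_ ?_
  all_goals dsimp only [preAddComp]
  · refine biprod₃_eq_zero _ ?_ ?_ ?_
    · rw [biprod.inl_desc_assoc, biprod.inl_desc_assoc, precomp_addMk]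
      refine addMk_eq_zero _ _ 0 ?_ ?_
      · rw [precomp_compMk, zero_comp]
        exact compMk_eq_zero _ _ (𝟙 _) (by simp) (by simp)
      · rw [precomp_compMk, zero_comp, neg_zero]
        exact compMk_eq_zero _ _ 0 (by simp) (by simp)
    · rw [biprod.inl_desc_assoc, biprod.inr_desc_assoc, precomp_addMk]
      refine addMk_eq_zero _ _ 0 ?_ ?_
      · rw [precomp_compMk, zero_comp]
        exact compMk_eq_zero _ _ 0 (by simp) (by simp)
      · rw [precomp_compMk, zero_comp, neg_zero]
        exact compMk_eq_zero _ _ (𝟙 _) (by simp) (by simp)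
    · rw [biprod.inr_desc_assoc, precomp_addMk]
      refine addMk_eq_zero _ _ (𝟙 _) ?_ ?_
      · rw [precomp_compMk, comp_ι, Category.id_comp]
        congr 1 <;> simp
      · rw [precomp_compMk, comp_ι, ← Preadditive.neg_comp, precomp_compMk]
        congr 1 <;> simp
  · rw [precomp_addMk, add_κ]
    congr 1
    · rw [precomp_compMk, comp_κ]
      congr 1 <;> simp
    · rw [precomp_compMk, comp_κ]
      congr 1 <;> simp
  · rw [precomp_addMk, add_ι]
    congr 1
    · rw [precomp_compMk]
      exact compMk_eq_zero _ _ 0 (by simp) (by simp)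
    · rw [precomp_compMk, comp_ι]
      congr 1 <;> simp
  · simp
  · simp

lemma add_comp (P P' : Butterfly X Y) (Q : Butterfly Y Z) :
    ((P.add P').comp Q).Equiv ((P.comp Q).add (P'.comp Q)) :=
  (preAddComp_left P P' Q).symm.trans (preAddComp_right P P' Q)

/-- A common presentation of `P.comp (Q.add Q')` and `(P.comp Q).add (P.comp Q')`. -/
noncomputable def preCompAdd (P : Butterfly X Y) (Q Q' : Butterfly Y Z) : PreButterfly X Z where
  L := pullback (pullback.snd P.ρ Q.σ ≫ Q.σ) Q'.σ
  J := Y.src ⊞ Z.src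
  j := biprod.desc (pullback.lift (pullback.lift P.ι Q.κ (by simp)) Q'.κ (by simp))
    (pullback.lift (pullback.lift 0 Q.ι (by simp)) (-Q'.ι) (by simp))
  k := pullback.lift (pullback.lift P.κ 0 (by simp)) 0 (by simp)
  i := pullback.lift 0 Q'.ι (by simp)
  s := pullback.fst _ _ ≫ pullback.fst _ _ ≫ P.σ
  r := pullback.fst _ _ ≫ pullback.snd _ _ ≫ Q.ρ + pullback.snd _ _ ≫ Q'.ρ
  j_s := by ext <;> simp
  j_r := by ext <;> simp
  k_s := by simp
  i_r := by simp
  k_r := by simp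
  i_s := by simp
  epi_s := inferInstance
  exact := fun t ht => by
    have c : t ≫ pullback.fst _ _ ≫ pullback.fst _ _ ≫ P.ρ =
        t ≫ pullback.fst _ _ ≫ pullback.snd _ _ ≫ Q.σ := by rw [pullback.condition]
    have c' : t ≫ pullback.fst _ _ ≫ pullback.snd _ _ ≫ Q.σ = t ≫ pullback.snd _ _ ≫ Q'.σ := by
      rw [pullback.condition]
    obtain ⟨y, hy⟩ := P.exists_lift (t ≫ pullback.fst _ _ ≫ pullback.fst _ _) (by simpa using ht)
    have e := congrArg (fun f => f ≫ P.ρ) hy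
    simp only [Category.assoc, c, ι_ρ] at e
    obtain ⟨z, hz⟩ := Q.exists_lift (t ≫ pullback.fst _ _ ≫ pullback.snd _ _ - y ≫ Q.κ)
      (by simp [e])
    obtain ⟨z', hz'⟩ := Q'.exists_lift (t ≫ pullback.snd _ _ - y ≫ Q'.κ)
      (by simp [← c', e])
    rw [sub_eq_iff_eq_add] at hz hz'
    refine ⟨biprod.lift y z, z + z', pullback.hom_ext (pullback.hom_ext ?_ ?_) ?_⟩
    · simp [hy]
    · simp [hz]
      abel
    · simp [hz']
      abel
  inj := fun y w h => by
    have h₁ := congrArg (fun f => f ≫ pullback.fst _ _ ≫ pullback.fst _ _) h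
    have h₂ := congrArg (fun f => f ≫ pullback.fst _ _ ≫ pullback.snd _ _) h
    have h₃ := congrArg (fun f => f ≫ pullback.snd _ _) h
    obtain ⟨y, z, rfl⟩ : ∃ a b, y = biprod.lift a b :=
      ⟨y ≫ biprod.fst, y ≫ biprod.snd, by ext <;> simp⟩
    obtain rfl : y = 0 := P.zero_of_ι (by simpa using h₁)
    obtain rfl : z = 0 := Q.zero_of_ι (by simpa using h₂)
    obtain rfl : w = 0 := Q'.zero_of_ι (by simpa using h₃)
    exact ⟨by ext <;> simp, rfl⟩

lemma comp_add (P : Butterfly X Y) (Q Q' : Butterfly Y Z) :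
    (P.comp (Q.add Q')).Equiv ((P.comp Q).add (P.comp Q')) := by
  have c := pullback.condition (f := P.ρ) (g := Q.σ)
  have c' := pullback.condition (f := pullback.snd P.ρ Q.σ ≫ Q.σ) (g := Q'.σ)
  refine Equiv.trans (Equiv.symm (Q := _) ((preCompAdd P Q Q').equiv_of_map _
    (compMk P (Q.add Q') (pullback.fst _ _ ≫ pullback.fst _ _)
      (addMk Q Q' (pullback.fst _ _ ≫ pullback.snd _ _) (pullback.snd _ _) (by simp [c']))
        (by simp [c]) : pullback (pullback.snd P.ρ Q.σ ≫ Q.σ) Q'.σ ⟶ _)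
    ?_ ?_ ?_ ?_ ?_)) ((preCompAdd P Q Q').equiv_of_map _
    (addMk (P.comp Q) (P.comp Q')
      (compMk P Q (pullback.fst _ _ ≫ pullback.fst _ _) (pullback.fst _ _ ≫ pullback.snd _ _)
        (by simp [c]))
      (compMk P Q' (pullback.fst _ _ ≫ pullback.fst _ _) (pullback.snd _ _)
        (by simp [c, c'])) (by simp) : pullback (pullback.snd P.ρ Q.σ ≫ Q.σ) Q'.σ ⟶ _)
    ?_ ?_ ?_ ?_ ?_)
  all_goals dsimp only [preCompAdd]
  · refine biprod_eq_zero _ ?_ ?_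
    · rw [biprod.inl_desc_assoc, precomp_compMk]
      refine compMk_eq_zero _ _ (𝟙 _) (by simp) ?_
      rw [precomp_addMk, add_κ, Category.id_comp]
      congr 1 <;> simp
    · rw [biprod.inr_desc_assoc, precomp_compMk]
      refine compMk_eq_zero _ _ 0 (by simp) ?_
      rw [precomp_addMk, zero_comp]
      exact addMk_eq_zero _ _ (𝟙 _) (by simp) (by simp)
  · rw [precomp_compMk, comp_κ]
    congr 1
    · simp
    · rw [precomp_addMk]
      exact addMk_eq_zero _ _ 0 (by simp) (by simp)
  · rw [precomp_compMk, comp_ι]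
    congr 1
    · simp
    · rw [precomp_addMk, add_ι]
      congr 1 <;> simp
  · simp
  · simp
  · refine biprod_eq_zero _ ?_ ?_
    · rw [biprod.inl_desc_assoc, precomp_addMk]
      refine addMk_eq_zero _ _ 0 ?_ ?_
      · rw [precomp_compMk, zero_comp]
        exact compMk_eq_zero _ _ (𝟙 _) (by simp) (by simp)
      · rw [precomp_compMk, zero_comp, neg_zero]
        exact compMk_eq_zero _ _ (𝟙 _) (by simp) (by simp)
    · rw [biprod.inr_desc_assoc, precomp_addMk]
      refine addMk_eq_zero _ _ (𝟙 _) ?_ ?_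
      · rw [precomp_compMk, comp_ι, Category.id_comp]
        congr 1 <;> simp
      · rw [precomp_compMk, comp_ι, ← Preadditive.neg_comp, precomp_compMk]
        congr 1 <;> simp
  · rw [precomp_addMk, add_κ]
    congr 1
    · rw [precomp_compMk, comp_κ]
      congr 1 <;> simp
    · rw [precomp_compMk, comp_κ]
      congr 1 <;> simp
  · rw [precomp_addMk, add_ι]
    congr 1
    · rw [precomp_compMk]
      exact compMk_eq_zero _ _ 0 (by simp) (by simp)
    · rw [precomp_compMk, comp_ι]
      congr 1 <;> simp
  · simp
  · simp

end Butterfly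
/-- The category of two-term complexes in `A` and isomorphism classes of butterflies. -/
noncomputable instance TwoTerm.category : Category.{max u v} (TwoTerm A) where
  Hom X Y := Quotient (Butterfly.setoid X Y)
  id X := ⟦Butterfly.id X⟧
  comp := Quotient.map₂ Butterfly.comp fun _ _ h _ _ h' => h.comp h'
  id_comp := by
    rintro X Y ⟨P⟩
    exact Quotient.sound P.id_comp
  comp_id := by
    rintro X Y ⟨P⟩
    exact Quotient.sound P.comp_id
  assoc := by
    rintro X Y Z W ⟨P⟩ ⟨Q⟩ ⟨R⟩
    exact Quotient.sound (P.comp_assoc Q R)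

/-- The morphism of two-term complexes represented by a butterfly. -/
def Butterfly.toHom {X Y : TwoTerm A} (P : Butterfly X Y) : X ⟶ Y :=
  (⟦P⟧ : Quotient (Butterfly.setoid X Y))

lemma Butterfly.toHom_eq_iff {X Y : TwoTerm A} (P Q : Butterfly X Y) :
    P.toHom = Q.toHom ↔ P.Equiv Q :=
  ⟨fun h => Quotient.exact h, fun h => Quotient.sound h⟩

lemma Butterfly.toHom_comp {X Y Z : TwoTerm A} (P : Butterfly X Y) (Q : Butterfly Y Z) :
    P.toHom ≫ Q.toHom = (P.comp Q).toHom := rfl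

/-- Addition of (isomorphism classes of) butterflies. -/
noncomputable instance TwoTerm.homAdd (X Y : TwoTerm A) : Add (X ⟶ Y) :=
  ⟨Quotient.map₂ Butterfly.add fun _ _ h _ _ h' => h.add h'⟩

/-- The class of the zero butterfly. -/
noncomputable instance TwoTerm.homZero (X Y : TwoTerm A) : Zero (X ⟶ Y) :=
  ⟨(Butterfly.zero X Y).toHom⟩

/-- The negative `(E, κ, -ι, σ, -ρ)` of a butterfly. -/
noncomputable instance TwoTerm.homNeg (X Y : TwoTerm A) : Neg (X ⟶ Y) :=
  ⟨Quotient.map Butterfly.neg fun _ _ h => h.neg⟩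

noncomputable instance TwoTerm.addCommGroup (X Y : TwoTerm A) : AddCommGroup (X ⟶ Y) where
  add_assoc := by
    rintro ⟨P⟩ ⟨Q⟩ ⟨R⟩
    exact Quotient.sound (P.add_assoc Q R)
  zero_add := by
    rintro ⟨P⟩
    exact Quotient.sound P.zero_add
  add_zero := by
    rintro ⟨P⟩
    exact Quotient.sound ((P.add_comm _).trans P.zero_add)
  add_comm := by
    rintro ⟨P⟩ ⟨Q⟩
    exact Quotient.sound (P.add_comm Q)
  neg_add_cancel := by
    rintro ⟨P⟩
    exact Quotient.sound P.neg_add_cancel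
  nsmul := nsmulRec
  zsmul := zsmulRec

noncomputable instance TwoTerm.preadditive : Preadditive (TwoTerm A) where
  add_comp := by
    rintro X Y Z ⟨P⟩ ⟨P'⟩ ⟨Q⟩
    exact Quotient.sound (P.add_comp P' Q)
  comp_add := by
    rintro X Y Z ⟨P⟩ ⟨Q⟩ ⟨Q'⟩
    exact Quotient.sound (P.comp_add Q Q')

/-- The functor sending a morphism of two-term complexes to its strict butterfly. -/
noncomputable def strictFunctor (A : Type u) [Category.{v} A] [Abelian A] :
    Arrow A ⥤ TwoTerm A where
  obj X := ⟨X.left, X.right, X.hom⟩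
  map f := (Butterfly.strict f.left f.right (Arrow.w f)).toHom
  map_id _ := rfl
  map_comp _ _ := Quotient.sound (Butterfly.strict_comp _ _ _ _ _ _).symm

end Butterflies

section Tilting

variable {A : Type u} [Category.{v} A] [Abelian A]

/-- The two-term complexes `d` with `ker d` in `F` and `coker d` in `T`. -/
def tiltProperty (T F : ObjectProperty A) : ObjectProperty (TwoTerm A) :=
  fun X => F (kernel X.d) ∧ T (cokernel X.d)

/-- The category obtained by tilting `A` with respect to the torsion pair `(T, F)`: its objects
are the two-term complexes `d` with `ker d` in `F` and `coker d` in `T`, its morphisms are the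
isomorphism classes of butterflies. -/
abbrev HRSTilt (T F : ObjectProperty A) := (tiltProperty T F).FullSubcategory

/-- The subcategory `F[1]` of the tilt: the objects isomorphic to a complex `[F ⟶ 0]`. -/
def tiltTors (T F : ObjectProperty A) : ObjectProperty (HRSTilt T F) :=
  fun X => ∃ Y : HRSTilt T F, IsZero Y.obj.tgt ∧ Nonempty (X ≅ Y)

/-- The subcategory `T` of the tilt: the objects isomorphic to a complex `[0 ⟶ T]`. -/
def tiltFree (T F : ObjectProperty A) : ObjectProperty (HRSTilt T F) :=
  fun X => ∃ Y : HRSTilt T F, IsZero Y.obj.src ∧ Nonempty (X ≅ Y)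

/-- A quadruple `[K₁ ⊆ K₂ ⊆ E ⊇ M]` with `K₂ ∩ M` in `F` and `E / (K₁ + M)` in `T`. -/
structure Quad (T F : ObjectProperty A) where
  E : A
  K₁ : Subobject E
  K₂ : Subobject E
  M : Subobject E
  le : K₁ ≤ K₂
  free : F ((K₂ ⊓ M : Subobject E) : A)
  tors : T (cokernel (K₁ ⊔ M).arrow)

namespace Quad

variable {T F : ObjectProperty A}

/-- A morphism of quadruples: a morphism `E ⟶ E'` which maps `K₁` to `K₁'`, `K₂` to `K₂'` and `M`
to `M'`. -/
@[ext]
structure Hom (Z Z' : Quad T F) where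
  f : Z.E ⟶ Z'.E
  map₁ : Z'.K₁.Factors (Z.K₁.arrow ≫ f)
  map₂ : Z'.K₂.Factors (Z.K₂.arrow ≫ f)
  mapM : Z'.M.Factors (Z.M.arrow ≫ f)

lemma factors_comp {A : Type u} [Category.{v} A] {E E' E'' : A} {K : Subobject E} {K' : Subobject E'} {K'' : Subobject E''}
    {f : E ⟶ E'} {g : E' ⟶ E''} (h : K'.Factors (K.arrow ≫ f)) (h' : K''.Factors (K'.arrow ≫ g)) :
    K''.Factors (K.arrow ≫ f ≫ g) := by
  rw [← Category.assoc, ← K'.factorThru_arrow _ h, Category.assoc]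
  exact K''.factors_of_factors_right _ h'

instance : Category (Quad T F) where
  Hom := Hom
  id Z := ⟨𝟙 _, by simpa using Z.K₁.factors_self, by simpa using Z.K₂.factors_self,
    by simpa using Z.M.factors_self⟩
  comp f g := ⟨f.f ≫ g.f, factors_comp f.map₁ g.map₁, factors_comp f.map₂ g.map₂,
    factors_comp f.mapM g.mapM⟩
  id_comp f := Hom.ext (Category.id_comp f.f)
  comp_id f := Hom.ext (Category.comp_id f.f)
  assoc f g h := Hom.ext (Category.assoc f.f g.f h.f)

@[simp] lemma id_f (Z : Quad T F) : Hom.f (𝟙 Z) = 𝟙 Z.E := rfl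
@[simp] lemma comp_f {Z Z' Z'' : Quad T F} (f : Z ⟶ Z') (g : Z' ⟶ Z'') :
    Hom.f (f ≫ g) = Hom.f f ≫ Hom.f g := rfl

/-- The functor `[K₁ ⊆ K₂ ⊆ E ⊇ M] ↦ K₂ / K₁`. -/
noncomputable def quotient (T F : ObjectProperty A) : Quad T F ⥤ A where
  obj Z := cokernel (Subobject.ofLE Z.K₁ Z.K₂ Z.le)
  map {Z Z'} f := cokernel.map _ _ (Z'.K₁.factorThru _ f.map₁) (Z'.K₂.factorThru _ f.map₂)
    (by rw [← cancel_mono Z'.K₂.arrow]; simp)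
  map_id Z := by
    rw [← cancel_epi (cokernel.π _), cokernel.π_desc, Category.comp_id]
    have : Z.K₂.factorThru _ (Hom.map₂ (𝟙 Z)) = 𝟙 _ := by
      rw [← cancel_mono Z.K₂.arrow]; simp
    rw [this, Category.id_comp]
  map_comp {Z Z' Z''} f g := by
    rw [← cancel_epi (cokernel.π _)]
    simp only [cokernel.π_desc, cokernel.π_desc_assoc, Category.assoc]
    rw [← Category.assoc]
    congr 1
    rw [← cancel_mono Z''.K₂.arrow]
    simp

/-- The two-term complex `X = [K₁ ⟶ E / M]` attached to a quadruple. -/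
noncomputable def srcArrow (T F : ObjectProperty A) : Quad T F ⥤ Arrow A where
  obj Z := Arrow.mk (Z.K₁.arrow ≫ cokernel.π Z.M.arrow)
  map {Z Z'} f := Arrow.homMk (Z'.K₁.factorThru _ f.map₁)
    (cokernel.map _ _ (Z'.M.factorThru _ f.mapM) f.f (by simp)) (by simp)
  map_id Z := by
    ext
    · exact (cancel_mono Z.K₁.arrow).1 (by simp)
    · exact (cancel_epi (cokernel.π Z.M.arrow)).1 (by simp)
  map_comp {Z Z' Z''} f g := by
    ext
    · exact (cancel_mono Z''.K₁.arrow).1 (by simp)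
    · exact (cancel_epi (cokernel.π Z.M.arrow)).1 (by simp)

/-- The two-term complex `Y = [M ⟶ E / K₂]` attached to a quadruple. -/
noncomputable def tgtArrow (T F : ObjectProperty A) : Quad T F ⥤ Arrow A where
  obj Z := Arrow.mk (Z.M.arrow ≫ cokernel.π Z.K₂.arrow)
  map {Z Z'} f := Arrow.homMk (Z'.M.factorThru _ f.mapM)
    (cokernel.map _ _ (Z'.K₂.factorThru _ f.map₂) f.f (by simp)) (by simp)
  map_id Z := by
    ext
    · exact (cancel_mono Z.M.arrow).1 (by simp)
    · exact (cancel_epi (cokernel.π Z.K₂.arrow)).1 (by simp)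
  map_comp {Z Z' Z''} f g := by
    ext
    · exact (cancel_mono Z''.M.arrow).1 (by simp)
    · exact (cancel_epi (cokernel.π Z.K₂.arrow)).1 (by simp)

lemma factors_of_comp_π {E V : A} (K : Subobject E) (f : V ⟶ E)
    (h : f ≫ cokernel.π K.arrow = 0) : K.Factors f := by
  have e : (ShortComplex.exact_cokernel K.arrow).lift f h ≫ K.arrow = f :=
    (ShortComplex.exact_cokernel K.arrow).lift_f f h
  rw [← e]
  exact K.factors_comp_arrow _

lemma arrow_comp_π {E : A} {K L : Subobject E} (h : K ≤ L) : K.arrow ≫ cokernel.π L.arrow = 0 := by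
  rw [← Subobject.ofLE_arrow h, Category.assoc, cokernel.condition, comp_zero]

lemma free_kernel (h : IsTorsionPair T F) (Z : Quad T F) {V : A} (t : V ⟶ Z.E) [Mono t]
    (h₁ : t ≫ cokernel.π Z.K₂.arrow = 0) (h₂ : t ≫ cokernel.π Z.M.arrow = 0) : F V := by
  have hf : (Z.K₂ ⊓ Z.M).Factors t :=
    (Subobject.inf_factors t).2 ⟨factors_of_comp_π _ _ h₁, factors_of_comp_π _ _ h₂⟩
  have : Mono ((Z.K₂ ⊓ Z.M).factorThru t hf) :=
    mono_of_mono_fac (Subobject.factorThru_arrow _ _ hf)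
  exact h.free_of_mono ((Z.K₂ ⊓ Z.M).factorThru t hf) Z.free

lemma tors_cokernel (h : IsTorsionPair T F) (Z : Quad T F) {V : A} (p : Z.E ⟶ V) [Epi p]
    (h₁ : Z.K₁.arrow ≫ p = 0) (h₂ : Z.M.arrow ≫ p = 0) : T V := by
  have hle : Z.K₁ ⊔ Z.M ≤ kernelSubobject p :=
    sup_le (le_kernelSubobject p Z.K₁ h₁) (le_kernelSubobject p Z.M h₂)
  have h0 : (Z.K₁ ⊔ Z.M).arrow ≫ p = 0 := by
    rw [← Subobject.ofLE_arrow hle, Category.assoc, kernelSubobject_arrow_comp, comp_zero]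
  have : Epi (cokernel.desc _ p h0) := epi_of_epi_fac (cokernel.π_desc _ p h0)
  exact h.tors_of_epi (cokernel.desc _ p h0) Z.tors

lemma srcArrow_property (h : IsTorsionPair T F) (Z : Quad T F) :
    tiltProperty T F ((srcArrow T F ⋙ strictFunctor A).obj Z) := by
  constructor
  · change F (kernel (Z.K₁.arrow ≫ cokernel.π Z.M.arrow))
    exact Z.free_kernel h (kernel.ι (Z.K₁.arrow ≫ cokernel.π Z.M.arrow) ≫ Z.K₁.arrow)
      (by rw [Category.assoc, arrow_comp_π Z.le, comp_zero]) (by simp)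
  · change T (cokernel (Z.K₁.arrow ≫ cokernel.π Z.M.arrow))
    exact Z.tors_cokernel h
      (cokernel.π Z.M.arrow ≫ cokernel.π (Z.K₁.arrow ≫ cokernel.π Z.M.arrow))
      (by rw [← Category.assoc, cokernel.condition]) (by simp)

lemma tgtArrow_property (h : IsTorsionPair T F) (Z : Quad T F) :
    tiltProperty T F ((tgtArrow T F ⋙ strictFunctor A).obj Z) := by
  constructor
  · change F (kernel (Z.M.arrow ≫ cokernel.π Z.K₂.arrow))
    exact Z.free_kernel h (kernel.ι (Z.M.arrow ≫ cokernel.π Z.K₂.arrow) ≫ Z.M.arrow)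
      (by simp) (by simp)
  · change T (cokernel (Z.M.arrow ≫ cokernel.π Z.K₂.arrow))
    exact Z.tors_cokernel h
      (cokernel.π Z.K₂.arrow ≫ cokernel.π (Z.M.arrow ≫ cokernel.π Z.K₂.arrow))
      (by rw [← Category.assoc, arrow_comp_π Z.le, zero_comp])
      (by rw [← Category.assoc, cokernel.condition])

/-- The object `X = [K₁ ⟶ E / M]` of the tilt. -/
noncomputable def src (h : IsTorsionPair T F) : Quad T F ⥤ HRSTilt T F :=
  (tiltProperty T F).lift (srcArrow T F ⋙ strictFunctor A) (srcArrow_property h)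

/-- The object `Y = [M ⟶ E / K₂]` of the tilt. -/
noncomputable def tgt (h : IsTorsionPair T F) : Quad T F ⥤ HRSTilt T F :=
  (tiltProperty T F).lift (tgtArrow T F ⋙ strictFunctor A) (tgtArrow_property h)

/-- The butterfly from `X = [K₁ ⟶ E / M]` to `Y = [M ⟶ E / K₂]` with middle object `E`, formed by
the inclusions of `K₁` and `M` and the projections to `E / M` and `E / K₂`. -/
noncomputable def butterfly (h : IsTorsionPair T F) (Z : Quad T F) :
    Butterfly ((src h).obj Z).obj ((tgt h).obj Z).obj where
  E := Z.E
  κ := Z.K₁.arrow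
  ι := Z.M.arrow
  σ := cokernel.π Z.M.arrow
  ρ := cokernel.π Z.K₂.arrow
  κ_σ := rfl
  ι_ρ := rfl
  κ_ρ := arrow_comp_π Z.le
  ι_σ := cokernel.condition _
  shortExact := .mk' (ShortComplex.exact_cokernel Z.M.arrow)
    (inferInstanceAs (Mono Z.M.arrow)) (inferInstanceAs (Epi (cokernel.π Z.M.arrow)))

/-- The functor sending `[K₁ ⊆ K₂ ⊆ E ⊇ M]` to the morphism `X ⟶ Y` in the tilt which is
represented by the butterfly with middle object `E`. -/
noncomputable def toArrow (h : IsTorsionPair T F) : Quad T F ⥤ Arrow (HRSTilt T F) where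
  obj Z := Arrow.mk (ObjectProperty.homMk (butterfly h Z).toHom : (src h).obj Z ⟶ (tgt h).obj Z)
  map {Z Z'} f := Arrow.homMk ((src h).map f) ((tgt h).map f) (by
    apply ObjectProperty.hom_ext
    symm
    refine Quotient.sound (Butterfly.strict_square (butterfly h Z) (butterfly h Z')
      (Arrow.w ((srcArrow T F).map f)) (Arrow.w ((tgtArrow T F).map f)) f.f ?_ ?_ ?_ ?_)
    · exact (Subobject.factorThru_arrow _ _ f.map₁).symm
    · exact (Subobject.factorThru_arrow _ _ f.mapM).symm
    · exact (cokernel.π_desc _ _ _).symm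
    · exact (cokernel.π_desc _ _ _).symm)
  map_id Z := by ext <;> simp
  map_comp f g := by ext <;> simp

/-- The functor sending a quadruple to the two-term complex `[X ⟶ Y]` in the tilt, and a morphism
of quadruples to the corresponding strict morphism. -/
noncomputable def toTwoTerm (h : IsTorsionPair T F) [Abelian (HRSTilt T F)] :
    Quad T F ⥤ TwoTerm (HRSTilt T F) :=
  toArrow h ⋙ strictFunctor (HRSTilt T F)

end Quad

end Tilting

/-! Two functors out of the category of quadruples are compared: `Quad.toTilt`, with values in the
iterated tilt C, and `Quad.quotient`, with values K₂/K₁ in A. Both are essentially surjective, both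
present every morphism between objects of their image as a fraction of morphisms of quadruples, and
both kill the same morphisms. Quadruple morphisms can be subtracted, so the two functors also
identify the same morphisms; as C and A are balanced, they invert the same morphisms as well. A
fraction in C can then be read as a fraction in A and conversely, which gives the equivalence H; it
is unique because every morphism of C is a fraction up to isomorphism. This formal part is
`Roof.exists_equivalence`.

Kernels and cokernels in B come from factoring differentials. If d_X = m ∘ a with middle term E',
then [X⁻¹ ⟶ E'] ⟶ X ⟶ [E' ⟶ X⁰] is a kernel-cokernel pair as soon as the outer complexes lie in B
(`HRSTilt.isKernelCokernelPair_factor`). For a butterfly with middle object E, one takes E' between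
im κ and ker ρ with E'/im κ torsion and (ker ρ)/E' torsion-free. Then [X⁻¹ ⟶ E'] is the kernel,
[E/E' ⟶ Y⁰] is the cokernel, and E itself is an invertible butterfly from coimage to image
(`HRSTilt.exists_factorization`). Hence B is abelian, and a morphism of B is an object of C exactly
when κ is mono and ρ is epi (`HRSTilt.tiltProperty_iff`). In that case X⁻¹ ⊆ ker ρ ⊆ E ⊇ Y⁻¹ is a
quadruple, so `Quad.toTilt` is essentially surjective.

Fractions in C arise because any butterfly is a fraction of strict ones, through `Butterfly.roof`.
This is used on two levels: a morphism of C is a fraction of commutative squares in B, and the sides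
of such a square are butterflies in A, which are resolved again (`Quad.exists_hom_of_square`).
Fractions for K₂/K₁ come from graphs of morphisms (`Quad.quotient_hasRoofs`). The tilting or
cotilting hypothesis provides the essential surjectivity of K₂/K₁ (`Quad.quotient_essSurj`).

That the same morphisms die is `Quad.toTilt_map_eq_zero_iff`. If f maps K₂ into K₁', it factors
through the quadruple with K₂' replaced by K₁', whose object of C is an isomorphism X ⟶ Y and
therefore zero. Conversely, a null-homotopy in C reduces the claim to morphisms that vanish on both
X and Y; subtracting the two null-homotopies in A leaves a map E/(K₁ + M) ⟶ K₂' ∩ M' from a torsion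
to a torsion-free object. -/

namespace Roof

/-! ### Functors with roofs that kill the same morphisms -/

variable {S C D : Type*} [Category* S] [Category* C] [Category* D]

/-- Every morphism between objects in the image of `i` is represented by a roof `i s⁻¹ ≫ i f`. -/
structure HasRoofs (i : S ⥤ C) : Prop where
  exists_roof : ∀ {a b : S} (g : i.obj a ⟶ i.obj b), ∃ (c : S) (s : c ⟶ a) (f : c ⟶ b),
    IsIso (i.map s) ∧ i.map s ≫ g = i.map f

section reflect

variable [Preadditive C] [Preadditive D] {i : S ⥤ C} {q : S ⥤ D}

/-- Vanishing is the only property visible to both functors. A test morphism v with v ≫ q(s) = 0 is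
a fraction with some numerator k; then q(k ≫ s) and so i(k ≫ s) vanish, i(s) cancels, and k dies
under both functors. -/
lemma mono_map (hq : HasRoofs q) [q.EssSurj]
    (h0 : ∀ {a b : S} (f : a ⟶ b), i.map f = 0 ↔ q.map f = 0) {a b : S} (s : a ⟶ b)
    [IsIso (i.map s)] : Mono (q.map s) := by
  refine Preadditive.mono_of_cancel_zero _ fun {Z} v hv => ?_
  let e := q.objObjPreimageIso Z
  obtain ⟨w, t, k, ht, hk⟩ := hq.exists_roof (e.hom ≫ v)
  have hks : q.map (k ≫ s) = 0 := by simp [← hk, hv]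
  have hik : i.map k = 0 := by
    rw [← cancel_mono (i.map s), zero_comp, ← i.map_comp, h0, hks]
  rw [(h0 k).1 hik] at hk
  rw [← cancel_epi e.hom, ← cancel_epi (q.map t), hk]
  simp

/-- Not formally dual to the monomorphism case, since roofs only refine the source. The denominator
t of the test morphism must first be lifted through s, which is possible on the side of i, where s
is invertible. -/
lemma epi_map (hi : HasRoofs i) (hq : HasRoofs q) [q.EssSurj]
    (h0 : ∀ {a b : S} (f : a ⟶ b), i.map f = 0 ↔ q.map f = 0)
    (hs : ∀ {a b : S} (f g : a ⟶ b), ∃ d : a ⟶ b, i.map f = i.map g + i.map d ∧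
      q.map f = q.map g + q.map d) {a b : S} (s : a ⟶ b)
    [IsIso (i.map s)] : Epi (q.map s) := by
  refine Preadditive.epi_of_cancel_zero _ fun {Z} v hv => ?_
  let e := q.objObjPreimageIso Z
  obtain ⟨w, t, k, ht, hk⟩ := hq.exists_roof (v ≫ e.inv)
  -- Up to the refinement r, the morphism t factors as l ≫ s after applying i, and then after
  -- applying q.
  obtain ⟨x, r, l, hr, hl⟩ := hi.exists_roof (i.map t ≫ inv (i.map s))
  have h1 : i.map (r ≫ t) = i.map (l ≫ s) := by
    rw [i.map_comp, i.map_comp, ← hl]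
    simp
  have h2 : q.map (r ≫ t) = q.map (l ≫ s) := by
    obtain ⟨d, hd, hd'⟩ := hs (r ≫ t) (l ≫ s)
    have : i.map d = 0 := by simpa [h1] using hd
    rw [hd', (h0 d).1 this, add_zero]
  have h3 : q.map (r ≫ k) = 0 := by
    rw [q.map_comp, ← hk, ← Category.assoc, ← q.map_comp, h2, q.map_comp, Category.assoc,
      reassoc_of% hv, zero_comp, comp_zero]
  have h4 : i.map k = 0 := by
    rw [← cancel_epi (i.map r), comp_zero, ← i.map_comp, h0, h3]
  rw [(h0 k).1 h4] at hk
  rw [← cancel_mono e.inv, ← cancel_epi (q.map t), hk]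
  simp

lemma isIso_map (hi : HasRoofs i) (hq : HasRoofs q) [q.EssSurj] [Balanced D]
    (h0 : ∀ {a b : S} (f : a ⟶ b), i.map f = 0 ↔ q.map f = 0)
    (hs : ∀ {a b : S} (f g : a ⟶ b), ∃ d : a ⟶ b, i.map f = i.map g + i.map d ∧
      q.map f = q.map g + q.map d) {a b : S} (s : a ⟶ b)
    [IsIso (i.map s)] : IsIso (q.map s) := by
  have := mono_map hq h0 s
  have := epi_map hi hq h0 hs s
  exact isIso_of_mono_of_epi _

end reflect

/-- The morphism between the images under `q` that corresponds to a morphism between the images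
under `i`. -/
noncomputable def transport {i : S ⥤ C} (q : S ⥤ D) (hi : HasRoofs i)
    (hiso : ∀ ⦃a b : S⦄ (s : a ⟶ b), IsIso (i.map s) → IsIso (q.map s)) {a b : S}
    (g : i.obj a ⟶ i.obj b) : q.obj a ⟶ q.obj b :=
  have := hiso (hi.exists_roof g).choose_spec.choose
    (hi.exists_roof g).choose_spec.choose_spec.choose_spec.1
  inv (q.map (hi.exists_roof g).choose_spec.choose) ≫
    q.map (hi.exists_roof g).choose_spec.choose_spec.choose

section transport

variable {i : S ⥤ C} {q : S ⥤ D} (hi : HasRoofs i)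
  (hiso : ∀ ⦃a b : S⦄ (s : a ⟶ b), IsIso (i.map s) → IsIso (q.map s))

lemma exists_transport_roof {a b : S} (g : i.obj a ⟶ i.obj b) :
    ∃ (c : S) (s : c ⟶ a) (f : c ⟶ b), IsIso (i.map s) ∧ IsIso (q.map s) ∧
      i.map s ≫ g = i.map f ∧ q.map s ≫ transport q hi hiso g = q.map f := by
  refine ⟨_, (hi.exists_roof g).choose_spec.choose,
    (hi.exists_roof g).choose_spec.choose_spec.choose,
    (hi.exists_roof g).choose_spec.choose_spec.choose_spec.1,
    hiso _ (hi.exists_roof g).choose_spec.choose_spec.choose_spec.1,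
    (hi.exists_roof g).choose_spec.choose_spec.choose_spec.2, ?_⟩
  simp [transport]

/-- Independence of the chosen roof: any other roof of g is compared with it on a common refinement,
constructed on the side of q and read back on the side of i. -/
lemma transport_spec (hq : HasRoofs q)
    (heq : ∀ ⦃a b : S⦄ (f g : a ⟶ b), i.map f = i.map g ↔ q.map f = q.map g) {a b d : S}
    (g : i.obj a ⟶ i.obj b) (t : d ⟶ a) (k : d ⟶ b)
    (h : i.map t ≫ g = i.map k) : q.map t ≫ transport q hi hiso g = q.map k := by
  obtain ⟨c, s, f, his, hqs, hs, hs'⟩ := exists_transport_roof hi hiso g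
  obtain ⟨w, t', k', ht', hk'⟩ := hq.exists_roof (q.map t ≫ inv (q.map s))
  have h1 : q.map (t' ≫ t) = q.map (k' ≫ s) := by
    rw [q.map_comp, q.map_comp, ← hk']
    simp
  have h2 := (heq _ _).2 h1
  have h3 : i.map (t' ≫ k) = i.map (k' ≫ f) := by
    rw [i.map_comp, ← h, ← Category.assoc, ← i.map_comp, h2, i.map_comp, Category.assoc, hs,
      i.map_comp]
  have h4 := (heq _ _).1 h3
  rw [← cancel_epi (q.map t'), ← Category.assoc, ← q.map_comp, h1, q.map_comp, Category.assoc, hs',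
    ← q.map_comp, ← q.map_comp, h4]

lemma transport_map (hq : HasRoofs q)
    (heq : ∀ ⦃a b : S⦄ (f g : a ⟶ b), i.map f = i.map g ↔ q.map f = q.map g) {a b : S} (f : a ⟶ b) :
    transport q hi hiso (i.map f) = q.map f := by
  simpa using transport_spec hi hiso hq heq (i.map f) (𝟙 a) f (by simp)

lemma transport_id (hq : HasRoofs q)
    (heq : ∀ ⦃a b : S⦄ (f g : a ⟶ b), i.map f = i.map g ↔ q.map f = q.map g) (a : S) :
    transport q hi hiso (𝟙 (i.obj a)) = 𝟙 (q.obj a) := by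
  rw [← i.map_id, transport_map hi hiso hq heq, q.map_id]

lemma transport_comp (hq : HasRoofs q)
    (heq : ∀ ⦃a b : S⦄ (f g : a ⟶ b), i.map f = i.map g ↔ q.map f = q.map g) {a b c : S}
    (g : i.obj a ⟶ i.obj b) (g' : i.obj b ⟶ i.obj c) :
    transport q hi hiso (g ≫ g') = transport q hi hiso g ≫ transport q hi hiso g' := by
  obtain ⟨x, s, f, his, hqs, hs, hs'⟩ := exists_transport_roof hi hiso g
  obtain ⟨x', s', f', his', hqs', hr, hr'⟩ := exists_transport_roof hi hiso g'
  obtain ⟨w, t', k', ht', hk'⟩ := hq.exists_roof (q.map f ≫ inv (q.map s'))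
  have h1 : q.map (t' ≫ f) = q.map (k' ≫ s') := by
    rw [q.map_comp, q.map_comp, ← hk']
    simp
  have h2 := (heq _ _).2 h1
  have h3 : i.map (t' ≫ s) ≫ g ≫ g' = i.map (k' ≫ f') := by
    rw [i.map_comp, Category.assoc, reassoc_of% hs, ← Category.assoc, ← i.map_comp, h2,
      i.map_comp, Category.assoc, hr, i.map_comp]
  have h4 := transport_spec hi hiso hq heq _ _ _ h3
  rw [← cancel_epi (q.map s), ← cancel_epi (q.map t'), ← Category.assoc, ← q.map_comp, h4,
    reassoc_of% hs', ← q.map_comp_assoc, h1, q.map_comp, q.map_comp, Category.assoc, hr']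

/-- Two roofs with the same value in D acquire a common refinement there; its legs agree under i as
well, and its denominator is invertible in C by `hiso'`. -/
lemma transport_injective (hq : HasRoofs q)
    (heq : ∀ ⦃a b : S⦄ (f g : a ⟶ b), i.map f = i.map g ↔ q.map f = q.map g) {a b : S}
    {g g' : i.obj a ⟶ i.obj b}
    (h : transport q hi hiso g = transport q hi hiso g')
    (hiso' : ∀ ⦃a b : S⦄ (s : a ⟶ b), IsIso (q.map s) → IsIso (i.map s)) : g = g' := by
  obtain ⟨x, s, f, his, hqs, hs, hs'⟩ := exists_transport_roof hi hiso g
  obtain ⟨x', s', f', his', hqs', hr, hr'⟩ := exists_transport_roof hi hiso g'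
  obtain ⟨w, t', k', ht', hk'⟩ := hq.exists_roof (q.map s ≫ inv (q.map s'))
  have h1 : q.map (t' ≫ s) = q.map (k' ≫ s') := by
    rw [q.map_comp, q.map_comp, ← hk']
    simp
  have h2 := (heq _ _).2 h1
  have h3 : q.map (t' ≫ f) = q.map (k' ≫ f') := by
    rw [q.map_comp, ← hs', ← Category.assoc, ← q.map_comp, h1, h, q.map_comp, Category.assoc, hr',
      q.map_comp]
  have h4 := (heq _ _).2 h3
  have := hiso' t' ht'
  have : IsIso (i.map (t' ≫ s)) := by rw [i.map_comp]; infer_instance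
  have h5 : i.map (t' ≫ s) ≫ g' = i.map (k' ≫ f') := by
    rw [h2, i.map_comp, Category.assoc, hr, i.map_comp]
  rw [← cancel_epi (i.map (t' ≫ s)), h5, ← h4, i.map_comp, Category.assoc, hs, i.map_comp]

lemma transport_surjective (hq : HasRoofs q)
    (heq : ∀ ⦃a b : S⦄ (f g : a ⟶ b), i.map f = i.map g ↔ q.map f = q.map g)
    (hiso' : ∀ ⦃a b : S⦄ (s : a ⟶ b), IsIso (q.map s) → IsIso (i.map s)) {a b : S}
    (g : q.obj a ⟶ q.obj b) : ∃ g' : i.obj a ⟶ i.obj b, transport q hi hiso g' = g := by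
  obtain ⟨c, s, f, hs, h⟩ := hq.exists_roof g
  have := hiso' s hs
  refine ⟨inv (i.map s) ≫ i.map f, ?_⟩
  rw [← cancel_epi (q.map s), transport_spec hi hiso hq heq _ s f (by simp), h]

/-- The functor `C ⥤ D` induced by two functors `i` and `q` that have roofs and identify the same
morphisms. -/
noncomputable def functor (hq : HasRoofs q)
    (heq : ∀ ⦃a b : S⦄ (f g : a ⟶ b), i.map f = i.map g ↔ q.map f = q.map g) [i.EssSurj] :
    C ⥤ D where
  obj X := q.obj (i.objPreimage X)
  map {X Y} g := transport q hi hiso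
    ((i.objObjPreimageIso X).hom ≫ g ≫ (i.objObjPreimageIso Y).inv)
  map_id X := by
    rw [Category.id_comp, Iso.hom_inv_id, transport_id hi hiso hq heq]
  map_comp f g := by
    rw [← transport_comp hi hiso hq heq]
    simp

/-- The functor induced by `i` and `q` factors `q` through `i`. -/
noncomputable def functorCompIso (hq : HasRoofs q)
    (heq : ∀ ⦃a b : S⦄ (f g : a ⟶ b), i.map f = i.map g ↔ q.map f = q.map g) [i.EssSurj] :
    i ⋙ functor hi hiso hq heq ≅ q :=
  NatIso.ofComponents (fun a =>
    { hom := transport q hi hiso (i.objObjPreimageIso (i.obj a)).hom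
      inv := transport q hi hiso (i.objObjPreimageIso (i.obj a)).inv
      hom_inv_id := (transport_comp hi hiso hq heq _ _).symm.trans
        ((congrArg _ (Iso.hom_inv_id _)).trans (transport_id hi hiso hq heq _))
      inv_hom_id := (transport_comp hi hiso hq heq _ _).symm.trans
        ((congrArg _ (Iso.inv_hom_id _)).trans (transport_id hi hiso hq heq _)) })
    (fun {a b} f => by
      change transport q hi hiso _ ≫ transport q hi hiso _ = transport q hi hiso _ ≫ q.map f
      rw [← transport_map hi hiso hq heq f, ← transport_comp hi hiso hq heq,
        ← transport_comp hi hiso hq heq]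
      simp)

lemma functor_faithful (hq : HasRoofs q)
    (heq : ∀ ⦃a b : S⦄ (f g : a ⟶ b), i.map f = i.map g ↔ q.map f = q.map g) [i.EssSurj]
    (hiso' : ∀ ⦃a b : S⦄ (s : a ⟶ b), IsIso (q.map s) → IsIso (i.map s)) :
    (functor hi hiso hq heq).Faithful where
  map_injective {X Y} f g h := by
    have := transport_injective hi hiso hq heq (g := _ ≫ f ≫ _) (g' := _ ≫ g ≫ _) h hiso'
    simpa using this

lemma functor_full (hq : HasRoofs q)
    (heq : ∀ ⦃a b : S⦄ (f g : a ⟶ b), i.map f = i.map g ↔ q.map f = q.map g) [i.EssSurj]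
    (hiso' : ∀ ⦃a b : S⦄ (s : a ⟶ b), IsIso (q.map s) → IsIso (i.map s)) :
    (functor hi hiso hq heq).Full where
  map_surjective {X Y} g := by
    obtain ⟨g', hg'⟩ := transport_surjective hi hiso hq heq hiso' g
    exact ⟨(i.objObjPreimageIso X).inv ≫ g' ≫ (i.objObjPreimageIso Y).hom, by
      refine Eq.trans (congrArg (transport q hi hiso) ?_) hg'
      simp⟩

lemma functor_essSurj (hq : HasRoofs q)
    (heq : ∀ ⦃a b : S⦄ (f g : a ⟶ b), i.map f = i.map g ↔ q.map f = q.map g) [i.EssSurj] [q.EssSurj] :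
    (functor hi hiso hq heq).EssSurj where
  mem_essImage Y := ⟨i.obj (q.objPreimage Y),
    ⟨(functorCompIso hi hiso hq heq).app _ ≪≫ q.objObjPreimageIso Y⟩⟩

/-- Any functor that factors `q` through `i` is isomorphic to the induced one. -/
noncomputable def functorUnique (hq : HasRoofs q)
    (heq : ∀ ⦃a b : S⦄ (f g : a ⟶ b), i.map f = i.map g ↔ q.map f = q.map g) [i.EssSurj]
    (H : C ⥤ D) (β : i ⋙ H ≅ q) :
    H ≅ functor hi hiso hq heq :=
  NatIso.ofComponents
    (fun X => H.mapIso (i.objObjPreimageIso X).symm ≪≫ β.app (i.objPreimage X))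
    (fun {X Y} g => by
      -- A roof of the morphism reduces naturality to that of `β` at its two legs, which are
      -- morphisms of `S`.
      obtain ⟨c, s, f, his, hqs, hs, hs'⟩ := exists_transport_roof (q := q) hi hiso
        ((i.objObjPreimageIso X).hom ≫ g ≫ (i.objObjPreimageIso Y).inv)
      have h1 := β.hom.naturality s
      have h2 := β.hom.naturality f
      dsimp at h1 h2
      change H.map g ≫ H.map (i.objObjPreimageIso Y).inv ≫ β.hom.app (i.objPreimage Y) =
        (H.map (i.objObjPreimageIso X).inv ≫ β.hom.app (i.objPreimage X)) ≫
          transport q hi hiso ((i.objObjPreimageIso X).hom ≫ g ≫ (i.objObjPreimageIso Y).inv)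
      have e : H.map (i.objObjPreimageIso X).hom ≫ H.map (i.objObjPreimageIso X).inv = 𝟙 _ := by
        rw [← H.map_comp, Iso.hom_inv_id, H.map_id]
      rw [← cancel_epi (H.map (i.objObjPreimageIso X).hom), ← cancel_epi (H.map (i.map s)),
        Category.assoc, reassoc_of% e, reassoc_of% h1, hs', ← h2, ← hs]
      simp)

end transport

/-- Two functors with roofs that kill the same morphisms and are essentially surjective have
equivalent targets. -/
theorem exists_equivalence [Preadditive C] [Preadditive D] [Balanced C] [Balanced D] (i : S ⥤ C)
    (q : S ⥤ D) (hi : HasRoofs i) (hq : HasRoofs q) [i.EssSurj] [q.EssSurj]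
    (h0 : ∀ {a b : S} (f : a ⟶ b), i.map f = 0 ↔ q.map f = 0)
    (hs : ∀ {a b : S} (f g : a ⟶ b), ∃ d : a ⟶ b, i.map f = i.map g + i.map d ∧
      q.map f = q.map g + q.map d) :
    ∃ H : C ⥤ D, Nonempty (i ⋙ H ≅ q) ∧
      (∀ H' : C ⥤ D, Nonempty (i ⋙ H' ≅ q) → Nonempty (H' ≅ H)) ∧ H.IsEquivalence := by
  have hiso ⦃a b : S⦄ (s : a ⟶ b) (h : IsIso (i.map s)) : IsIso (q.map s) :=
    isIso_map hi hq h0 hs s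
  -- The assumptions are symmetric in the two functors, so the previous argument applies with the
  -- roles exchanged.
  have hiso' ⦃a b : S⦄ (s : a ⟶ b) (h : IsIso (q.map s)) : IsIso (i.map s) :=
    isIso_map hq hi (fun f => (h0 f).symm)
      (fun f g => by obtain ⟨d, h, h'⟩ := hs f g; exact ⟨d, h', h⟩) s
  -- The functors are not assumed additive and `S` is not preadditive: the single morphism d serves
  -- as the difference on both sides.
  have heq ⦃a b : S⦄ (f g : a ⟶ b) : i.map f = i.map g ↔ q.map f = q.map g := by
    obtain ⟨d, h, h'⟩ := hs f g
    rw [h, h', add_eq_left, add_eq_left, h0]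
  refine ⟨functor hi hiso hq heq, ⟨functorCompIso hi hiso hq heq⟩,
    fun H' ⟨β⟩ => ⟨functorUnique hi hiso hq heq H' β⟩, ?_⟩
  have := functor_faithful hi hiso hq heq hiso'
  have := functor_full hi hiso hq heq hiso'
  have := functor_essSurj hi hiso hq heq
  exact { }

end Roof

/-! ### Kernel-cokernel pairs and a criterion for being abelian -/

/-- `k` is a kernel of `p` and `p` is a cokernel of `k`. -/
structure IsKernelCokernelPair {C : Type*} [Category* C] [Preadditive C] {K X I : C} (k : K ⟶ X)
    (p : X ⟶ I) : Prop where
  zero : k ≫ p = 0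
  mono : Mono k
  epi : Epi p
  exists_lift : ∀ {W : C} (g : W ⟶ X), g ≫ p = 0 → ∃ l : W ⟶ K, l ≫ k = g
  exists_desc : ∀ {W : C} (g : X ⟶ W), k ≫ g = 0 → ∃ l : I ⟶ W, p ≫ l = g

namespace IsKernelCokernelPair

variable {C : Type*} [Category* C] [Preadditive C] {K X I Y Q : C} {k : K ⟶ X} {p : X ⟶ I}
  {m : I ⟶ Y} {q : Y ⟶ Q}

/-- A monomorphism after p does not change what p kills, so the kernel of p remains the kernel of
the composite. -/
lemma nonempty_isLimit (h : IsKernelCokernelPair k p) {f : X ⟶ Y} (hf : p ≫ m = f) [Mono m] :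
    ∃ w : k ≫ f = 0, Nonempty (IsLimit (KernelFork.ofι k w)) := by
  have := h.mono
  have w : k ≫ f = 0 := by rw [← hf, reassoc_of% h.zero, zero_comp]
  refine ⟨w, ⟨KernelFork.IsLimit.ofι' k w fun g hg => ?_⟩⟩
  have hg' : g ≫ p = 0 := by rw [← cancel_mono m, Category.assoc, hf, hg, zero_comp]
  exact ⟨_, (h.exists_lift g hg').choose_spec⟩

lemma nonempty_isColimit (h : IsKernelCokernelPair m q) {f : X ⟶ Y} (hf : p ≫ m = f) [Epi p] :
    ∃ w : f ≫ q = 0, Nonempty (IsColimit (CokernelCofork.ofπ q w)) := by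
  have := h.epi
  have w : f ≫ q = 0 := by rw [← hf, Category.assoc, h.zero, comp_zero]
  refine ⟨w, ⟨CokernelCofork.IsColimit.ofπ' q w fun g hg => ?_⟩⟩
  have hg' : m ≫ g = 0 := by rw [← cancel_epi p, ← Category.assoc, hf, hg, comp_zero]
  exact ⟨_, (h.exists_desc g hg').choose_spec⟩

lemma isIso_of_zero_left (h : IsKernelCokernelPair k p) (hk : k = 0) : IsIso p := by
  obtain ⟨l, hl⟩ := h.exists_desc (𝟙 X) (by rw [hk, zero_comp])
  have := h.epi
  exact ⟨l, hl, by rw [← cancel_epi p, reassoc_of% hl, Category.comp_id]⟩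

lemma isIso_of_zero_right (h : IsKernelCokernelPair k p) (hp : p = 0) : IsIso k := by
  obtain ⟨l, hl⟩ := h.exists_lift (𝟙 X) (by rw [hp, comp_zero])
  have := h.mono
  exact ⟨l, by rw [← cancel_mono k, Category.assoc, hl]; simp, hl⟩

lemma of_iso_left {K' : C} (h : IsKernelCokernelPair k p) (e : K' ⟶ K) [IsIso e] :
    IsKernelCokernelPair (e ≫ k) p where
  zero := by rw [Category.assoc, h.zero, comp_zero]
  mono := have := h.mono; inferInstance
  epi := h.epi
  exists_lift g hg := by
    obtain ⟨l, hl⟩ := h.exists_lift g hg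
    exact ⟨l ≫ inv e, by simp [hl]⟩
  exists_desc g hg := h.exists_desc g (by
    rwa [← cancel_epi e, comp_zero, ← Category.assoc])

end IsKernelCokernelPair

/-- A preadditive category with finite products in which every morphism is a cokernel followed by
a kernel is abelian. -/
@[reducible]
noncomputable def abelianOfFactorization {C : Type*} [Category* C] [hC : Preadditive C]
    [HasFiniteProducts C] (h : ∀ {X Y : C} (f : X ⟶ Y), ∃ (K I Q : C) (k : K ⟶ X) (p : X ⟶ I)
      (m : I ⟶ Y) (q : Y ⟶ Q), p ≫ m = f ∧ IsKernelCokernelPair k p ∧ IsKernelCokernelPair m q) :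
    Abelian C where
  toPreadditive := hC
  normalMonoOfMono {X Y} f hf := by
    obtain ⟨K, I, Q, k, p, m, q, fac, hk, hm⟩ := h f
    -- A monomorphism has zero kernel part, which makes p invertible; so f is, up to isomorphism,
    -- the kernel m of q.
    have hk0 : k = 0 := by rw [← cancel_mono f, ← fac, reassoc_of% hk.zero, zero_comp, zero_comp]
    have := hk.isIso_of_zero_left hk0
    have hf' : IsKernelCokernelPair f q := fac ▸ hm.of_iso_left p
    exact ⟨{ Z := Q, g := q, w := hf'.zero
             isLimit := (hf'.nonempty_isLimit (Category.comp_id q)).choose_spec.some }⟩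
  normalEpiOfEpi {X Y} f hf := by
    obtain ⟨K, I, Q, k, p, m, q, fac, hk, hm⟩ := h f
    have hq0 : q = 0 := by rw [← cancel_epi f, ← fac, Category.assoc, hm.zero, comp_zero, comp_zero]
    have := hm.isIso_of_zero_right hq0
    have w : k ≫ f = 0 := by rw [← fac, reassoc_of% hk.zero, zero_comp]
    have := hk.epi
    exact ⟨{ W := K, g := k, w := w
             isColimit := CokernelCofork.IsColimit.ofπ' f w fun g hg =>
              ⟨inv m ≫ (hk.exists_desc g hg).choose, by
                rw [← fac, Category.assoc, IsIso.hom_inv_id_assoc,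
                  (hk.exists_desc g hg).choose_spec]⟩ }⟩
  has_kernels := ⟨fun {X Y} f => by
    obtain ⟨K, I, Q, k, p, m, q, fac, hk, hm⟩ := h f
    have := hm.mono
    obtain ⟨w, ⟨hl⟩⟩ := hk.nonempty_isLimit fac
    exact ⟨⟨_, hl⟩⟩⟩
  has_cokernels := ⟨fun {X Y} f => by
    obtain ⟨K, I, Q, k, p, m, q, fac, hk, hm⟩ := h f
    have := hk.epi
    obtain ⟨w, ⟨hl⟩⟩ := hm.nonempty_isColimit fac
    exact ⟨⟨_, hl⟩⟩⟩

/-! ### Vanishing and invertibility of butterflies -/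

section Butterflies

variable {A : Type u} [Category.{v} A] [Abelian A]

attribute [local simp] pullback.lift_fst pullback.lift_snd pullback.lift_fst_assoc
  pullback.lift_snd_assoc

namespace Butterfly

variable {X Y Z W : TwoTerm A}

/-- A map out of the middle object of a butterfly is determined on the kernel of `σ`. -/
lemma exists_desc (P : Butterfly X Y) {T : A} (t : P.E ⟶ T) (h : P.ι ≫ t = 0) :
    ∃ z : X.tgt ⟶ T, t = P.σ ≫ z :=
  ⟨P.shortExact.exact.desc t h, (P.shortExact.exact.g_desc t h).symm⟩

lemma zero_toHom : (zero X Y).toHom = 0 := rfl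

section strict

variable (f : X.src ⟶ Y.src) (g : X.tgt ⟶ Y.tgt) (w : f ≫ Y.d = X.d ≫ g)

/-- The inclusion of `X⁰` into the middle object of a strict butterfly. -/
noncomputable def strictInl : X.tgt ⟶ (strict f g w).E := strictMk f g w (𝟙 _) 0

@[simp] lemma strictInl_σ : strictInl f g w ≫ (strict f g w).σ = 𝟙 _ := by simp [strictInl]

@[simp] lemma strictInl_σ_assoc {T : A} (t : X.tgt ⟶ T) :
    strictInl f g w ≫ (strict f g w).σ ≫ t = t := by
  rw [← Category.assoc, strictInl_σ, Category.id_comp]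

@[simp] lemma strictInl_snd : strictInl f g w ≫ strictSnd f g w = 0 := by simp [strictInl]

@[simp] lemma strictInl_ρ : strictInl f g w ≫ (strict f g w).ρ = g := by simp [strictInl]

lemma strict_κ_eq : (strict f g w).κ = X.d ≫ strictInl f g w - f ≫ (strict f g w).ι :=
  strict_ext (by simp) (by simp)

lemma strict_id_eq : 𝟙 (strict f g w).E =
    (strict f g w).σ ≫ strictInl f g w + strictSnd f g w ≫ (strict f g w).ι :=
  strict_ext (by simp) (by simp)

lemma strict_eq {T : A} (t : (strict f g w).E ⟶ T) : t =
    (strict f g w).σ ≫ strictInl f g w ≫ t + strictSnd f g w ≫ (strict f g w).ι ≫ t := by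
  conv_lhs => rw [← Category.id_comp t, strict_id_eq]
  simp

variable {f g w} in
lemma strict_hom_ext {T : A} {s t : (strict f g w).E ⟶ T}
    (h₁ : strictInl f g w ≫ s = strictInl f g w ≫ t)
    (h₂ : (strict f g w).ι ≫ s = (strict f g w).ι ≫ t) : s = t := by
  rw [strict_eq f g w s, strict_eq f g w t, h₁, h₂]

/-- The map out of the middle object of a strict butterfly with given components. -/
noncomputable def strictDesc {T : A} (a : X.tgt ⟶ T) (b : Y.src ⟶ T) : (strict f g w).E ⟶ T :=
  (strict f g w).σ ≫ a + strictSnd f g w ≫ b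

@[simp] lemma ι_strictDesc {T : A} (a : X.tgt ⟶ T) (b : Y.src ⟶ T) :
    (strict f g w).ι ≫ strictDesc f g w a b = b := by
  simp [strictDesc, reassoc_of% strict_ι_snd f g w]

@[simp] lemma strictInl_strictDesc {T : A} (a : X.tgt ⟶ T) (b : Y.src ⟶ T) :
    strictInl f g w ≫ strictDesc f g w a b = a := by
  simp [strictDesc, reassoc_of% strictInl_snd f g w, reassoc_of% strictInl_σ f g w]

@[simp] lemma ι_strictDesc_assoc {T T' : A} (a : X.tgt ⟶ T) (b : Y.src ⟶ T) (t : T ⟶ T') :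
    (strict f g w).ι ≫ strictDesc f g w a b ≫ t = b ≫ t := by
  rw [← Category.assoc, ι_strictDesc]

@[simp] lemma strictInl_strictDesc_assoc {T T' : A} (a : X.tgt ⟶ T) (b : Y.src ⟶ T) (t : T ⟶ T') :
    strictInl f g w ≫ strictDesc f g w a b ≫ t = a ≫ t := by
  rw [← Category.assoc, strictInl_strictDesc]

@[simp] lemma κ_strictDesc {T : A} (a : X.tgt ⟶ T) (b : Y.src ⟶ T) :
    (strict f g w).κ ≫ strictDesc f g w a b = X.d ≫ a - f ≫ b := by
  simp [strict_κ_eq]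

/-- On the fibre product over X⁰ the components in X⁰ agree, and those in Y⁻¹ are added; the
antidiagonal copy of Y⁻¹ is thereby killed. -/
lemma strict_add (f' : X.src ⟶ Y.src) (g' : X.tgt ⟶ Y.tgt) (w' : f' ≫ Y.d = X.d ≫ g') :
    (strict f g w).toHom + (strict f' g' w').toHom =
      (strict (f + f') (g + g') (by simp [w, w'])).toHom := by
  have c := pullback.condition (f := (strict f g w).σ) (g := (strict f' g' w').σ)
  refine Quotient.sound (add_equiv _ _ _ (strictMk _ _ _ (pullback.fst _ _ ≫ (strict f g w).σ)
    (pullback.fst _ _ ≫ strictSnd f g w + pullback.snd _ _ ≫ strictSnd f' g' w')) ?_ ?_ ?_ ?_ ?_)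
  · exact strict_ext (by simp [precomp_strictMk]) (by simp [precomp_strictMk])
  · exact strict_ext (by simp [precomp_strictMk]) (by simp [precomp_strictMk]; abel)
  · exact strict_ext (by simp [precomp_strictMk]) (by simp [precomp_strictMk])
  · simp
  · rw [strictMk_ρ, strict_ρ f g w, strict_ρ f' g' w', Preadditive.comp_add, Preadditive.comp_add,
      Preadditive.comp_add, ← reassoc_of% c]
    simp
    abel

end strict

/-- An isomorphism with the zero butterfly X⁰ ⊞ Y⁻¹ has σ as its first component, hence is
determined by the second one, the retraction r. -/
lemma toHom_eq_zero_iff_retraction (P : Butterfly X Y) : P.toHom = 0 ↔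
    ∃ r : P.E ⟶ Y.src, P.ι ≫ r = 𝟙 _ ∧ P.κ ≫ r = 0 ∧ r ≫ Y.d = P.ρ := by
  rw [← zero_toHom, toHom_eq_iff]
  constructor
  · rintro ⟨e, h₁, h₂, h₃, h₄⟩
    refine ⟨e.hom ≫ strictSnd _ _ _, ?_, ?_, ?_⟩
    · rw [reassoc_of% h₂, strict_ι_snd]
    · rw [reassoc_of% h₁, strict_κ_snd, neg_zero]
    · rw [← h₄, strict_ρ]
      simp
  · rintro ⟨r, h₁, h₂, h₃⟩
    refine Equiv.of_map (strictMk _ _ _ P.σ r) ?_ ?_ (by simp) (by simp [h₃])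
    · exact strict_ext (by simp [precomp_strictMk]) (by simp [precomp_strictMk, h₂])
    · exact strict_ext (by simp [precomp_strictMk]) (by simp [precomp_strictMk, h₁])

lemma toHom_eq_zero_of_section (P : Butterfly X Y) (s : X.tgt ⟶ P.E) (h₁ : s ≫ P.σ = 𝟙 _)
    (h₂ : s ≫ P.ρ = 0) (h₃ : X.d ≫ s = P.κ) : P.toHom = 0 := by
  rw [← zero_toHom, toHom_eq_iff]
  exact Equiv.symm (Equiv.of_map (strictDesc _ _ _ s P.ι) (by simp [h₃]) (by simp)
    (strict_hom_ext (by simp [h₁]) (by simp)) (strict_hom_ext (by simp [h₂]) (by simp)))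

/-- A retraction of X⁰ ⊞ Y⁻¹ onto the second summand is determined by its restriction to X⁰, and
this restriction is a null-homotopy. -/
lemma strict_toHom_eq_zero_iff (f : X.src ⟶ Y.src) (g : X.tgt ⟶ Y.tgt) (w : f ≫ Y.d = X.d ≫ g) :
    (strict f g w).toHom = 0 ↔ ∃ h : X.tgt ⟶ Y.src, X.d ≫ h = f ∧ h ≫ Y.d = g := by
  rw [toHom_eq_zero_iff_retraction]
  constructor
  · rintro ⟨r, h₁, h₂, h₃⟩
    refine ⟨strictInl _ _ _ ≫ r, ?_, by simp [h₃]⟩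
    rw [strict_κ_eq, Preadditive.sub_comp, Category.assoc, Category.assoc, h₁, Category.comp_id,
      sub_eq_zero] at h₂
    exact h₂
  · rintro ⟨h, h₁, h₂⟩
    exact ⟨strictDesc _ _ _ h (𝟙 _), by simp, by simp [h₁],
      strict_hom_ext (by simp [h₂]) (by simp)⟩

instance (P : Butterfly X Y) (Q : Butterfly Y Z) : Epi (compπ P Q) :=
  have (p : PreButterfly X Z) : Epi (cokernel.π p.j) := inferInstance
  this (P.preComp Q)

/-- A morphism θ between the middle objects corresponds to a retraction r of the composite through
r(x, y) = y - θ(x), the right-hand side lying in Y⁻¹. This describes zero composites without any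
quotient. -/
lemma comp_eq_zero_iff (Q : Butterfly W X) (P : Butterfly X Y) : Q.toHom ≫ P.toHom = 0 ↔
    ∃ θ : Q.E ⟶ P.E, Q.κ ≫ θ = 0 ∧ Q.ι ≫ θ = P.κ ∧ θ ≫ P.σ = Q.ρ ∧ θ ≫ P.ρ = 0 := by
  have c := pullback.condition (f := Q.ρ) (g := P.σ)
  rw [toHom_comp, toHom_eq_zero_iff_retraction]
  constructor
  · rintro ⟨r, h₁, h₂, h₃⟩
    have e : pullback.lift 0 P.ι (by simp) ≫ (pullback.snd Q.ρ P.σ - compπ Q P ≫ r ≫ P.ι) = 0 := by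
      have : pullback.lift 0 P.ι (by simp) ≫ compπ Q P = (Q.comp P).ι := rfl
      simp [reassoc_of% this, reassoc_of% h₁]
    -- The elements of the fibre product with zero first component come from Y⁻¹, where r is the
    -- identity. So y - r(x, y) depends on x only and descends along the epimorphism `pullback.fst`.
    have e' : kernel.ι (pullback.fst Q.ρ P.σ) ≫
        (pullback.snd Q.ρ P.σ - compπ Q P ≫ r ≫ P.ι) = 0 := by
      obtain ⟨z, hz⟩ := P.exists_lift (kernel.ι (pullback.fst Q.ρ P.σ) ≫ pullback.snd Q.ρ P.σ)
        (by rw [Category.assoc, ← c]; simp)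
      have : kernel.ι (pullback.fst Q.ρ P.σ) = z ≫ pullback.lift 0 P.ι (by simp) :=
        pullback.hom_ext (by simp) (by simp [hz])
      rw [this, Category.assoc, e, comp_zero]
    have hd := Abelian.comp_epiDesc (pullback.fst Q.ρ P.σ) _ e'
    set θ := Abelian.epiDesc (pullback.fst Q.ρ P.σ) _ e'
    refine ⟨θ, ?_, ?_, ?_, ?_⟩
    · have := congrArg (fun t => pullback.lift Q.κ 0 (by simp) ≫ t) hd
      have h : pullback.lift Q.κ 0 (by simp) ≫ compπ Q P = (Q.comp P).κ := rfl
      simpa [reassoc_of% h, reassoc_of% h₂] using this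
    · have := congrArg (fun t => pullback.lift Q.ι P.κ (by simp) ≫ t) hd
      simpa [reassoc_of% compπ_cond] using this
    · rw [← cancel_epi (pullback.fst Q.ρ P.σ), reassoc_of% hd]
      simp [c]
    · rw [← cancel_epi (pullback.fst Q.ρ P.σ), reassoc_of% hd]
      simp [h₃, compπ_ρ]
  · rintro ⟨θ, h₁, h₂, h₃, h₄⟩
    obtain ⟨r, hr⟩ := P.exists_lift (pullback.snd Q.ρ P.σ - pullback.fst Q.ρ P.σ ≫ θ)
      (by simp [h₃, c])
    have hr' {T : A} (t : T ⟶ pullback Q.ρ P.σ) (z : T ⟶ Y.src)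
        (h : t ≫ pullback.snd _ _ = t ≫ pullback.fst Q.ρ P.σ ≫ θ + z ≫ P.ι) : t ≫ r = z := by
      rw [← cancel_mono P.ι, Category.assoc, ← hr, Preadditive.comp_sub, h, add_sub_cancel_left]
    -- The condition `h₂` on θ is what makes the difference vanish on the copy of X⁻¹ divided out in
    -- the composite.
    have hz : (Q.preComp P).j ≫ r = 0 := by
      dsimp only [preComp]
      exact hr' _ 0 (by simp [h₂])
    obtain ⟨r', hr''⟩ : ∃ r' : (Q.comp P).E ⟶ Y.src, compπ Q P ≫ r' = r :=
      ⟨cokernel.desc _ r hz, cokernel.π_desc _ _ _⟩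
    have hM {T : A} (a : T ⟶ Q.E) (b : T ⟶ P.E) (h : a ≫ Q.ρ = b ≫ P.σ) :
        compMk Q P a b h ≫ r' = pullback.lift a b h ≫ r := by
      rw [compMk, Category.assoc, hr'']
    refine ⟨r', ?_, ?_, ?_⟩
    · rw [comp_ι, hM, hr' _ (𝟙 _) (by simp)]
    · rw [comp_κ, hM, hr' _ 0 (by simp [h₁])]
    · rw [← cancel_epi (compπ Q P), reassoc_of% hr'', compπ_ρ]
      have := congrArg (fun t => t ≫ P.ρ) hr
      simp [h₄] at this
      exact this.symm

/-- The butterfly with the roles of the two diagonals exchanged. -/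
def flip (P : Butterfly X Y) (h : (ShortComplex.mk P.κ P.ρ P.κ_ρ).ShortExact) : Butterfly Y X where
  E := P.E
  κ := P.ι
  ι := P.κ
  σ := P.ρ
  ρ := P.σ
  κ_σ := P.ι_ρ
  ι_ρ := P.κ_σ
  κ_ρ := P.ι_σ
  ι_σ := P.κ_ρ
  shortExact := h

/-- The identification of the middle object of `P.flip h` with that of `P`. -/
def flipπ (P : Butterfly X Y) (h : (ShortComplex.mk P.κ P.ρ P.κ_ρ).ShortExact) :
    (P.flip h).E ⟶ P.E := 𝟙 P.E

section flip

variable (P : Butterfly X Y) (h : (ShortComplex.mk P.κ P.ρ P.κ_ρ).ShortExact)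

@[simp] lemma flip_ι_π : (P.flip h).ι ≫ flipπ P h = P.κ := Category.comp_id _
@[simp] lemma flip_κ_π : (P.flip h).κ ≫ flipπ P h = P.ι := Category.comp_id _
@[simp] lemma flipπ_σ : flipπ P h ≫ P.σ = (P.flip h).ρ := Category.id_comp _
@[simp] lemma flipπ_ρ : flipπ P h ≫ P.ρ = (P.flip h).σ := Category.id_comp _

/-- Two elements of the middle object with the same image in Y⁰ differ by a unique element of X⁻¹,
because the second diagonal is exact. This difference is the X⁻¹-component of the map to the
identity butterfly. -/
lemma comp_flip : (P.comp (P.flip h)).Equiv (Butterfly.id X) := by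
  have c := pullback.condition (f := P.ρ) (g := (P.flip h).σ)
  have hκ : Mono P.κ := h.mono_f
  obtain ⟨r, hr⟩ : ∃ r, pullback.snd P.ρ (P.flip h).σ ≫ flipπ P h - pullback.fst _ _ = r ≫ P.κ :=
    ⟨h.exact.lift _ (by simp [c]), (h.exact.lift_f _ _).symm⟩
  have hr' {T : A} (t : T ⟶ pullback P.ρ (P.flip h).σ) (z : T ⟶ X.src)
      (h : t ≫ pullback.snd _ _ ≫ flipπ P h = t ≫ pullback.fst P.ρ (P.flip h).σ + z ≫ P.κ) :
      t ≫ r = z := by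
    rw [← cancel_mono P.κ, Category.assoc, ← hr, Preadditive.comp_sub, h, add_sub_cancel_left]
  refine comp_equiv _ _ _ (strictMk _ _ _ (pullback.fst _ _ ≫ P.σ) r) ?_ ?_ ?_ ?_ ?_
  · refine strict_ext (by simp [precomp_strictMk]) ?_
    rw [precomp_strictMk, strictMk_snd, hr' _ 0 (by simp), zero_comp]
  · refine strict_ext (by simp [precomp_strictMk]) ?_
    rw [precomp_strictMk, strictMk_snd, hr' _ (-𝟙 _) (by simp), strict_κ_snd]
  · refine strict_ext (by simp [precomp_strictMk]) ?_
    rw [precomp_strictMk, strictMk_snd, hr' _ (𝟙 _) (by simp), strict_ι_snd]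
  · simp
  · have := congrArg (fun t => t ≫ P.σ) hr
    simp only [Preadditive.sub_comp, Category.assoc, κ_σ, sub_eq_iff_eq_add, flipπ_σ] at this
    rw [strictMk_ρ, Category.comp_id, _root_.add_comm]
    exact this.symm

end flip

/-- A butterfly both of whose diagonals are short exact represents an isomorphism. -/
lemma isIso_toHom (P : Butterfly X Y) (h : (ShortComplex.mk P.κ P.ρ P.κ_ρ).ShortExact) :
    IsIso P.toHom :=
  ⟨(P.flip h).toHom, Quotient.sound (P.comp_flip h),
    Quotient.sound (comp_flip (P.flip h) P.shortExact)⟩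

/-- Composition with a strict butterfly: a compatible map of middle objects. -/
lemma toHom_comp_strict (P : Butterfly X Y) (P' : Butterfly X Z) (b : Y.src ⟶ Z.src)
    (b' : Y.tgt ⟶ Z.tgt) (hb : b ≫ Z.d = Y.d ≫ b') (f : P.E ⟶ P'.E) (hκ : P.κ ≫ f = P'.κ)
    (hι : P.ι ≫ f = b ≫ P'.ι) (hσ : f ≫ P'.σ = P.σ) (hρ : f ≫ P'.ρ = P.ρ ≫ b') :
    P.toHom ≫ (strict b b' hb).toHom = P'.toHom := by
  rw [← Category.id_comp P'.toHom]
  exact Quotient.sound (strict_square P P' (a := 𝟙 _) (a' := 𝟙 _) (by simp) hb f (by simp [hκ]) hι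
    (by simp [hσ]) hρ)

lemma strict_comp_toHom (P : Butterfly Y Z) (P' : Butterfly X Z) (a : X.src ⟶ Y.src)
    (a' : X.tgt ⟶ Y.tgt) (ha : a ≫ Y.d = X.d ≫ a') (f : P'.E ⟶ P.E) (hκ : P'.κ ≫ f = a ≫ P.κ)
    (hι : P'.ι ≫ f = P.ι) (hσ : f ≫ P.σ = P'.σ ≫ a') (hρ : f ≫ P.ρ = P'.ρ) :
    (strict a a' ha).toHom ≫ P.toHom = P'.toHom := by
  rw [← Category.comp_id P'.toHom]
  exact (Quotient.sound (strict_square P' P ha (b := 𝟙 _) (b' := 𝟙 _) (by simp) f hκ (by simp [hι])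
    hσ (by simp [hρ]))).symm

end Butterfly

end Butterflies

/-! ### Torsion arguments, roofs and factorizations of the differential -/

section Butterflies

variable {A : Type u} [Category.{v} A] [Abelian A]

namespace IsTorsionPair

variable {T F : ObjectProperty A}

lemma tors_of_isZero (h : IsTorsionPair T F) {X : A} (hX : IsZero X) : T X :=
  h.tors_of_forall fun _ _ _ => hX.eq_of_src _ _

lemma free_of_isZero (h : IsTorsionPair T F) {X : A} (hX : IsZero X) : F X :=
  h.free_of_forall fun _ _ _ => hX.eq_of_tgt _ _

/-- The kernel of `f` is torsion-free as soon as it embeds into the kernel of `g`. -/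
lemma free_kernel_of (h : IsTorsionPair T F) {U V U' V' : A} (f : U ⟶ V) (g : U' ⟶ V')
    (hg : F (kernel g)) (s : kernel f ⟶ U') (hs : s ≫ g = 0) [Mono s] : F (kernel f) := by
  have : Mono (kernel.lift g s hs) := mono_of_mono_fac (kernel.lift_ι g s hs)
  exact h.free_of_mono (kernel.lift g s hs) hg

lemma tors_cokernel_of (h : IsTorsionPair T F) {U V U' V' : A} (f : U ⟶ V) (g : U' ⟶ V')
    (hf : T (cokernel f)) (s : V ⟶ cokernel g) (hs : f ≫ s = 0) [Epi s] : T (cokernel g) := by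
  have : Epi (cokernel.desc f s hs) := epi_of_epi_fac (cokernel.π_desc f s hs)
  exact h.tors_of_epi (cokernel.desc f s hs) hf

end IsTorsionPair

namespace Butterfly

variable {X Y Z W : TwoTerm A} {T F : ObjectProperty A}

/-- The quotient of the middle object by the images of κ and ι is coker d_X, a torsion object. -/
lemma eq_zero_of_tors_free (h : IsTorsionPair T F) (P : Butterfly X Y) (hX : T (cokernel X.d))
    {V : A} (hV : F V) (g : P.E ⟶ V) (hκ : P.κ ≫ g = 0) (hι : P.ι ≫ g = 0) : g = 0 := by
  obtain ⟨z, rfl⟩ := P.exists_desc g hι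
  have hz : X.d ≫ z = 0 := by rw [← P.κ_σ, Category.assoc, hκ]
  rw [← cokernel.π_desc X.d z hz, h.hom_eq_zero hX hV (cokernel.desc X.d z hz), comp_zero,
    comp_zero]

lemma eq_zero_of_comp_eq_zero (h : IsTorsionPair T F) (P : Butterfly X Y) (hX : T (cokernel X.d))
    {V V' : A} (m : V ⟶ V') (hm : F (kernel m)) (g : P.E ⟶ V) (hκ : P.κ ≫ g = 0)
    (hι : P.ι ≫ g = 0) (hg : g ≫ m = 0) : g = 0 := by
  rw [← kernel.lift_ι m g hg, eq_zero_of_tors_free h P hX hm (kernel.lift m g hg)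
    (by rw [← cancel_mono (kernel.ι m)]; simp [hκ])
    (by rw [← cancel_mono (kernel.ι m)]; simp [hι]), zero_comp]

/-- The intersection of ker σ and ker ρ is ker d_Y, which is torsion-free, while g factors through
the torsion object coker e. -/
lemma eq_zero_of_comp_σ_ρ_eq_zero (h : IsTorsionPair T F) (P : Butterfly X Y)
    (hY : F (kernel Y.d)) {V V' : A} (e : V' ⟶ V) (he : T (cokernel e)) (g : V ⟶ P.E)
    (hσ : g ≫ P.σ = 0) (hρ : g ≫ P.ρ = 0) (hg : e ≫ g = 0) : g = 0 := by
  obtain ⟨z, rfl⟩ := P.exists_lift g hσ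
  have hz : z ≫ Y.d = 0 := by rw [← P.ι_ρ, ← Category.assoc, hρ]
  have hez : e ≫ z = 0 := P.zero_of_ι (by rw [Category.assoc, hg])
  rw [← cokernel.π_desc e z hez, ← kernel.lift_ι Y.d (cokernel.desc e z hez)
    (by rw [← cancel_epi (cokernel.π e)]; simp [hz]), h.hom_eq_zero he hY (kernel.lift _ _ _)]
  simp

/-- A criterion for a strict butterfly to represent an isomorphism. -/
lemma isIso_strict (f : X.src ⟶ Y.src) (g : X.tgt ⟶ Y.tgt) (w : f ≫ Y.d = X.d ≫ g)
    (h₁ : ∀ {V : A} (x : V ⟶ X.src), x ≫ X.d = 0 → x ≫ f = 0 → x = 0)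
    (h₂ : ∀ {V : A} (a : V ⟶ X.tgt) (b : V ⟶ Y.src), a ≫ g + b ≫ Y.d = 0 →
      ∃ x : V ⟶ X.src, x ≫ X.d = a ∧ x ≫ f = -b)
    (h₃ : Epi (strict f g w).ρ) : IsIso (strict f g w).toHom := by
  -- The three hypotheses are the exactness of 0 ⟶ X⁻¹ ⟶ X⁰ ⊞ Y⁻¹ ⟶ Y⁰ ⟶ 0, the second diagonal of
  -- the strict butterfly.
  refine isIso_toHom _ (ShortComplex.ShortExact.mk' ?_ ?_ h₃)
  · rw [ShortComplex.exact_iff_exact_up_to_refinements]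
    intro V t ht
    change t ≫ (strict f g w).ρ = 0 at ht
    obtain ⟨x, hx, hx'⟩ := h₂ (t ≫ (strict f g w).σ) (t ≫ strictSnd f g w)
      (by
        have := congrArg (fun r => t ≫ r) (strict_ρ f g w)
        simp only [ht, Preadditive.comp_add] at this
        simpa using this.symm)
    refine ⟨V, 𝟙 _, inferInstance, x, ?_⟩
    change 𝟙 _ ≫ t = x ≫ (strict f g w).κ
    exact strict_ext (by simp [hx]) (by simp [hx'])
  · refine Preadditive.mono_of_cancel_zero _ fun x hx => ?_
    change x ≫ (strict f g w).κ = 0 at hx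
    refine h₁ x ?_ ?_
    · rw [← (strict f g w).κ_σ, ← Category.assoc, hx, zero_comp]
    · have := congrArg (fun t => t ≫ strictSnd f g w) hx
      simpa using this

section roof

variable (P : Butterfly X Y)

/-- The two-term complex `[X⁻¹ ⊞ Y⁻¹ ⟶ E]`, through which a butterfly becomes a fraction of strict
butterflies. -/
noncomputable abbrev roof : TwoTerm A := ⟨X.src ⊞ Y.src, P.E, biprod.desc P.κ P.ι⟩

lemma roof_fst_comm : biprod.fst ≫ X.d = P.roof.d ≫ P.σ := by
  apply biprod.hom_ext' <;> simp

lemma roof_snd_comm : biprod.snd ≫ Y.d = P.roof.d ≫ P.ρ := by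
  apply biprod.hom_ext' <;> simp

/-- The strict isomorphism from the roof to the source of a butterfly. -/
noncomputable def roofFst : P.roof ⟶ X := (strict biprod.fst P.σ P.roof_fst_comm).toHom

/-- The strict morphism from the roof to the target of a butterfly. -/
noncomputable def roofSnd : P.roof ⟶ Y := (strict biprod.snd P.ρ P.roof_snd_comm).toHom

/-- The strict butterfly of the second leg has middle object E ⊞ Y⁻¹, which maps to E by the
identity on E and by ι on Y⁻¹. -/
lemma roofFst_comp : P.roofFst ≫ P.toHom = P.roofSnd := by
  refine strict_comp_toHom P (strict biprod.snd P.ρ P.roof_snd_comm) _ _ _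
    (strictDesc (X := P.roof) (Y := Y) biprod.snd P.ρ P.roof_snd_comm (𝟙 P.E) P.ι)
    ?_ (ι_strictDesc _ _ _ _ _) ?_ ?_
  · rw [κ_strictDesc]
    apply biprod.hom_ext' <;> simp
  · exact strict_hom_ext (by simp) (by simp)
  · exact strict_hom_ext (by simp) (by simp)

/-- In each degree this leg is an epimorphism with kernel Y⁻¹, and these kernels form the acyclic
complex with identity differential. -/
instance : IsIso P.roofFst := by
  refine isIso_strict _ _ _ (fun {V} x hx hx' => ?_) (fun {V} a b hab => ?_) ?_
  · have hx₁ : x = (x ≫ biprod.snd) ≫ biprod.inr := by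
      refine biprod.hom_ext _ _ ?_ (by simp)
      rw [hx', Category.assoc, biprod.inr_fst, comp_zero]
    rw [hx₁, Category.assoc, biprod.inr_desc] at hx
    rw [hx₁, P.zero_of_ι hx, zero_comp]
  · obtain ⟨z, hz⟩ := P.exists_lift (a + b ≫ P.κ) (by simpa using hab)
    exact ⟨biprod.lift (-b) z, by simp [← hz], by simp⟩
  · exact epi_of_epi_fac (strictInl_ρ _ _ _)

lemma roof_property (h : IsTorsionPair T F) (hX : tiltProperty T F X) :
    tiltProperty T F P.roof := by
  constructor
  · have : Mono (kernel.ι P.roof.d ≫ (biprod.fst : X.src ⊞ Y.src ⟶ _)) := by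
      refine Preadditive.mono_of_cancel_zero _ fun {V} x hx => ?_
      have hx₁ : x ≫ kernel.ι P.roof.d = (x ≫ kernel.ι P.roof.d ≫
          (biprod.snd : X.src ⊞ Y.src ⟶ _)) ≫ biprod.inr := by
        refine biprod.hom_ext _ _ ?_ (by simp)
        rw [Category.assoc, hx]
        simp
      have hx₂ : (x ≫ kernel.ι P.roof.d) ≫ P.roof.d = 0 := by simp
      rw [hx₁, Category.assoc, biprod.inr_desc] at hx₂
      rw [P.zero_of_ι hx₂, zero_comp] at hx₁
      exact zero_of_comp_mono _ hx₁
    exact h.free_kernel_of _ _ hX.1 (kernel.ι P.roof.d ≫ biprod.fst) (by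
      rw [Category.assoc, P.roof_fst_comm, kernel.condition_assoc, zero_comp])
  · obtain ⟨z, hz⟩ := P.exists_desc (cokernel.π P.roof.d) (by
      rw [show P.ι = biprod.inr ≫ P.roof.d by simp, Category.assoc, cokernel.condition, comp_zero])
    have : Epi z := epi_of_epi_fac hz.symm
    refine h.tors_cokernel_of _ _ hX.2 z ?_
    rw [← P.κ_σ, Category.assoc, ← hz, show P.κ = biprod.inl ≫ P.roof.d by simp, Category.assoc,
      cokernel.condition, comp_zero]

end roof

end Butterfly

namespace TwoTerm

open Butterfly

variable {T F : ObjectProperty A}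

section factor

variable {X W : TwoTerm A} {E : A} (a : X.src ⟶ E) (m : E ⟶ X.tgt) (hm : a ≫ m = X.d)

/-- For a factorization `d = a ≫ m`, the strict morphism from `[a]` to `[d]`. -/
noncomputable def factorLeft : (⟨X.src, E, a⟩ : TwoTerm A) ⟶ X :=
  (strict (X := ⟨X.src, E, a⟩) (Y := X) (𝟙 X.src) m (by simp [hm])).toHom

/-- For a factorization `d = a ≫ m`, the strict morphism from `[d]` to `[m]`. -/
noncomputable def factorRight : X ⟶ (⟨E, X.tgt, m⟩ : TwoTerm A) :=
  (strict (X := X) (Y := ⟨E, X.tgt, m⟩) a (𝟙 X.tgt) (by simp [hm])).toHom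

/-- The composite has components a and m, for which the identity of the intermediate object E is a
null-homotopy. -/
lemma factorLeft_comp_factorRight : factorLeft a m hm ≫ factorRight a m hm = 0 := by
  refine Eq.trans (Quotient.sound (strict_comp _ _ _ _ _ _)) ((strict_toHom_eq_zero_iff _ _ _).2 ?_)
  exact ⟨𝟙 E, by simp, by simp⟩

lemma factor_exists_lift (g : W ⟶ X) (hg : g ≫ factorRight a m hm = 0) :
    ∃ l : W ⟶ (⟨X.src, E, a⟩ : TwoTerm A), l ≫ factorLeft a m hm = g := by
  obtain ⟨R⟩ := g
  obtain ⟨θ, h₁, h₂, h₃, h₄⟩ := (comp_eq_zero_iff _ _).1 hg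
  set t := θ ≫ strictSnd _ _ _ with ht
  have hκ : R.κ ≫ t = 0 := by rw [ht, reassoc_of% h₁, zero_comp]
  have hι : R.ι ≫ t = -a := by rw [ht, reassoc_of% h₂, strict_κ_snd]
  have hρ : R.ρ + t ≫ m = 0 := by
    rw [strict_ρ, Preadditive.comp_add, reassoc_of% h₃, Category.comp_id] at h₄
    rw [ht, Category.assoc]
    exact h₄
  -- The lift keeps the middle object of g and replaces its wing into X⁰ by minus the E-component of
  -- θ; the sign makes ι followed by the new wing equal to a.
  let l : Butterfly W ⟨X.src, E, a⟩ :=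
    { E := R.E, κ := R.κ, ι := R.ι, σ := R.σ, ρ := -t
      κ_σ := R.κ_σ
      ι_ρ := by simp [hι]
      κ_ρ := by simp [hκ]
      ι_σ := R.ι_σ
      shortExact := R.shortExact }
  refine ⟨l.toHom, toHom_comp_strict l R _ _ _ (𝟙 R.E) (Category.comp_id _) ?_
    (Category.id_comp _) ?_⟩
  · exact (Category.comp_id _).trans (Category.id_comp _).symm
  · refine (Category.id_comp _).trans ?_
    change R.ρ = (-t) ≫ m
    rw [Preadditive.neg_comp]
    exact eq_neg_of_add_eq_zero_left hρ

lemma factor_exists_desc (g : X ⟶ W) (hg : factorLeft a m hm ≫ g = 0) :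
    ∃ l : (⟨E, X.tgt, m⟩ : TwoTerm A) ⟶ W, factorRight a m hm ≫ l = g := by
  obtain ⟨R⟩ := g
  obtain ⟨θ, h₁, h₂, h₃, h₄⟩ := (comp_eq_zero_iff _ _).1 hg
  set t := strictInl _ _ _ ≫ θ with ht
  have hκ : a ≫ t = R.κ := by
    rw [strict_κ_eq, Preadditive.sub_comp, Category.assoc, Category.assoc, h₂, Category.id_comp,
      sub_eq_zero] at h₁
    exact h₁
  have hσ : t ≫ R.σ = m := by rw [ht, Category.assoc, h₃, strictInl_ρ]
  have hρ : t ≫ R.ρ = 0 := by rw [ht, Category.assoc, h₄, comp_zero]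
  -- Dually, only the wing κ changes: X⁻¹ is replaced by E, mapped by the restriction of θ.
  let l : Butterfly ⟨E, X.tgt, m⟩ W :=
    { E := R.E, κ := t, ι := R.ι, σ := R.σ, ρ := R.ρ
      κ_σ := hσ
      ι_ρ := R.ι_ρ
      κ_ρ := hρ
      ι_σ := R.ι_σ
      shortExact := R.shortExact }
  exact ⟨l.toHom, strict_comp_toHom l R _ _ _ (𝟙 R.E) ((Category.comp_id _).trans hκ.symm)
    (Category.comp_id _) ((Category.id_comp _).trans (Category.comp_id _).symm)
    (Category.id_comp _)⟩

/-- The vanishing of the composite provides a retraction whose compatibility with ρ is known only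
after applying m. The defect kills the images of κ and ι and lands in the torsion-free ker m, hence
vanishes. -/
lemma factorLeft_cancel_zero (h : IsTorsionPair T F) (hW : T (cokernel W.d)) (hF : F (kernel m))
    (g : W ⟶ (⟨X.src, E, a⟩ : TwoTerm A)) (hg : g ≫ factorLeft a m hm = 0) : g = 0 := by
  obtain ⟨S⟩ := g
  obtain ⟨θ, h₁, h₂, h₃, h₄⟩ := (comp_eq_zero_iff _ _).1 hg
  set t := θ ≫ strictSnd _ _ _ with ht
  have hκ : S.κ ≫ t = 0 := by rw [ht, reassoc_of% h₁, zero_comp]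
  have hι : S.ι ≫ t = -𝟙 _ := by rw [ht, reassoc_of% h₂, strict_κ_snd]
  have hρ : S.ρ ≫ m + t ≫ X.d = 0 := by
    rw [strict_ρ, Preadditive.comp_add, reassoc_of% h₃] at h₄
    rw [ht, Category.assoc]
    exact h₄
  have hι' : S.ι ≫ S.ρ = a := S.ι_ρ
  have key : S.ρ + t ≫ a = 0 := by
    refine eq_zero_of_comp_eq_zero h S hW m hF _ ?_ ?_ ?_
    · simp [reassoc_of% hκ]
    · simp [reassoc_of% hι, hι']
    · simpa [hm] using hρ
  refine (toHom_eq_zero_iff_retraction S).2 ⟨-t, by simp [hι], by simp [hκ], ?_⟩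
  rw [Preadditive.neg_comp]
  exact (eq_neg_of_add_eq_zero_left key).symm

/-- Here a section is found whose compatibility with κ is known only after precomposition with a.
The defect factors through the torsion object coker a and lands in ker σ ∩ ker ρ = ker d_W. -/
lemma factorRight_cancel_zero (h : IsTorsionPair T F) (hW : F (kernel W.d)) (hT : T (cokernel a))
    (g : (⟨E, X.tgt, m⟩ : TwoTerm A) ⟶ W) (hg : factorRight a m hm ≫ g = 0) : g = 0 := by
  obtain ⟨S⟩ := g
  obtain ⟨θ, h₁, h₂, h₃, h₄⟩ := (comp_eq_zero_iff _ _).1 hg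
  set t := strictInl _ _ _ ≫ θ with ht
  have hκ : X.d ≫ t = a ≫ S.κ := by
    rw [strict_κ_eq, Preadditive.sub_comp, Category.assoc, Category.assoc, h₂, sub_eq_zero] at h₁
    exact h₁
  have hσ : t ≫ S.σ = 𝟙 _ := by rw [ht, Category.assoc, h₃, strictInl_ρ]
  have hρ : t ≫ S.ρ = 0 := by rw [ht, Category.assoc, h₄, comp_zero]
  have hκ' : S.κ ≫ S.σ = m := S.κ_σ
  have key : S.κ - m ≫ t = 0 := by
    refine eq_zero_of_comp_σ_ρ_eq_zero h S hW a hT _ ?_ ?_ ?_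
    · simp [hκ', hσ]
    · simp [hρ]
    · simp [reassoc_of% hm, hκ]
  exact toHom_eq_zero_of_section S t hσ hρ (sub_eq_zero.1 key).symm

end factor

end TwoTerm

end Butterflies

/-! ### The kernel, image and cokernel of a butterfly -/

section Tilting

variable {A : Type u} [Category.{v} A] [Abelian A] {T F : ObjectProperty A}

open Butterfly TwoTerm

namespace Butterfly

variable {X Y : TwoTerm A}

/-- For a butterfly with middle object `E`, there is a subobject `E'` of `E` between the images of
`κ` and the kernel of `ρ` such that the quotients are torsion and torsion-free. -/
lemma exists_torsion_middle (h : IsTorsionPair T F) (P : Butterfly X Y) :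
    ∃ (E : A) (a : X.src ⟶ E) (j : E ⟶ P.E) (hj : j ≫ P.ρ = 0), Mono j ∧ a ≫ j = P.κ ∧
      T (cokernel a) ∧ F (kernel (cokernel.desc j P.ρ hj)) := by
  let k := kernel.lift P.ρ P.κ P.κ_ρ
  have hk : k ≫ kernel.ι P.ρ = P.κ := kernel.lift_ι _ _ _
  -- The subobject is the preimage in ker ρ of the torsion part U of (ker ρ)/im κ.
  obtain ⟨U, V, i, p, w, hU, hV, hs⟩ := h.exists_shortExact (cokernel k)
  have := hs.mono_f
  have := hs.epi_g
  let fst := pullback.fst (cokernel.π k) i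
  let snd := pullback.snd (cokernel.π k) i
  have c : fst ≫ cokernel.π k = snd ≫ i := pullback.condition
  let j := fst ≫ kernel.ι P.ρ
  let a : X.src ⟶ pullback (cokernel.π k) i := pullback.lift k 0 (by simp)
  have ha₁ : a ≫ fst = k := pullback.lift_fst _ _ _
  have ha₂ : a ≫ snd = 0 := pullback.lift_snd _ _ _
  have hj : j ≫ P.ρ = 0 := by simp [j]
  have hjπ : fst ≫ kernel.ι P.ρ ≫ cokernel.π j = 0 := by
    rw [← Category.assoc, cokernel.condition]
  refine ⟨_, a, j, hj, inferInstance, by rw [← Category.assoc, ha₁, hk], ?_, ?_⟩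
  -- The projection to U is epi and its kernel lies in the image of a, so coker a is a quotient of
  -- U.
  · have h0 : kernel.ι snd ≫ cokernel.π a = 0 := by
      have ht : (kernel.ι snd ≫ fst) ≫ cokernel.π k = 0 := by
        rw [Category.assoc, c, kernel.condition_assoc, zero_comp]
      obtain ⟨V', π, hπ, x, hx⟩ :=
        (ShortComplex.exact_cokernel k).exact_up_to_refinements (kernel.ι snd ≫ fst) ht
      have hx : π ≫ kernel.ι snd ≫ fst = x ≫ k := hx
      have e : π ≫ kernel.ι snd = x ≫ a :=
        pullback.hom_ext (by simpa [fst, ha₁] using (hx.trans (congrArg _ ha₁.symm)))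
          (show (π ≫ kernel.ι snd) ≫ snd = (x ≫ a) ≫ snd by simp [ha₂])
      rw [← cancel_epi π, reassoc_of% e, cokernel.condition, comp_zero, comp_zero]
    have hd := Abelian.comp_epiDesc snd _ h0
    have : Epi (Abelian.epiDesc snd _ h0) := epi_of_epi_fac hd
    exact h.tors_of_epi (Abelian.epiDesc snd _ h0) hU
  · let ρ' := cokernel.desc j P.ρ hj
    have hρ' : cokernel.π j ≫ ρ' = P.ρ := cokernel.π_desc _ _ _
    let e : kernel P.ρ ⟶ kernel ρ' :=
      kernel.lift ρ' (kernel.ι P.ρ ≫ cokernel.π j) (by simp [hρ'])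
    have he : e ≫ kernel.ι ρ' = kernel.ι P.ρ ≫ cokernel.π j := kernel.lift_ι _ _ _
    have : Epi e := by
      rw [epi_iff_surjective_up_to_refinements]
      intro V' u
      obtain ⟨V'', π, hπ, x, hx⟩ :=
        surjective_up_to_refinements_of_epi (cokernel.π j) (u ≫ kernel.ι ρ')
      refine ⟨V'', π, hπ, kernel.lift P.ρ x ?_, ?_⟩
      · rw [← hρ', ← reassoc_of% hx, kernel.condition, comp_zero, comp_zero]
      · rw [← cancel_mono (kernel.ι ρ')]
        simp [hx, he]
    -- The kernel of e lies in the chosen subobject, so the map from ker ρ to the torsion-free part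
    -- V descends to ker ρ'. The descended map is mono, which makes ker ρ' torsion-free.
    have h0 : kernel.ι e ≫ cokernel.π k ≫ p = 0 := by
      have ht : (kernel.ι e ≫ kernel.ι P.ρ) ≫ cokernel.π j = 0 := by
        rw [Category.assoc, ← he, kernel.condition_assoc, zero_comp]
      have hl := Abelian.monoLift_comp j (kernel.ι e ≫ kernel.ι P.ρ) ht
      rw [← Category.assoc, cancel_mono] at hl
      rw [← hl, Category.assoc, reassoc_of% c, w, comp_zero, comp_zero]
    have hd := Abelian.comp_epiDesc e _ h0
    have : Mono (Abelian.epiDesc e _ h0) := by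
      refine Preadditive.mono_of_cancel_zero _ fun {V'} u hu => ?_
      obtain ⟨V'', π, hπ, t, ht⟩ := surjective_up_to_refinements_of_epi e u
      have ht' : (t ≫ cokernel.π k) ≫ p = 0 := by
        rw [Category.assoc, ← hd, ← reassoc_of% ht, hu, comp_zero]
      have hl : hs.exact.lift _ ht' ≫ i = t ≫ cokernel.π k := hs.exact.lift_f _ _
      have hy : pullback.lift t (hs.exact.lift _ ht') hl.symm ≫ fst = t := pullback.lift_fst _ _ _
      rw [← cancel_epi π, ht, ← cancel_mono (kernel.ι ρ'), Category.assoc, he, ← hy,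
        Category.assoc, hjπ, comp_zero, comp_zero, zero_comp]
    exact h.free_of_mono (Abelian.epiDesc e _ h0) hV

end Butterfly

namespace HRSTilt

variable (h : IsTorsionPair T F)

/-- Lifts and extensions exist for arbitrary two-term complexes; the torsion conditions on the outer
terms give their uniqueness. -/
lemma isKernelCokernelPair_factor (h : IsTorsionPair T F) {X : HRSTilt T F} {E : A}
    (a : X.obj.src ⟶ E) (m : E ⟶ X.obj.tgt) (hm : a ≫ m = X.obj.d)
    (hK : tiltProperty T F ⟨X.obj.src, E, a⟩) (hI : tiltProperty T F ⟨E, X.obj.tgt, m⟩) :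
    IsKernelCokernelPair (ObjectProperty.homMk (factorLeft a m hm) : (⟨_, hK⟩ : HRSTilt T F) ⟶ X)
      (ObjectProperty.homMk (factorRight a m hm) : X ⟶ (⟨_, hI⟩ : HRSTilt T F)) where
  zero := ObjectProperty.hom_ext _ (factorLeft_comp_factorRight a m hm)
  mono := Preadditive.mono_of_cancel_zero _ fun {W} g hg => ObjectProperty.hom_ext _
    (factorLeft_cancel_zero a m hm h W.property.2 hI.1 g.hom
      (congrArg InducedCategory.Hom.hom hg))
  epi := Preadditive.epi_of_cancel_zero _ fun {W} g hg => ObjectProperty.hom_ext _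
    (factorRight_cancel_zero a m hm h W.property.1 hK.2 g.hom
      (congrArg InducedCategory.Hom.hom hg))
  exists_lift g hg := by
    obtain ⟨l, hl⟩ := factor_exists_lift a m hm g.hom (congrArg InducedCategory.Hom.hom hg)
    exact ⟨ObjectProperty.homMk l, ObjectProperty.hom_ext _ hl⟩
  exists_desc g hg := by
    obtain ⟨l, hl⟩ := factor_exists_desc a m hm g.hom (congrArg InducedCategory.Hom.hom hg)
    exact ⟨ObjectProperty.homMk l, ObjectProperty.hom_ext _ hl⟩

/-- With j : E ⟶ P.E the intermediate subobject, the kernel is [X⁻¹ ⟶ E], the coimage [E ⟶ X⁰], the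
image [Y⁻¹ ⟶ P.E/E] and the cokernel [P.E/E ⟶ Y⁰]. The last two conclusions express when kernel and
cokernel have mono and epi differential through the wings of the butterfly alone. -/
lemma exists_factorization (h : IsTorsionPair T F) {X Y : HRSTilt T F}
    (P : Butterfly X.obj Y.obj) :
    ∃ (K I Q : HRSTilt T F) (k : K ⟶ X) (p : X ⟶ I) (m : I ⟶ Y) (q : Y ⟶ Q),
      p ≫ m = ObjectProperty.homMk P.toHom ∧ IsKernelCokernelPair k p ∧
      IsKernelCokernelPair m q ∧ (Mono K.obj.d ↔ Mono P.κ) ∧ (Epi Q.obj.d ↔ Epi P.ρ) := by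
  obtain ⟨E, a, j, hj, hmono, ha, hT, hF⟩ := exists_torsion_middle h P
  let π := cokernel.π j
  let ρ' := cokernel.desc j P.ρ hj
  have hρ' : π ≫ ρ' = P.ρ := cokernel.π_desc _ _ _
  have hjπ : j ≫ π = 0 := cokernel.condition j
  have hκπ : P.κ ≫ π = 0 := by rw [← ha, Category.assoc, hjπ, comp_zero]
  have hm : a ≫ j ≫ P.σ = X.obj.d := by rw [reassoc_of% ha, P.κ_σ]
  have hm' : (P.ι ≫ π) ≫ ρ' = Y.obj.d := by rw [Category.assoc, hρ', P.ι_ρ]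
  have hK : tiltProperty T F ⟨X.obj.src, E, a⟩ := by
    refine ⟨h.free_kernel_of a X.obj.d X.property.1 (kernel.ι a) ?_, hT⟩
    rw [← hm, kernel.condition_assoc, zero_comp]
  have hI : tiltProperty T F ⟨E, X.obj.tgt, j ≫ P.σ⟩ := by
    constructor
    -- The kernel of E ⟶ X⁰ lies in Y⁻¹, and in ker d_Y because E lies in ker ρ.
    · obtain ⟨z, hz⟩ := P.exists_lift (kernel.ι (j ≫ P.σ) ≫ j) (by simp)
      have : Mono z := mono_of_mono_fac hz.symm
      refine h.free_kernel_of (j ≫ P.σ) Y.obj.d Y.property.1 z ?_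
      rw [← P.ι_ρ, ← Category.assoc, ← hz, Category.assoc, hj, comp_zero]
    · refine h.tors_cokernel_of X.obj.d (j ≫ P.σ) X.property.2 (cokernel.π _) ?_
      rw [← hm, Category.assoc, cokernel.condition, comp_zero]
  have hI' : tiltProperty T F ⟨Y.obj.src, cokernel j, P.ι ≫ π⟩ := by
    constructor
    · refine h.free_kernel_of (P.ι ≫ π) Y.obj.d Y.property.1 (kernel.ι _) ?_
      rw [← hm', kernel.condition_assoc, zero_comp]
    · obtain ⟨z, hz⟩ := P.exists_desc (π ≫ cokernel.π (P.ι ≫ π))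
        (by rw [← Category.assoc, cokernel.condition])
      have : Epi z := epi_of_epi_fac hz.symm
      refine h.tors_cokernel_of X.obj.d (P.ι ≫ π) X.property.2 z ?_
      rw [← P.κ_σ, Category.assoc, ← hz, reassoc_of% hκπ, zero_comp]
  have hQ : tiltProperty T F ⟨cokernel j, Y.obj.tgt, ρ'⟩ := by
    refine ⟨hF, h.tors_cokernel_of Y.obj.d ρ' Y.property.2 (cokernel.π _) ?_⟩
    rw [← hm', Category.assoc, cokernel.condition, comp_zero]
  -- The same middle object P.E compares coimage and image; now both diagonals are short exact, the
  -- second one being E ⟶ P.E ⟶ P.E/E.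
  let Φ : Butterfly ⟨E, X.obj.tgt, j ≫ P.σ⟩ ⟨Y.obj.src, cokernel j, P.ι ≫ π⟩ :=
    { E := P.E, κ := j, ι := P.ι, σ := P.σ, ρ := π
      κ_σ := rfl
      ι_ρ := rfl
      κ_ρ := hjπ
      ι_σ := P.ι_σ
      shortExact := P.shortExact }
  have hΦ : IsIso Φ.toHom := isIso_toHom _
    (ShortComplex.ShortExact.mk' (ShortComplex.exact_cokernel j) hmono
      (inferInstanceAs (Epi (cokernel.π j))))
  let Φ' : (⟨_, hI⟩ : HRSTilt T F) ⟶ ⟨_, hI'⟩ := ObjectProperty.homMk Φ.toHom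
  have : IsIso Φ' := (ObjectProperty.isIso_hom_iff _).1 hΦ
  refine ⟨⟨_, hK⟩, ⟨_, hI⟩, ⟨_, hQ⟩, _, _, _, _, ?_,
    isKernelCokernelPair_factor h a (j ≫ P.σ) hm hK hI,
    (isKernelCokernelPair_factor h (P.ι ≫ π) ρ' hm' hI' hQ).of_iso_left Φ', ?_, ?_⟩
  · apply ObjectProperty.hom_ext
    let P' : Butterfly ⟨E, X.obj.tgt, j ≫ P.σ⟩ Y.obj :=
      { E := P.E, κ := j, ι := P.ι, σ := P.σ, ρ := P.ρ
        κ_σ := rfl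
        ι_ρ := P.ι_ρ
        κ_ρ := hj
        ι_σ := P.ι_σ
        shortExact := P.shortExact }
    have e₁ : Φ.toHom ≫ factorLeft (P.ι ≫ π) ρ' hm' = P'.toHom :=
      toHom_comp_strict Φ P' _ _ _ (𝟙 P.E) (Category.comp_id _)
        ((Category.comp_id _).trans (Category.id_comp _).symm) (Category.id_comp _)
        ((Category.id_comp _).trans hρ'.symm)
    have e₂ : factorRight a (j ≫ P.σ) hm ≫ P'.toHom = P.toHom :=
      strict_comp_toHom P' P _ _ _ (𝟙 P.E) ((Category.comp_id _).trans ha.symm)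
        (Category.comp_id _) ((Category.id_comp _).trans (Category.comp_id _).symm)
        (Category.id_comp _)
    change factorRight a (j ≫ P.σ) hm ≫ Φ.toHom ≫ factorLeft (P.ι ≫ π) ρ' hm' = P.toHom
    rw [e₁, e₂]
  · change Mono a ↔ Mono P.κ
    rw [← ha]
    exact ⟨fun _ => inferInstance, fun _ => mono_of_mono a j⟩
  · change Epi ρ' ↔ Epi P.ρ
    rw [← hρ']
    exact ⟨fun _ => inferInstance, fun _ => epi_of_epi π ρ'⟩

end HRSTilt

end Tilting

/-! ### The tilt is abelian, its torsion pair, and the objects of the iterated tilt -/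

section Tilting

open scoped ZeroObject

variable {A : Type u} [Category.{v} A] [Abelian A] {T F : ObjectProperty A}

open Butterfly TwoTerm

namespace Butterfly

variable {X Y Z : TwoTerm A}

lemma strict_toHom_comp (f : X.src ⟶ Y.src) (g : X.tgt ⟶ Y.tgt) (w : f ≫ Y.d = X.d ≫ g)
    (f' : Y.src ⟶ Z.src) (g' : Y.tgt ⟶ Z.tgt) (w' : f' ≫ Z.d = Y.d ≫ g') :
    (strict f g w).toHom ≫ (strict f' g' w').toHom =
      (strict (f ≫ f') (g ≫ g') (by simp [w', reassoc_of% w])).toHom :=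
  Quotient.sound (strict_comp _ _ _ _ _ _)

end Butterfly

namespace TwoTerm

/-- The direct sum of two two-term complexes. -/
noncomputable abbrev sum (X Y : TwoTerm A) : TwoTerm A :=
  ⟨X.src ⊞ Y.src, X.tgt ⊞ Y.tgt, biprod.map X.d Y.d⟩

lemma sum_property (h : IsTorsionPair T F) {X Y : TwoTerm A} (hX : tiltProperty T F X)
    (hY : tiltProperty T F Y) : tiltProperty T F (X.sum Y) := by
  constructor
  · refine h.free_of_forall fun U hU f => ?_
    rw [← cancel_mono (kernel.ι (biprod.map X.d Y.d)), zero_comp]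
    refine biprod.hom_ext _ _ ?_ ?_
    · have e : (f ≫ kernel.ι (biprod.map X.d Y.d) ≫ biprod.fst) ≫ X.d = 0 := by
        simp only [Category.assoc]
        rw [← biprod.map_fst, kernel.condition_assoc, zero_comp, comp_zero]
      have := congrArg (fun t => t ≫ kernel.ι _) (h.hom_eq_zero hU hX.1 (kernel.lift _ _ e))
      simpa using this
    · have e : (f ≫ kernel.ι (biprod.map X.d Y.d) ≫ biprod.snd) ≫ Y.d = 0 := by
        simp only [Category.assoc]
        rw [← biprod.map_snd, kernel.condition_assoc, zero_comp, comp_zero]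
      have := congrArg (fun t => t ≫ kernel.ι _) (h.hom_eq_zero hU hY.1 (kernel.lift _ _ e))
      simpa using this
  · refine h.tors_of_forall fun U hU f => ?_
    rw [← cancel_epi (cokernel.π (biprod.map X.d Y.d)), comp_zero]
    refine biprod.hom_ext' _ _ ?_ ?_
    · have e : X.d ≫ biprod.inl ≫ cokernel.π (biprod.map X.d Y.d) ≫ f = 0 := by
        rw [← biprod.inl_map_assoc, cokernel.condition_assoc, zero_comp, comp_zero]
      have := congrArg (fun t => cokernel.π _ ≫ t) (h.hom_eq_zero hX.2 hU (cokernel.desc _ _ e))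
      simpa using this
    · have e : Y.d ≫ biprod.inr ≫ cokernel.π (biprod.map X.d Y.d) ≫ f = 0 := by
        rw [← biprod.inr_map_assoc, cokernel.condition_assoc, zero_comp, comp_zero]
      have := congrArg (fun t => cokernel.π _ ≫ t) (h.hom_eq_zero hY.2 hU (cokernel.desc _ _ e))
      simpa using this

end TwoTerm

namespace HRSTilt

/-- The strict morphism of the tilt given by a morphism of complexes. -/
noncomputable def strictHom {X Y : HRSTilt T F} (f : X.obj.src ⟶ Y.obj.src)
    (g : X.obj.tgt ⟶ Y.obj.tgt) (w : f ≫ Y.obj.d = X.obj.d ≫ g) : X ⟶ Y :=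
  ObjectProperty.homMk (strict f g w).toHom

section

variable {X Y Z : HRSTilt T F} (f : X.obj.src ⟶ Y.obj.src)
    (g : X.obj.tgt ⟶ Y.obj.tgt) (w : f ≫ Y.obj.d = X.obj.d ≫ g)

lemma strictHom_comp (f' : Y.obj.src ⟶ Z.obj.src) (g' : Y.obj.tgt ⟶ Z.obj.tgt)
    (w' : f' ≫ Z.obj.d = Y.obj.d ≫ g') :
    strictHom f g w ≫ strictHom f' g' w' =
      strictHom (f ≫ f') (g ≫ g') (by simp [w', reassoc_of% w]) :=
  ObjectProperty.hom_ext _ (strict_toHom_comp _ _ _ _ _ _)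

lemma strictHom_add (f' : X.obj.src ⟶ Y.obj.src) (g' : X.obj.tgt ⟶ Y.obj.tgt)
    (w' : f' ≫ Y.obj.d = X.obj.d ≫ g') :
    strictHom f g w + strictHom f' g' w' = strictHom (f + f') (g + g') (by simp [w, w']) :=
  ObjectProperty.hom_ext _ (strict_add _ _ _ _ _ _)

lemma strictHom_eq_zero_iff : strictHom f g w = 0 ↔
    ∃ h : X.obj.tgt ⟶ Y.obj.src, X.obj.d ≫ h = f ∧ h ≫ Y.obj.d = g := by
  rw [← strict_toHom_eq_zero_iff f g w]
  exact ⟨fun h => congrArg InducedCategory.Hom.hom h, fun h => ObjectProperty.hom_ext _ h⟩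

lemma strictHom_id : strictHom (𝟙 X.obj.src) (𝟙 X.obj.tgt) (by simp) = 𝟙 X := rfl

lemma strictHom_congr {f f' : X.obj.src ⟶ Y.obj.src} {g g' : X.obj.tgt ⟶ Y.obj.tgt}
    (w : f ≫ Y.obj.d = X.obj.d ≫ g) (hf : f = f') (hg : g = g') :
    strictHom f g w = strictHom f' g' (by rw [← hf, ← hg, w]) := by
  subst hf hg
  rfl

end

/-- The middle object is an extension of X⁰ = 0 by Y⁻¹ = 0, hence zero. -/
lemma eq_zero_of_isZero_tgt_src {X Y : HRSTilt T F} (hX : IsZero X.obj.tgt)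
    (hY : IsZero Y.obj.src) (f : X ⟶ Y) : f = 0 := by
  obtain ⟨⟨P⟩⟩ := f
  refine ObjectProperty.hom_ext _ ((toHom_eq_zero_iff_retraction P).2 ⟨0, hY.eq_of_src _ _, by simp,
    ?_⟩)
  have : Mono P.σ := P.shortExact.exact.mono_g (hY.eq_of_src _ _)
  have h0 : P.σ = 0 := hX.eq_of_tgt _ _
  rw [zero_comp, ← cancel_epi (𝟙 P.E), show 𝟙 P.E = 0 by rw [← cancel_mono P.σ, h0]; simp,
    zero_comp, zero_comp]

lemma hasFiniteProducts (h : IsTorsionPair T F) : HasFiniteProducts (HRSTilt T F) := by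
  have : HasZeroObject (HRSTilt T F) := by
    have h0 : IsZero (0 : A) := isZero_zero A
    refine ⟨⟨⟨⟨0, 0, 0⟩, ?_, ?_⟩, (IsZero.iff_id_eq_zero _).2
      ((strictHom_eq_zero_iff _ _ _).2 ⟨0, h0.eq_of_src _ _, h0.eq_of_src _ _⟩)⟩⟩
    · exact h.free_of_mono (kernel.ι (0 : (0 : A) ⟶ 0)) (h.free_of_isZero h0)
    · exact h.tors_of_epi (cokernel.π (0 : (0 : A) ⟶ 0)) (h.tors_of_isZero h0)
  have : HasBinaryBiproducts (HRSTilt T F) := ⟨fun X Y => by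
    let S : HRSTilt T F := ⟨X.obj.sum Y.obj, sum_property h X.property Y.property⟩
    let b : BinaryBicone X Y :=
      { pt := S
        fst := strictHom (X := S) (Y := X) biprod.fst biprod.fst (by simp [S])
        snd := strictHom (X := S) (Y := Y) biprod.snd biprod.snd (by simp [S])
        inl := strictHom (X := X) (Y := S) biprod.inl biprod.inl (by simp [S])
        inr := strictHom (X := Y) (Y := S) biprod.inr biprod.inr (by simp [S])
        inl_fst := (strictHom_comp _ _ _ _ _ _).trans
          (strictHom_congr _ biprod.inl_fst biprod.inl_fst)
        inl_snd := (strictHom_comp _ _ _ _ _ _).trans ((strictHom_eq_zero_iff _ _ _).2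
          ⟨0, comp_zero.trans biprod.inl_snd.symm, zero_comp.trans biprod.inl_snd.symm⟩)
        inr_fst := (strictHom_comp _ _ _ _ _ _).trans ((strictHom_eq_zero_iff _ _ _).2
          ⟨0, comp_zero.trans biprod.inr_fst.symm, zero_comp.trans biprod.inr_fst.symm⟩)
        inr_snd := (strictHom_comp _ _ _ _ _ _).trans
          (strictHom_congr _ biprod.inr_snd biprod.inr_snd) }
    refine hasBinaryBiproduct_of_total b ?_
    dsimp only [b]
    rw [strictHom_comp, strictHom_comp, strictHom_add]
    exact strictHom_congr _ biprod.total biprod.total⟩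
  exact hasFiniteProducts_of_has_binary_and_terminal

/-- The tilt of an abelian category with respect to a torsion pair is abelian. -/
@[reducible]
noncomputable def abelian (h : IsTorsionPair T F) : Abelian (HRSTilt T F) :=
  have := hasFiniteProducts h
  abelianOfFactorization fun {X Y} f => by
    obtain ⟨⟨P⟩⟩ := f
    obtain ⟨K, I, Q, k, p, m, q, e, hk, hq, -⟩ := exists_factorization h P
    exact ⟨K, I, Q, k, p, m, q, e, hk, hq⟩

/-- The inclusion of the kernel is a strict morphism [ker d ⟶ 0] ⟶ X. It vanishes for X in T, and a
null-homotopy, factoring through 0, forces ker d = 0. If d is mono, X ⟶ [0 ⟶ coker d] is an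
isomorphism. -/
lemma tiltFree_iff (h : IsTorsionPair T F) (X : HRSTilt T F) : tiltFree T F X ↔ Mono X.obj.d := by
  constructor
  · rintro ⟨Y, hY, ⟨e⟩⟩
    have h0 := isZero_zero A
    let K : HRSTilt T F := ⟨⟨kernel X.obj.d, 0, 0⟩,
      h.free_of_mono (kernel.ι (0 : kernel X.obj.d ⟶ 0)) X.property.1,
      h.tors_of_epi (cokernel.π (0 : kernel X.obj.d ⟶ 0)) (h.tors_of_isZero h0)⟩
    have hz : strictHom (X := K) (Y := X) (kernel.ι X.obj.d) 0 (by simp [K]) = 0 := by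
      refine (cancel_mono e.hom).1 (Eq.trans ?_ zero_comp.symm)
      exact eq_zero_of_isZero_tgt_src h0 hY _
    obtain ⟨t, ht, -⟩ := (strictHom_eq_zero_iff _ _ _).1 hz
    refine Preadditive.mono_of_kernel_zero (?_ : kernel.ι X.obj.d = 0)
    rw [← ht, h0.eq_of_src t 0, comp_zero]
  · intro hX
    have h0 := isZero_zero A
    let Q : HRSTilt T F := ⟨⟨0, cokernel X.obj.d, 0⟩,
      h.free_of_mono (kernel.ι (0 : 0 ⟶ cokernel X.obj.d)) (h.free_of_isZero h0),
      h.tors_of_epi (cokernel.π (0 : 0 ⟶ cokernel X.obj.d)) X.property.2⟩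
    refine ⟨Q, h0, ⟨?_⟩⟩
    have : IsIso (strictHom (X := X) (Y := Q) 0 (cokernel.π X.obj.d) (by simp [Q])) := by
      refine (ObjectProperty.isIso_hom_iff _).1 (isIso_strict (X := X.obj) (Y := Q.obj) _ _ _
        (fun x hx _ => zero_of_comp_mono X.obj.d hx) (fun {V} a b hab => ?_) ?_)
      · have ha : a ≫ cokernel.π X.obj.d = 0 := by
          rw [h0.eq_of_tgt b 0] at hab
          simpa using hab
        exact ⟨Abelian.monoLift X.obj.d a ha, Abelian.monoLift_comp _ _ _, h0.eq_of_tgt _ _⟩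
      · have : Epi (cokernel.π X.obj.d) := inferInstance
        exact epi_of_epi_fac (strictInl_ρ _ _ _)
    exact asIso (strictHom (X := X) (Y := Q) 0 (cokernel.π X.obj.d) _)

/-- The dual argument uses X ⟶ [0 ⟶ coker d], and for epi d the isomorphism [ker d ⟶ 0] ⟶ X. -/
lemma tiltTors_iff (h : IsTorsionPair T F) (X : HRSTilt T F) : tiltTors T F X ↔ Epi X.obj.d := by
  constructor
  · rintro ⟨Y, hY, ⟨e⟩⟩
    have h0 := isZero_zero A
    let Q : HRSTilt T F := ⟨⟨0, cokernel X.obj.d, 0⟩,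
      h.free_of_mono (kernel.ι (0 : 0 ⟶ cokernel X.obj.d)) (h.free_of_isZero h0),
      h.tors_of_epi (cokernel.π (0 : 0 ⟶ cokernel X.obj.d)) X.property.2⟩
    have hz : strictHom (X := X) (Y := Q) 0 (cokernel.π X.obj.d) (by simp [Q]) = 0 := by
      refine (cancel_epi e.inv).1 (Eq.trans ?_ comp_zero.symm)
      exact eq_zero_of_isZero_tgt_src hY h0 _
    obtain ⟨t, -, ht⟩ := (strictHom_eq_zero_iff _ _ _).1 hz
    refine Preadditive.epi_of_cokernel_zero (?_ : cokernel.π X.obj.d = 0)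
    rw [← ht, h0.eq_of_tgt t 0, zero_comp]
  · intro hX
    have h0 := isZero_zero A
    let K : HRSTilt T F := ⟨⟨kernel X.obj.d, 0, 0⟩,
      h.free_of_mono (kernel.ι (0 : kernel X.obj.d ⟶ 0)) X.property.1,
      h.tors_of_epi (cokernel.π (0 : kernel X.obj.d ⟶ 0)) (h.tors_of_isZero h0)⟩
    refine ⟨K, h0, ⟨?_⟩⟩
    have : IsIso (strictHom (X := K) (Y := X) (kernel.ι X.obj.d) 0 (by simp [K])) := by
      refine (ObjectProperty.isIso_hom_iff _).1 (isIso_strict (X := K.obj) (Y := X.obj) _ _ _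
        (fun x _ hx => zero_of_comp_mono (kernel.ι X.obj.d) hx) (fun {V} a b hab => ?_) ?_)
      · have hb : (-b) ≫ X.obj.d = 0 := by
          rw [comp_zero, _root_.zero_add] at hab
          rw [Preadditive.neg_comp, hab, neg_zero]
        exact ⟨kernel.lift X.obj.d (-b) hb, h0.eq_of_tgt _ _, kernel.lift_ι _ _ _⟩
      · exact epi_of_epi_fac (Butterfly.ι_ρ _)
    exact (asIso (strictHom (X := K) (Y := X) (kernel.ι X.obj.d) 0 _)).symm

lemma tiltFree_of_iso {X Y : HRSTilt T F} (e : X ≅ Y) (hX : tiltFree T F X) : tiltFree T F Y := by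
  obtain ⟨Z, hZ, ⟨f⟩⟩ := hX
  exact ⟨Z, hZ, ⟨e.symm ≪≫ f⟩⟩

lemma tiltTors_of_iso {X Y : HRSTilt T F} (e : X ≅ Y) (hX : tiltTors T F X) : tiltTors T F Y := by
  obtain ⟨Z, hZ, ⟨f⟩⟩ := hX
  exact ⟨Z, hZ, ⟨e.symm ≪≫ f⟩⟩

/-- The torsion pair `(F[1], T)` in the tilt. -/
lemma isTorsionPair (h : IsTorsionPair T F) :
    letI := abelian h
    IsTorsionPair (tiltTors T F) (tiltFree T F) := by
  let _ := abelian h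
  refine ⟨⟨fun e hX => tiltTors_of_iso e hX⟩, ⟨fun e hX => tiltFree_of_iso e hX⟩, ?_, fun X => ?_⟩
  · rintro X Y ⟨X', hX, ⟨e⟩⟩ ⟨Y', hY, ⟨e'⟩⟩ f
    have := eq_zero_of_isZero_tgt_src hX hY (e.inv ≫ f ≫ e'.hom)
    rw [← cancel_epi e.inv, ← cancel_mono e'.hom, Category.assoc, this]
    simp
  -- The torsion sequence of X is the kernel-cokernel pair of the factorization of d through its
  -- image.
  · have hm : factorThruImage X.obj.d ≫ image.ι X.obj.d = X.obj.d := image.fac _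
    have hK : tiltProperty T F ⟨X.obj.src, image X.obj.d, factorThruImage X.obj.d⟩ := by
      constructor
      · refine h.free_kernel_of (factorThruImage X.obj.d) X.obj.d X.property.1 (kernel.ι _) ?_
        refine (congrArg _ hm.symm).trans ?_
        rw [kernel.condition_assoc, zero_comp]
      · exact h.tors_of_isZero (isZero_cokernel_of_epi _)
    have hI : tiltProperty T F ⟨image X.obj.d, X.obj.tgt, image.ι X.obj.d⟩ := by
      constructor
      · exact h.free_of_isZero (isZero_kernel_of_mono _)
      · refine h.tors_cokernel_of X.obj.d (image.ι X.obj.d) X.property.2 (cokernel.π _) ?_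
        refine (congrArg (· ≫ _) hm.symm).trans ?_
        rw [Category.assoc, cokernel.condition, comp_zero]
    have key := isKernelCokernelPair_factor h _ _ hm hK hI
    refine ⟨⟨_, hK⟩, ⟨_, hI⟩, _, _, key.zero, ?_, ?_, ?_⟩
    · exact (tiltTors_iff h _).2 (inferInstanceAs (Epi (factorThruImage X.obj.d)))
    · exact (tiltFree_iff h _).2 (inferInstanceAs (Mono (image.ι X.obj.d)))
    · obtain ⟨_, ⟨hl⟩⟩ := key.nonempty_isLimit (Category.comp_id _)
      exact ShortComplex.ShortExact.mk' (ShortComplex.exact_of_f_is_kernel _ hl) key.mono key.epi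

/-- A morphism of the tilt is an object of the iterated tilt if and only if, for any
representing butterfly, `κ` is a monomorphism and `ρ` an epimorphism. -/
lemma tiltProperty_iff (h : IsTorsionPair T F) {X Y : HRSTilt T F}
    (P : Butterfly X.obj Y.obj) :
    letI := abelian h
    tiltProperty (tiltTors T F) (tiltFree T F)
      (⟨X, Y, ObjectProperty.homMk P.toHom⟩ : TwoTerm (HRSTilt T F)) ↔ Mono P.κ ∧ Epi P.ρ := by
  let _ := abelian h
  obtain ⟨K, I, Q, k, p, m, q, e, hk, hq, hK, hQ⟩ := exists_factorization h P
  have := hq.mono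
  have := hk.epi
  obtain ⟨_, ⟨hl⟩⟩ := hk.nonempty_isLimit e
  obtain ⟨_, ⟨hc⟩⟩ := hq.nonempty_isColimit e
  let eK := IsLimit.conePointUniqueUpToIso (kernelIsKernel
    (ObjectProperty.homMk P.toHom : X ⟶ Y)) hl
  let eQ := IsColimit.coconePointUniqueUpToIso (cokernelIsCokernel
    (ObjectProperty.homMk P.toHom : X ⟶ Y)) hc
  rw [← hK, ← hQ, ← tiltFree_iff h, ← tiltTors_iff h]
  exact and_congr ⟨tiltFree_of_iso eK, tiltFree_of_iso eK.symm⟩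
    ⟨tiltTors_of_iso eQ, tiltTors_of_iso eQ.symm⟩

end HRSTilt

end Tilting

/-! ### Commutative squares of butterflies -/

section Tilting

variable {A : Type u} [Category.{v} A] [Abelian A] {T F : ObjectProperty A}

namespace Butterfly

variable {X Y X' Y' : TwoTerm A}

/-- A commutative square of butterflies with strict horizontal sides is induced by a map of the
middle objects of the vertical sides. -/
lemma exists_map_of_strict_square (Q : Butterfly X Y) (P : Butterfly X' Y') (a : X.src ⟶ X'.src)
    (a' : X.tgt ⟶ X'.tgt) (ha : a ≫ X'.d = X.d ≫ a') (b : Y.src ⟶ Y'.src) (b' : Y.tgt ⟶ Y'.tgt)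
    (hb : b ≫ Y'.d = Y.d ≫ b')
    (h : Q.toHom ≫ (strict b b' hb).toHom = (strict a a' ha).toHom ≫ P.toHom) :
    ∃ u : Q.E ⟶ P.E, Q.κ ≫ u = a ≫ P.κ ∧ Q.ι ≫ u = b ≫ P.ι ∧ u ≫ P.σ = Q.σ ≫ a' ∧
      u ≫ P.ρ = Q.ρ ≫ b' := by
  rw [toHom_comp, toHom_comp, toHom_eq_iff] at h
  obtain ⟨e, h₁, h₂, h₃, h₄⟩ := h
  have c := pullback.condition (f := (strict a a' ha).ρ) (g := P.σ)
  -- The composite of a strict butterfly with P maps back to the middle object of P by (x, y) ↦ y -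
  -- κ(x'), where x' is the component of x in X'⁻¹.
  obtain ⟨r, hr⟩ : ∃ r : ((strict a a' ha).comp P).E ⟶ P.E, compπ _ P ≫ r =
      pullback.snd _ _ - pullback.fst _ _ ≫ strictSnd a a' ha ≫ P.κ :=
    ⟨cokernel.desc _ _ (by
        simp [preComp, pullback.lift_snd, pullback.lift_fst_assoc,
          reassoc_of% strict_ι_snd a a' ha]
        rfl),
      cokernel.π_desc _ _ _⟩
  have hr' {V : A} (x : V ⟶ (strict a a' ha).E) (y : V ⟶ P.E) (hxy) :
      compMk _ P x y hxy ≫ r = y - x ≫ strictSnd a a' ha ≫ P.κ := by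
    rw [compMk, Category.assoc, hr]
    simp [pullback.lift_snd, pullback.lift_fst_assoc]
  have hrσ : r ≫ P.σ = ((strict a a' ha).comp P).σ ≫ a' := by
    rw [← cancel_epi (compπ _ P), reassoc_of% hr, reassoc_of% compπ_σ]
    simp [← c, strict_ρ]
  have hrρ : r ≫ P.ρ = ((strict a a' ha).comp P).ρ := by
    rw [← cancel_epi (compπ _ P), reassoc_of% hr, compπ_ρ]
    simp
  have hκ : Q.κ ≫ compMk Q (strict b b' hb) (𝟙 _) (Q.ρ ≫ strictInl _ _ _) (by simp) =
      (Q.comp (strict b b' hb)).κ := by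
    rw [precomp_compMk, comp_κ]
    congr 1 <;> simp
  have hι : Q.ι ≫ compMk Q (strict b b' hb) (𝟙 _) (Q.ρ ≫ strictInl _ _ _) (by simp) =
      b ≫ (Q.comp (strict b b' hb)).ι := by
    rw [precomp_compMk, comp_ι, precomp_compMk]
    exact compMk_eq _ _ (𝟙 _) (by simp) (by simp [strict_κ_eq])
  -- An element x of Q.E is sent to the class of (x, (ρ(x), 0)) in the other composite, then along
  -- the isomorphism e and back by r.
  refine ⟨compMk Q (strict b b' hb) (𝟙 _) (Q.ρ ≫ strictInl _ _ _) (by simp) ≫ e.hom ≫ r,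
    ?_, ?_, ?_, ?_⟩
  · rw [reassoc_of% hκ, reassoc_of% h₁, comp_κ, hr']
    simp [reassoc_of% strict_κ_snd a a' ha]
  · rw [reassoc_of% hι, reassoc_of% h₂, comp_ι, hr']
    simp
  · simp [hrσ, reassoc_of% h₃, reassoc_of% compMk_σ Q (strict b b' hb)]
  · simp [hrρ, h₄]

section roofSquare

variable (P : Butterfly X Y) (P' : Butterfly X' Y') (a : Butterfly X X') (b : Butterfly Y Y')
  (Q : Butterfly a.roof b.roof) (u : Q.E ⟶ P.E)

/-- An element of X⁻¹ ⊞ X'⁻¹ killed by κ has first component zero because P.κ is mono, and then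
second component zero because the ι of a is mono. -/
lemma mono_κ_of_roof_square [Mono P.κ] (hκ : Q.κ ≫ u = biprod.fst ≫ P.κ) : Mono Q.κ := by
  refine Preadditive.mono_of_cancel_zero _ fun {V} x hx => ?_
  have h₁ : x ≫ biprod.fst = 0 := by
    rw [← cancel_mono P.κ, Category.assoc, ← hκ, reassoc_of% hx, zero_comp, zero_comp]
  have h₂ : x = (x ≫ biprod.snd) ≫ biprod.inr := biprod.hom_ext _ _ (by simp [h₁]) (by simp)
  have h₃ : x ≫ a.roof.d = 0 := by rw [← Q.κ_σ, reassoc_of% hx, zero_comp]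
  rw [h₂, Category.assoc, biprod.inr_desc] at h₃
  rw [h₂, a.zero_of_ι h₃, zero_comp]

lemma epi_of_roof_square (hι : Q.ι ≫ u = biprod.fst ≫ P.ι) (hσ : u ≫ P.σ = Q.σ ≫ a.σ) :
    Epi u := by
  rw [epi_iff_surjective_up_to_refinements]
  intro V e
  obtain ⟨V', π, _, x, hx⟩ := surjective_up_to_refinements_of_epi (Q.σ ≫ a.σ) (e ≫ P.σ)
  obtain ⟨z, hz⟩ := P.exists_lift (π ≫ e - x ≫ u) (by simp [hx, hσ])
  exact ⟨V', π, inferInstance, x + z ≫ biprod.inl ≫ Q.ι, by simp [hι, ← hz]⟩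

/-- The summand Y'⁻¹ of the source of Q.ι is invisible to u but moves Q.ρ by the kernel of b.σ. So ρ
can be adjusted to any value compatible with u. -/
lemma exists_lift_of_roof_square (hι : Q.ι ≫ u = biprod.fst ≫ P.ι)
    (hρ : u ≫ P.ρ = Q.ρ ≫ b.σ) {V : A} (x : V ⟶ Q.E) (y : V ⟶ b.E)
    (h : x ≫ u ≫ P.ρ = y ≫ b.σ) : ∃ x' : V ⟶ Q.E, x' ≫ Q.ρ = y ∧ x' ≫ u = x ≫ u := by
  obtain ⟨z, hz⟩ := b.exists_lift (y - x ≫ Q.ρ) (by simp [← h, hρ])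
  have h₁ : biprod.inr ≫ Q.ι ≫ Q.ρ = b.ι := by simp
  refine ⟨x + z ≫ biprod.inr ≫ Q.ι, ?_, by simp [hι]⟩
  simp only [Preadditive.add_comp, Category.assoc, h₁, ← hz]
  abel

lemma epi_ρ_of_roof_square [Epi P.ρ] (hι : Q.ι ≫ u = biprod.fst ≫ P.ι)
    (hσ : u ≫ P.σ = Q.σ ≫ a.σ) (hρ : u ≫ P.ρ = Q.ρ ≫ b.σ) : Epi Q.ρ := by
  have := epi_of_roof_square P a b Q u hι hσ
  rw [epi_iff_surjective_up_to_refinements]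
  intro V y
  obtain ⟨V', π, _, x, hx⟩ := surjective_up_to_refinements_of_epi (u ≫ P.ρ) (y ≫ b.σ)
  obtain ⟨x', hx', -⟩ := exists_lift_of_roof_square P a b Q u hι hρ x (π ≫ y) (by simp [hx])
  exact ⟨V', π, inferInstance, x', hx'.symm⟩

/-- A commutative square of butterflies is dominated by a commutative square of butterflies with
strict horizontal sides. -/
lemma exists_roof_square (h : a.toHom ≫ P'.toHom = P.toHom ≫ b.toHom) :
    ∃ Q : Butterfly a.roof b.roof,
      (∃ u : Q.E ⟶ P.E, Q.κ ≫ u = biprod.fst ≫ P.κ ∧ Q.ι ≫ u = biprod.fst ≫ P.ι ∧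
        u ≫ P.σ = Q.σ ≫ a.σ ∧ u ≫ P.ρ = Q.ρ ≫ b.σ) ∧
      ∃ f : Q.E ⟶ P'.E, Q.κ ≫ f = biprod.snd ≫ P'.κ ∧ Q.ι ≫ f = biprod.snd ≫ P'.ι ∧
        f ≫ P'.σ = Q.σ ≫ a.ρ ∧ f ≫ P'.ρ = Q.ρ ≫ b.ρ := by
  -- Q is P transported along the invertible first legs of the two roofs; the squares with the
  -- second legs then commute by the assumption.
  obtain ⟨Q, hQ⟩ : ∃ Q : Butterfly a.roof b.roof,
      Q.toHom = a.roofFst ≫ P.toHom ≫ inv b.roofFst := Quotient.exists_rep _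
  refine ⟨Q, exists_map_of_strict_square Q P _ _ a.roof_fst_comm _ _ b.roof_fst_comm ?_,
    exists_map_of_strict_square Q P' _ _ a.roof_snd_comm _ _ b.roof_snd_comm ?_⟩
  · change Q.toHom ≫ b.roofFst = a.roofFst ≫ P.toHom
    simp [hQ]
  · change Q.toHom ≫ b.roofSnd = a.roofSnd ≫ P'.toHom
    rw [← roofFst_comp, ← roofFst_comp, hQ]
    simp [h]

end roofSquare

end Butterfly

end Tilting

/-! ### Factoring through subobjects -/

section Subobject

variable {C : Type u} [Category.{v} C]

namespace CategoryTheory.Subobject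

lemma factors_mk_iff {X Y Z : C} (k : X ⟶ Y) [Mono k] (g : Z ⟶ Y) :
    (Subobject.mk k).Factors g ↔ ∃ t : Z ⟶ X, t ≫ k = g :=
  Subobject.mk_factors_iff k g

lemma factors_mk_arrow_comp {X Y Z : C} (k : X ⟶ Y) [Mono k] (K : Subobject Z) (g : Y ⟶ Z) :
    K.Factors ((Subobject.mk k).arrow ≫ g) ↔ K.Factors (k ≫ g) := by
  constructor
  · intro h
    rw [← Subobject.underlyingIso_arrow k, Category.assoc]
    exact K.factors_of_factors_right _ h
  · intro h
    rw [← Subobject.underlyingIso_hom_comp_eq_mk k, Category.assoc]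
    exact K.factors_of_factors_right _ h

lemma comp_eq_zero_of_mk_arrow [HasZeroMorphisms C] {X Y Z : C} (k : X ⟶ Y) [Mono k] (g : Y ⟶ Z)
    (h : (Subobject.mk k).arrow ≫ g = 0) : k ≫ g = 0 := by
  rw [← Subobject.underlyingIso_arrow k, Category.assoc, h, comp_zero]

lemma factors_iff_exists {X Z : C} (K : Subobject X) (g : Z ⟶ X) :
    K.Factors g ↔ ∃ t : Z ⟶ (K : C), t ≫ K.arrow = g :=
  ⟨fun h => ⟨_, K.factorThru_arrow g h⟩, by rintro ⟨t, rfl⟩; exact K.factors_comp_arrow t⟩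

end CategoryTheory.Subobject

end Subobject

/-! ### Quadruples and the functor K₂/K₁ -/

section Tilting

open scoped ZeroObject

variable {A : Type u} [Category.{v} A] [Abelian A] {T F : ObjectProperty A}

namespace Quad

open Subobject

lemma eq_zero_of_factors (h : IsTorsionPair T F) (Z : Quad T F) {U : A} (hU : T U) (t : U ⟶ Z.E)
    (h₂ : Z.K₂.Factors t) (hM : Z.M.Factors t) : t = 0 := by
  have hf : (Z.K₂ ⊓ Z.M).Factors t := (Subobject.inf_factors t).2 ⟨h₂, hM⟩
  rw [← Subobject.factorThru_arrow _ _ hf, h.hom_eq_zero hU Z.free (Subobject.factorThru _ t hf),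
    zero_comp]

lemma eq_zero_of_arrow_comp (h : IsTorsionPair T F) (Z : Quad T F) {V : A} (hV : F V)
    (p : Z.E ⟶ V) (h₁ : Z.K₁.arrow ≫ p = 0) (hM : Z.M.arrow ≫ p = 0) : p = 0 := by
  have hle : Z.K₁ ⊔ Z.M ≤ kernelSubobject p :=
    sup_le (le_kernelSubobject p Z.K₁ h₁) (le_kernelSubobject p Z.M hM)
  have h0 : (Z.K₁ ⊔ Z.M).arrow ≫ p = 0 := by
    rw [← Subobject.ofLE_arrow hle, Category.assoc, kernelSubobject_arrow_comp, comp_zero]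
  rw [← cokernel.π_desc _ p h0, h.hom_eq_zero Z.tors hV (cokernel.desc _ p h0), comp_zero]

/-- The quadruple given by monomorphisms `k₁`, `k₂`, `m` with a common target. -/
noncomputable abbrev ofMonos (h : IsTorsionPair T F) {E A₁ A₂ B : A} (k₁ : A₁ ⟶ E) (k₂ : A₂ ⟶ E)
    (m : B ⟶ E) [Mono k₁] [Mono k₂] [Mono m] (l : A₁ ⟶ A₂) (hl : l ≫ k₂ = k₁)
    (hF : ∀ {U : A}, T U → ∀ (x : U ⟶ A₂) (y : U ⟶ B), x ≫ k₂ = y ≫ m → x ≫ k₂ = 0)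
    (hT : ∀ {V : A}, F V → ∀ p : E ⟶ V, k₁ ≫ p = 0 → m ≫ p = 0 → p = 0) : Quad T F where
  E := E
  K₁ := Subobject.mk k₁
  K₂ := Subobject.mk k₂
  M := Subobject.mk m
  le := Subobject.mk_le_mk_of_comm l hl
  free := h.free_of_forall fun U hU f => by
    have hf := (Subobject.inf_factors _).1 ((Subobject.mk k₂ ⊓ Subobject.mk m).factors_comp_arrow f)
    obtain ⟨x, hx⟩ := (Subobject.factors_mk_iff k₂ _).1 hf.1
    obtain ⟨y, hy⟩ := (Subobject.factors_mk_iff m _).1 hf.2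
    rw [← cancel_mono (Subobject.arrow _), zero_comp, ← hx, hF hU x y (hx.trans hy.symm)]
  tors := h.tors_of_forall fun V hV f => by
    rw [← cancel_epi (cokernel.π _), comp_zero]
    refine hT hV _ ?_ ?_
    · exact comp_eq_zero_of_mk_arrow k₁ _ (by rw [reassoc_of% arrow_comp_π le_sup_left, zero_comp])
    · exact comp_eq_zero_of_mk_arrow m _ (by rw [reassoc_of% arrow_comp_π le_sup_right, zero_comp])

/-- The projection `K₂ ⟶ K₂ / K₁`. -/
noncomputable def quotientπ (Z : Quad T F) : (Z.K₂ : A) ⟶ (quotient T F).obj Z :=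
  cokernel.π (Subobject.ofLE Z.K₁ Z.K₂ Z.le)

lemma ofLE_quotientπ (Z : Quad T F) : Subobject.ofLE Z.K₁ Z.K₂ Z.le ≫ Z.quotientπ = 0 :=
  cokernel.condition _

instance (Z : Quad T F) : Epi Z.quotientπ :=
  inferInstanceAs (Epi (cokernel.π (Subobject.ofLE Z.K₁ Z.K₂ Z.le)))

variable {Z Z' : Quad T F}

lemma quotientπ_map (f : Z ⟶ Z') : Z.quotientπ ≫ (quotient T F).map f =
    Z'.K₂.factorThru _ (Hom.map₂ f) ≫ Z'.quotientπ :=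
  cokernel.π_desc _ _ _

lemma comp_quotientπ_map (f : Z ⟶ Z') {V : A} (x : V ⟶ Z.K₂) (y : V ⟶ Z'.K₂)
    (h : x ≫ Z.K₂.arrow ≫ Hom.f f = y ≫ Z'.K₂.arrow) :
    x ≫ Z.quotientπ ≫ (quotient T F).map f = y ≫ Z'.quotientπ := by
  rw [quotientπ_map, ← Category.assoc]
  congr 1
  rw [← cancel_mono Z'.K₂.arrow, ← h]
  simp

lemma comp_quotientπ_eq_zero_iff {V : A} (x : V ⟶ Z.K₂) :
    x ≫ Z.quotientπ = 0 ↔ Z.K₁.Factors (x ≫ Z.K₂.arrow) := by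
  constructor
  · intro h
    have e : Abelian.monoLift (Subobject.ofLE Z.K₁ Z.K₂ Z.le) x h ≫ _ = x :=
      Abelian.monoLift_comp _ _ _
    rw [← e, Category.assoc, Subobject.ofLE_arrow]
    exact Z.K₁.factors_comp_arrow _
  · intro h
    have e : x = Z.K₁.factorThru _ h ≫ Subobject.ofLE Z.K₁ Z.K₂ Z.le := by
      rw [← cancel_mono Z.K₂.arrow]
      simp
    rw [e, Category.assoc, ofLE_quotientπ, comp_zero]

lemma comp_quotientπ_map_eq_zero_iff (f : Z ⟶ Z') {V : A} (x : V ⟶ Z.K₂) :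
    x ≫ Z.quotientπ ≫ (quotient T F).map f = 0 ↔ Z'.K₁.Factors (x ≫ Z.K₂.arrow ≫ Hom.f f) := by
  rw [quotientπ_map, ← Category.assoc, comp_quotientπ_eq_zero_iff]
  simp

lemma quotient_map_eq_zero_iff (f : Z ⟶ Z') :
    (quotient T F).map f = 0 ↔ Z'.K₁.Factors (Z.K₂.arrow ≫ Hom.f f) := by
  rw [← cancel_epi Z.quotientπ, comp_zero]
  simpa using comp_quotientπ_map_eq_zero_iff f (𝟙 _)

lemma mono_quotient_map (f : Z ⟶ Z') (h : ∀ {V : A} (x : V ⟶ Z.K₂),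
    Z'.K₁.Factors (x ≫ Z.K₂.arrow ≫ Hom.f f) → Z.K₁.Factors (x ≫ Z.K₂.arrow)) :
    Mono ((quotient T F).map f) := by
  refine Preadditive.mono_of_cancel_zero _ fun {V} t ht => ?_
  obtain ⟨V', π, _, x, hx⟩ := surjective_up_to_refinements_of_epi Z.quotientπ t
  rw [← cancel_epi π, comp_zero, hx, comp_quotientπ_eq_zero_iff]
  refine h x ?_
  rw [← comp_quotientπ_map_eq_zero_iff, ← reassoc_of% hx, ht, comp_zero]

lemma epi_quotient_map (f : Z ⟶ Z') (h : ∀ {V : A} (y : V ⟶ Z'.K₂),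
    ∃ (V' : A) (π : V' ⟶ V) (_ : Epi π) (x : V' ⟶ Z.K₂),
      x ≫ Z.K₂.arrow ≫ Hom.f f = π ≫ y ≫ Z'.K₂.arrow) : Epi ((quotient T F).map f) := by
  rw [epi_iff_surjective_up_to_refinements]
  intro V t
  obtain ⟨V', π, _, y, hy⟩ := surjective_up_to_refinements_of_epi Z'.quotientπ t
  obtain ⟨V'', π', _, x, hx⟩ := h y
  refine ⟨V'', π' ≫ π, inferInstance, x ≫ Z.quotientπ, ?_⟩
  rw [Category.assoc, hy, Category.assoc,
    comp_quotientπ_map f x (π' ≫ y) (by rw [hx, Category.assoc]), Category.assoc]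

/-- The difference of two morphisms of quadruples. -/
lemma exists_sub (f g : Z ⟶ Z') : ∃ d : Z ⟶ Z', Hom.f d = Hom.f f - Hom.f g := by
  have key {K : Subobject Z.E} {K' : Subobject Z'.E} (hf : K'.Factors (K.arrow ≫ Hom.f f))
      (hg : K'.Factors (K.arrow ≫ Hom.f g)) :
      K'.Factors (K.arrow ≫ (Hom.f f - Hom.f g)) := by
    obtain ⟨s, hs⟩ := (factors_iff_exists _ _).1 hf
    obtain ⟨t, ht⟩ := (factors_iff_exists _ _).1 hg
    exact (factors_iff_exists _ _).2 ⟨s - t, by simp [hs, ht]⟩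
  exact ⟨⟨_, key f.map₁ g.map₁, key f.map₂ g.map₂, key f.mapM g.mapM⟩, rfl⟩

lemma quotient_map_eq_add {f g d : Z ⟶ Z'} (h : Hom.f d = Hom.f f - Hom.f g) :
    (quotient T F).map f = (quotient T F).map g + (quotient T F).map d := by
  rw [← cancel_epi Z.quotientπ, Preadditive.comp_add, quotientπ_map, quotientπ_map, quotientπ_map,
    ← Preadditive.add_comp]
  congr 1
  rw [← cancel_mono Z'.K₂.arrow]
  simp [h]

/-- The apex lives on E ⊞ E' with K₁ ⊞ K₁' and M ⊞ M', and its middle subobject R consists of the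
pairs in K₂ ⊞ K₂' whose classes correspond under g. Then R/(K₁ ⊞ K₁') is the graph of g. The torsion
conditions hold componentwise, since R ∩ (M ⊞ M') lies in (K₂ ∩ M) ⊞ (K₂' ∩ M'). -/
lemma quotient_hasRoofs (h : IsTorsionPair T F) : Roof.HasRoofs (quotient T F) := by
  refine ⟨fun {a b} g => ?_⟩
  let R := pullback (a.quotientπ ≫ g) b.quotientπ
  let k₁ : (a.K₁ : A) ⊞ (b.K₁ : A) ⟶ a.E ⊞ b.E := biprod.map a.K₁.arrow b.K₁.arrow
  let k₂ : R ⟶ a.E ⊞ b.E :=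
    biprod.lift (pullback.fst _ _ ≫ a.K₂.arrow) (pullback.snd _ _ ≫ b.K₂.arrow)
  let m : (a.M : A) ⊞ (b.M : A) ⟶ a.E ⊞ b.E := biprod.map a.M.arrow b.M.arrow
  have h₁ : k₂ ≫ biprod.fst = pullback.fst _ _ ≫ a.K₂.arrow := biprod.lift_fst _ _
  have h₂ : k₂ ≫ biprod.snd = pullback.snd _ _ ≫ b.K₂.arrow := biprod.lift_snd _ _
  have hc := pullback.condition (f := a.quotientπ ≫ g) (g := b.quotientπ)
  have : Mono k₁ := inferInstanceAs (Mono (biprod.map _ _))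
  have : Mono m := inferInstanceAs (Mono (biprod.map _ _))
  have : Mono k₂ := by
    refine Preadditive.mono_of_cancel_zero _ fun {V} t ht => pullback.hom_ext ?_ ?_
    · rw [← cancel_mono a.K₂.arrow, Category.assoc, ← h₁, reassoc_of% ht]
      simp
    · rw [← cancel_mono b.K₂.arrow, Category.assoc, ← h₂, reassoc_of% ht]
      simp
  let l : (a.K₁ : A) ⊞ (b.K₁ : A) ⟶ R := pullback.lift (biprod.fst ≫ Subobject.ofLE _ _ a.le)
    (biprod.snd ≫ Subobject.ofLE _ _ b.le) (by
      simp [reassoc_of% ofLE_quotientπ a, ofLE_quotientπ b])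
  have l₁ : l ≫ pullback.fst _ _ = biprod.fst ≫ Subobject.ofLE _ _ a.le := pullback.lift_fst _ _ _
  have l₂ : l ≫ pullback.snd _ _ = biprod.snd ≫ Subobject.ofLE _ _ b.le := pullback.lift_snd _ _ _
  let c : Quad T F := ofMonos h k₁ k₂ m l
    (biprod.hom_ext _ _ (by simp [h₁, reassoc_of% l₁, k₁]) (by simp [h₂, reassoc_of% l₂, k₁]))
    (fun {U} hU x y hxy => biprod.hom_ext _ _
      (Eq.trans (a.eq_zero_of_factors h hU _
        ((factors_iff_exists _ _).2 ⟨x ≫ pullback.fst _ _, by simp [h₁]⟩)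
        ((factors_iff_exists _ _).2 ⟨y ≫ biprod.fst, by rw [hxy]; simp [m]⟩)) zero_comp.symm)
      (Eq.trans (b.eq_zero_of_factors h hU _
        ((factors_iff_exists _ _).2 ⟨x ≫ pullback.snd _ _, by simp [h₂]⟩)
        ((factors_iff_exists _ _).2 ⟨y ≫ biprod.snd, by rw [hxy]; simp [m]⟩)) zero_comp.symm))
    (fun {V} hV p hp hp' => biprod.hom_ext' _ _
      (Eq.trans (a.eq_zero_of_arrow_comp h hV _
        (by simpa [k₁] using biprod.inl ≫= hp) (by simpa [m] using biprod.inl ≫= hp'))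
        comp_zero.symm)
      (Eq.trans (b.eq_zero_of_arrow_comp h hV _
        (by simpa [k₁] using biprod.inr ≫= hp) (by simpa [m] using biprod.inr ≫= hp'))
        comp_zero.symm))
  let s : c ⟶ a := ⟨(biprod.fst : a.E ⊞ b.E ⟶ a.E),
    (factors_mk_arrow_comp k₁ _ _).2 ((factors_iff_exists _ _).2 ⟨biprod.fst, by simp [k₁]⟩),
    (factors_mk_arrow_comp k₂ _ _).2 ((factors_iff_exists _ _).2 ⟨_, h₁.symm⟩),
    (factors_mk_arrow_comp m _ _).2 ((factors_iff_exists _ _).2 ⟨biprod.fst, by simp [m]⟩)⟩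
  let f : c ⟶ b := ⟨(biprod.snd : a.E ⊞ b.E ⟶ b.E),
    (factors_mk_arrow_comp k₁ _ _).2 ((factors_iff_exists _ _).2 ⟨biprod.snd, by simp [k₁]⟩),
    (factors_mk_arrow_comp k₂ _ _).2 ((factors_iff_exists _ _).2 ⟨_, h₂.symm⟩),
    (factors_mk_arrow_comp m _ _).2 ((factors_iff_exists _ _).2 ⟨biprod.snd, by simp [m]⟩)⟩
  let e : (c.K₂ : A) ≅ R := Subobject.underlyingIso k₂
  have he : e.hom ≫ k₂ = c.K₂.arrow := Subobject.underlyingIso_hom_comp_eq_mk k₂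
  have hs : c.quotientπ ≫ (quotient T F).map s = (e.hom ≫ pullback.fst _ _) ≫ a.quotientπ := by
    simpa using comp_quotientπ_map s (𝟙 _) (e.hom ≫ pullback.fst _ _) (by
      rw [← he]
      simpa [s] using e.hom ≫= h₁)
  have hf : c.quotientπ ≫ (quotient T F).map f = (e.hom ≫ pullback.snd _ _) ≫ b.quotientπ := by
    simpa using comp_quotientπ_map f (𝟙 _) (e.hom ≫ pullback.snd _ _) (by
      rw [← he]
      simpa [f] using e.hom ≫= h₂)
  have hsf : (quotient T F).map s ≫ g = (quotient T F).map f := by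
    rw [← cancel_epi c.quotientπ, reassoc_of% hs, hf, Category.assoc, ← hc]
  refine ⟨c, s, f, ?_, hsf⟩
  have : Epi ((quotient T F).map s) := by
    have : Epi (c.quotientπ ≫ (quotient T F).map s) := by
      rw [hs]
      infer_instance
    exact epi_of_epi c.quotientπ _
  -- If the first component of an element of R lies in K₁, its class and the image of this class
  -- under g vanish, so the second component lies in K₁'.
  have : Mono ((quotient T F).map s) := by
    refine mono_quotient_map s fun {V} x hx => ?_
    have hx' := hx
    rw [← comp_quotientπ_map_eq_zero_iff] at hx'
    have hy : x ≫ c.quotientπ ≫ (quotient T F).map f = 0 := by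
      rw [← hsf, reassoc_of% hx', zero_comp]
    rw [comp_quotientπ_map_eq_zero_iff] at hy
    obtain ⟨y, hy⟩ := (factors_iff_exists _ _).1 hy
    obtain ⟨x', hx'⟩ := (factors_iff_exists _ _).1 hx
    refine (Subobject.factors_mk_iff k₁ _).2 ⟨biprod.lift x' y, biprod.hom_ext _ _ ?_ ?_⟩
    · simpa [k₁, s] using hx'
    · simpa [k₁, f] using hy
  exact isIso_of_mono_of_epi _

lemma quotient_nonempty_iso (h : IsTorsionPair T F) {E A₁ A₂ B Q : A} {k₁ : A₁ ⟶ E} {k₂ : A₂ ⟶ E}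
    {m : B ⟶ E} [Mono k₁] [Mono k₂] [Mono m] {l : A₁ ⟶ A₂} (hl : l ≫ k₂ = k₁) (hF) (hT)
    (p : A₂ ⟶ Q) [Epi p] (hp : l ≫ p = 0)
    (hp' : ∀ {V : A} (t : V ⟶ A₂), t ≫ p = 0 → ∃ s, s ≫ l = t) :
    Nonempty ((quotient T F).obj (ofMonos h k₁ k₂ m l hl hF hT) ≅ Q) := by
  set c := ofMonos h k₁ k₂ m l hl hF hT
  let e : (c.K₂ : A) ≅ A₂ := Subobject.underlyingIso k₂
  have he : e.hom ≫ k₂ = c.K₂.arrow := Subobject.underlyingIso_hom_comp_eq_mk k₂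
  let e' : (c.K₁ : A) ≅ A₁ := Subobject.underlyingIso k₁
  have he' : e'.hom ≫ k₁ = c.K₁.arrow := Subobject.underlyingIso_hom_comp_eq_mk k₁
  have hle : Subobject.ofLE c.K₁ c.K₂ c.le ≫ e.hom = e'.hom ≫ l := by
    rw [← cancel_mono k₂, Category.assoc, he, Subobject.ofLE_arrow, Category.assoc, hl, he']
  have w : Subobject.ofLE c.K₁ c.K₂ c.le ≫ e.hom ≫ p = 0 := by
    rw [reassoc_of% hle, hp, comp_zero]
  let d : (quotient T F).obj c ⟶ Q := cokernel.desc _ (e.hom ≫ p) w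
  have hd : c.quotientπ ≫ d = e.hom ≫ p := cokernel.π_desc _ _ _
  have : Epi d := epi_of_epi_fac hd
  have : Mono d := by
    refine Preadditive.mono_of_cancel_zero _ fun {V} t ht => ?_
    obtain ⟨V', π, _, x, hx⟩ := surjective_up_to_refinements_of_epi c.quotientπ t
    rw [← cancel_epi π, comp_zero, hx, comp_quotientπ_eq_zero_iff]
    obtain ⟨s, hs⟩ := hp' (x ≫ e.hom) (by
      rw [Category.assoc, ← hd, ← reassoc_of% hx, ht, comp_zero])
    refine (Subobject.factors_mk_iff k₁ _).2 ⟨s, ?_⟩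
    rw [← hl, reassoc_of% hs, he]
  have := isIso_of_mono_of_epi d
  exact ⟨asIso d⟩

/-- For an embedding of Q into a torsion object Y, take [0 ⊆ Q ⊆ Y ⊇ 0]; for an epimorphism p from a
torsion-free Y onto Q, take [ker p ⊆ Y ⊆ Y ⊇ Y]. -/
lemma quotient_essSurj (h : IsTorsionPair T F) (htc : IsTilting T ∨ IsCotilting F) :
    (quotient T F).EssSurj := by
  refine ⟨fun Q => ?_⟩
  rcases htc with ht | hc
  · obtain ⟨Y, i, hY, _⟩ := ht Q
    obtain ⟨e⟩ := quotient_nonempty_iso h (k₁ := (0 : (0 : A) ⟶ Y)) (k₂ := i)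
      (m := (0 : (0 : A) ⟶ Y))
      (l := 0) zero_comp (fun _ x y hxy => by rw [hxy, comp_zero])
      (fun hV p _ _ => h.hom_eq_zero hY hV p) (𝟙 Q) zero_comp
      (fun t ht => ⟨0, by rw [comp_zero, ← ht, Category.comp_id]⟩)
    exact ⟨_, ⟨e⟩⟩
  · obtain ⟨Y, p, hY, _⟩ := hc Q
    obtain ⟨e⟩ := quotient_nonempty_iso h (k₁ := kernel.ι p) (k₂ := 𝟙 Y) (m := 𝟙 Y)
      (l := kernel.ι p) (Category.comp_id _)
      (fun hU x y _ => h.hom_eq_zero hU hY _)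
      (fun hV p _ hp => by rwa [Category.id_comp] at hp) p (kernel.condition p)
      (fun t ht => ⟨kernel.lift p t ht, kernel.lift_ι _ _ _⟩)
    exact ⟨_, ⟨e⟩⟩

end Quad

end Tilting

/-! ### Quadruples as morphisms of the tilt -/

section Tilting

open scoped ZeroObject

variable {A : Type u} [Category.{v} A] [Abelian A] {T F : ObjectProperty A}

lemma HRSTilt.isIso_strictHom {X Y : HRSTilt T F} (f : X.obj.src ⟶ Y.obj.src)
    (g : X.obj.tgt ⟶ Y.obj.tgt) (w : f ≫ Y.obj.d = X.obj.d ≫ g) (hf : IsIso f)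
    (hg : IsIso g) : IsIso (strictHom f g w) :=
  ⟨strictHom (inv f) (inv g) (by simp [← w]),
    (strictHom_comp _ _ _ _ _ _).trans (strictHom_congr _ (by simp) (by simp)),
    (strictHom_comp _ _ _ _ _ _).trans (strictHom_congr _ (by simp) (by simp))⟩

namespace Quad

open Subobject HRSTilt

section ofButterfly

variable (h : IsTorsionPair T F) {X Y : HRSTilt T F} (P : Butterfly X.obj Y.obj) [Mono P.κ]

/-- The quadruple formed by the middle object of a butterfly and its wings. -/
noncomputable abbrev ofButterfly : Quad T F :=
  ofMonos h P.κ (kernel.ι P.ρ) P.ι (kernel.lift P.ρ P.κ P.κ_ρ) (kernel.lift_ι _ _ _)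
    (fun {U} hU x y hxy => by
      -- The intersection of ker ρ with Y⁻¹ lies in ker d_Y, which is torsion-free.
      have hy : y ≫ Y.obj.d = 0 := by
        rw [← P.ι_ρ, ← Category.assoc, ← hxy, Category.assoc, kernel.condition, comp_zero]
      rw [hxy, ← kernel.lift_ι _ y hy, h.hom_eq_zero hU Y.property.1 (kernel.lift _ y hy),
        zero_comp, zero_comp])
    (fun hV p hκ hι => P.eq_zero_of_tors_free h X.property.2 hV p hκ hι)

/-- The map `E / Y⁻¹ ⟶ X⁰` induced by `σ`. -/
noncomputable def ofButterflyσ : cokernel (ofButterfly h P).M.arrow ⟶ X.obj.tgt :=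
  cokernel.desc _ P.σ (by
    rw [← underlyingIso_hom_comp_eq_mk P.ι, Category.assoc, P.ι_σ, comp_zero])

lemma π_ofButterflyσ : cokernel.π (ofButterfly h P).M.arrow ≫ ofButterflyσ h P = P.σ :=
  cokernel.π_desc _ _ _

instance : IsIso (ofButterflyσ h P) := by
  obtain ⟨z, hz⟩ := P.exists_desc (cokernel.π (ofButterfly h P).M.arrow)
    (comp_eq_zero_of_mk_arrow P.ι _ (cokernel.condition _))
  have := π_ofButterflyσ h P
  refine ⟨z, ?_, ?_⟩
  · rw [← cancel_epi (cokernel.π (ofButterfly h P).M.arrow), reassoc_of% this, ← hz,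
      Category.comp_id]
  · rw [← cancel_epi P.σ, ← reassoc_of% hz, this, Category.comp_id]

/-- The map `E / ker ρ ⟶ Y⁰` induced by `ρ`. -/
noncomputable def ofButterflyρ : cokernel (ofButterfly h P).K₂.arrow ⟶ Y.obj.tgt :=
  cokernel.desc _ P.ρ (by
    rw [← underlyingIso_hom_comp_eq_mk (kernel.ι P.ρ), Category.assoc, kernel.condition, comp_zero])

lemma π_ofButterflyρ : cokernel.π (ofButterfly h P).K₂.arrow ≫ ofButterflyρ h P = P.ρ :=
  cokernel.π_desc _ _ _

instance [Epi P.ρ] : IsIso (ofButterflyρ h P) := by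
  obtain ⟨z, hz⟩ : ∃ z, P.ρ ≫ z = cokernel.π (ofButterfly h P).K₂.arrow :=
    ⟨_, Abelian.comp_epiDesc P.ρ _
      (comp_eq_zero_of_mk_arrow (kernel.ι P.ρ) _ (cokernel.condition _))⟩
  have := π_ofButterflyρ h P
  refine ⟨z, ?_, ?_⟩
  · rw [← cancel_epi (cokernel.π (ofButterfly h P).K₂.arrow), reassoc_of% this, hz,
      Category.comp_id]
  · rw [← cancel_epi P.ρ, reassoc_of% hz, this, Category.comp_id]

/-- The strict isomorphism from `[K₁ ⟶ E / M]` to `X`. -/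
noncomputable def srcOfButterfly : (src h).obj (ofButterfly h P) ⟶ X :=
  have w : (underlyingIso P.κ).hom ≫ X.obj.d =
      ((ofButterfly h P).K₁.arrow ≫ cokernel.π (ofButterfly h P).M.arrow) ≫ ofButterflyσ h P := by
    rw [Category.assoc, π_ofButterflyσ, ← P.κ_σ, ← Category.assoc, underlyingIso_hom_comp_eq_mk]
  strictHom (X := (src h).obj (ofButterfly h P)) (underlyingIso P.κ).hom (ofButterflyσ h P) w

instance : IsIso (srcOfButterfly h P) :=
  isIso_strictHom (X := (src h).obj (ofButterfly h P)) (underlyingIso P.κ).hom (ofButterflyσ h P) _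
    (inferInstanceAs (IsIso (underlyingIso P.κ).hom)) (inferInstanceAs (IsIso (ofButterflyσ h P)))

/-- The strict isomorphism from `[M ⟶ E / K₂]` to `Y`. -/
noncomputable def tgtOfButterfly : (tgt h).obj (ofButterfly h P) ⟶ Y :=
  have w : (underlyingIso P.ι).hom ≫ Y.obj.d =
      ((ofButterfly h P).M.arrow ≫ cokernel.π (ofButterfly h P).K₂.arrow) ≫ ofButterflyρ h P := by
    rw [Category.assoc, π_ofButterflyρ, ← P.ι_ρ, ← Category.assoc, underlyingIso_hom_comp_eq_mk]
  strictHom (X := (tgt h).obj (ofButterfly h P)) (underlyingIso P.ι).hom (ofButterflyρ h P) w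

instance [Epi P.ρ] : IsIso (tgtOfButterfly h P) :=
  isIso_strictHom (X := (tgt h).obj (ofButterfly h P)) (underlyingIso P.ι).hom (ofButterflyρ h P) _
    (inferInstanceAs (IsIso (underlyingIso P.ι).hom)) (inferInstanceAs (IsIso (ofButterflyρ h P)))

/-- The morphism `X ⟶ Y` of the tilt attached to a quadruple. -/
noncomputable def hom (Z : Quad T F) : (src h).obj Z ⟶ (tgt h).obj Z :=
  ObjectProperty.homMk (butterfly h Z).toHom

lemma hom_tgtOfButterfly :
    (ofButterfly h P).hom h ≫ tgtOfButterfly h P =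
      srcOfButterfly h P ≫ (ObjectProperty.homMk P.toHom : X ⟶ Y) := by
  apply ObjectProperty.hom_ext
  refine Quotient.sound (Butterfly.strict_square (butterfly h (ofButterfly h P)) P _ _ (𝟙 P.E)
    ?_ ?_ ?_ ?_)
  · exact (Category.comp_id _).trans (underlyingIso_hom_comp_eq_mk P.κ).symm
  · exact (Category.comp_id _).trans (underlyingIso_hom_comp_eq_mk P.ι).symm
  · exact (Category.id_comp _).trans (π_ofButterflyσ h P).symm
  · exact (Category.id_comp _).trans (π_ofButterflyρ h P).symm

variable (b : Quad T F)

/-- A map of middle objects over strict morphisms respects all subobjects: K₁ and M by the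
conditions on κ and ι, and K₂ = ker ρ by the condition on ρ. -/
lemma exists_hom_of_ofButterfly (f : P.E ⟶ (butterfly h b).E)
    (α : X.obj.src ⟶ ((src h).obj b).obj.src) (α' : X.obj.tgt ⟶ ((src h).obj b).obj.tgt)
    (hα : α ≫ ((src h).obj b).obj.d = X.obj.d ≫ α')
    (β : Y.obj.src ⟶ ((tgt h).obj b).obj.src) (β' : Y.obj.tgt ⟶ ((tgt h).obj b).obj.tgt)
    (hβ : β ≫ ((tgt h).obj b).obj.d = Y.obj.d ≫ β')
    (hκ : P.κ ≫ f = α ≫ (butterfly h b).κ) (hι : P.ι ≫ f = β ≫ (butterfly h b).ι)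
    (hσ : f ≫ (butterfly h b).σ = P.σ ≫ α') (hρ : f ≫ (butterfly h b).ρ = P.ρ ≫ β') :
    ∃ φ : ofButterfly h P ⟶ b, Hom.f φ = f ∧
      (src h).map φ = srcOfButterfly h P ≫ strictHom α α' hα ∧
      (tgt h).map φ = tgtOfButterfly h P ≫ strictHom β β' hβ := by
  have h₁ : b.K₁.Factors ((ofButterfly h P).K₁.arrow ≫ f) :=
    (factors_mk_arrow_comp P.κ _ _).2 ((factors_iff_exists _ _).2 ⟨α, hκ.symm⟩)
  have hM : b.M.Factors ((ofButterfly h P).M.arrow ≫ f) :=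
    (factors_mk_arrow_comp P.ι _ _).2 ((factors_iff_exists _ _).2 ⟨β, hι.symm⟩)
  have h₂ : b.K₂.Factors ((ofButterfly h P).K₂.arrow ≫ f) := by
    refine (factors_mk_arrow_comp (kernel.ι P.ρ) _ _).2 (factors_of_comp_π _ _ ?_)
    refine (Category.assoc _ _ _).trans ((congrArg (kernel.ι P.ρ ≫ ·) hρ).trans
      ((kernel.condition_assoc _ _).trans zero_comp))
  refine ⟨⟨f, h₁, h₂, hM⟩, rfl, ?_, ?_⟩
  · refine Eq.trans ?_ (strictHom_comp _ _ _ _ _ _).symm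
    refine strictHom_congr (X := (src h).obj (ofButterfly h P)) (Y := (src h).obj b) _ ?_ ?_
    · refine (cancel_mono b.K₁.arrow).1 ((factorThru_arrow _ _ h₁).trans ?_)
      rw [← underlyingIso_hom_comp_eq_mk P.κ]
      exact (Category.assoc _ _ _).trans
        ((congrArg (_ ≫ ·) hκ).trans (Category.assoc _ _ _).symm)
    · refine (cancel_epi (cokernel.π (ofButterfly h P).M.arrow)).1
        ((cokernel.π_desc _ _ _).trans (hσ.trans ?_))
      rw [← π_ofButterflyσ h P]
      exact Category.assoc _ _ _
  · refine Eq.trans ?_ (strictHom_comp _ _ _ _ _ _).symm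
    refine strictHom_congr (X := (tgt h).obj (ofButterfly h P)) (Y := (tgt h).obj b) _ ?_ ?_
    · refine (cancel_mono b.M.arrow).1 ((factorThru_arrow _ _ hM).trans ?_)
      rw [← underlyingIso_hom_comp_eq_mk P.ι]
      exact (Category.assoc _ _ _).trans
        ((congrArg (_ ≫ ·) hι).trans (Category.assoc _ _ _).symm)
    · refine (cancel_epi (cokernel.π (ofButterfly h P).K₂.arrow)).1
        ((cokernel.π_desc _ _ _).trans (hρ.trans ?_))
      rw [← π_ofButterflyρ h P]
      exact Category.assoc _ _ _

end ofButterfly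

variable (h : IsTorsionPair T F) {a b : Quad T F}

instance (Z : Quad T F) : Mono (butterfly h Z).κ := inferInstanceAs (Mono Z.K₁.arrow)

instance (Z : Quad T F) : Epi (butterfly h Z).ρ := inferInstanceAs (Epi (cokernel.π Z.K₂.arrow))

/-- Every commutative square of the tilt between the morphisms attached to two quadruples is a
fraction of morphisms of quadruples. -/
lemma exists_hom_of_square (α : (src h).obj a ⟶ (src h).obj b) (β : (tgt h).obj a ⟶ (tgt h).obj b)
    (w : α ≫ b.hom h = a.hom h ≫ β) :
    ∃ (c : Quad T F) (u : c ⟶ a) (f : c ⟶ b), IsIso ((src h).map u) ∧ IsIso ((tgt h).map u) ∧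
      Epi ((quotient T F).map u) ∧ (src h).map f = (src h).map u ≫ α ∧
      (tgt h).map f = (tgt h).map u ≫ β := by
  obtain ⟨⟨V⟩⟩ := α
  obtain ⟨⟨W⟩⟩ := β
  -- Both sides α and β are butterflies and are replaced by their roofs; the apex quadruple is then
  -- the middle object of the butterfly Q between the roofs.
  obtain ⟨Q, ⟨u, u₁, u₂, u₃, u₄⟩, f, f₁, f₂, f₃, f₄⟩ := Butterfly.exists_roof_square (butterfly h a)
    (butterfly h b) V W (congrArg InducedCategory.Hom.hom w)
  have := Butterfly.mono_κ_of_roof_square _ _ _ Q u u₁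
  have := Butterfly.epi_ρ_of_roof_square _ _ _ Q u u₂ u₃ u₄
  let X : HRSTilt T F := ⟨V.roof, V.roof_property h ((src h).obj a).property⟩
  let Y : HRSTilt T F := ⟨W.roof, W.roof_property h ((tgt h).obj a).property⟩
  obtain ⟨φ, hφ, hφ₁, hφ₂⟩ := exists_hom_of_ofButterfly h (X := X) (Y := Y) Q a u _ _
    V.roof_fst_comm _ _ W.roof_fst_comm u₁ u₂ u₃ u₄
  obtain ⟨ψ, hψ, hψ₁, hψ₂⟩ := exists_hom_of_ofButterfly h (X := X) (Y := Y) Q b f _ _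
    V.roof_snd_comm _ _ W.roof_snd_comm f₁ f₂ f₃ f₄
  have i₁ : IsIso (strictHom (X := X) (Y := (src h).obj a) _ _ V.roof_fst_comm) :=
    (ObjectProperty.isIso_hom_iff _).1 (inferInstanceAs (IsIso V.roofFst))
  have i₂ : IsIso (strictHom (X := Y) (Y := (tgt h).obj a) _ _ W.roof_fst_comm) :=
    (ObjectProperty.isIso_hom_iff _).1 (inferInstanceAs (IsIso W.roofFst))
  refine ⟨_, φ, ψ, ?_, ?_, ?_, ?_, ?_⟩
  · rw [hφ₁]
    infer_instance
  · rw [hφ₂]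
    infer_instance
  · refine epi_quotient_map φ fun {U} y => ?_
    have := Butterfly.epi_of_roof_square _ _ _ Q u u₂ u₃
    obtain ⟨U', π, _, x, hx⟩ := surjective_up_to_refinements_of_epi u (y ≫ a.K₂.arrow)
    have hx' : x ≫ u ≫ (butterfly h a).ρ = 0 := by
      rw [← reassoc_of% hx]
      change π ≫ (y ≫ a.K₂.arrow) ≫ cokernel.π a.K₂.arrow = 0
      simp
    -- A lift of an element of K₂ to Q.E is corrected so that Q.ρ kills it, without changing its
    -- image under u; it then lies in the K₂ of the apex.
    obtain ⟨x', h₁, h₂⟩ := Butterfly.exists_lift_of_roof_square _ _ _ Q u u₂ u₄ x 0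
      (hx'.trans zero_comp.symm)
    refine ⟨U', π, inferInstance, kernel.lift Q.ρ x' h₁ ≫ (underlyingIso (kernel.ι Q.ρ)).inv, ?_⟩
    rw [hφ]
    refine (Category.assoc _ _ _).symm.trans ((congrArg (· ≫ u) ?_).trans (h₂.trans hx.symm))
    rw [Category.assoc, underlyingIso_arrow, kernel.lift_ι]
  · rw [hψ₁, hφ₁, Category.assoc]
    congr 1
    exact ObjectProperty.hom_ext _ V.roofFst_comp.symm
  · rw [hψ₂, hφ₂, Category.assoc]
    congr 1
    exact ObjectProperty.hom_ext _ W.roofFst_comp.symm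

/-- Null-homotopies s : E/M ⟶ K₁' and t : E/K₂ ⟶ M' leave δ = f - s - t, which kills K₁ and M and
lands in K₂' ∩ M'. So δ is a map from a torsion to a torsion-free object and vanishes; since t kills
K₂, the restriction of f to K₂ is s, with values in K₁'. -/
lemma quotient_map_eq_zero_of_src_tgt (f : a ⟶ b) (hs : (src h).map f = 0)
    (ht : (tgt h).map f = 0) : (quotient T F).map f = 0 := by
  obtain ⟨s, hs₁, hs₂⟩ : ∃ s : cokernel a.M.arrow ⟶ (b.K₁ : A),
      (a.K₁.arrow ≫ cokernel.π a.M.arrow) ≫ s = b.K₁.factorThru _ (Hom.map₁ f) ∧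
      s ≫ b.K₁.arrow ≫ cokernel.π b.M.arrow =
        cokernel.map _ _ (b.M.factorThru _ (Hom.mapM f)) (Hom.f f) (by simp) :=
    (strictHom_eq_zero_iff (X := (src h).obj a) (Y := (src h).obj b) _ _ _).1 hs
  obtain ⟨t, ht₁, ht₂⟩ : ∃ t : cokernel a.K₂.arrow ⟶ (b.M : A),
      (a.M.arrow ≫ cokernel.π a.K₂.arrow) ≫ t = b.M.factorThru _ (Hom.mapM f) ∧
      t ≫ b.M.arrow ≫ cokernel.π b.K₂.arrow =
        cokernel.map _ _ (b.K₂.factorThru _ (Hom.map₂ f)) (Hom.f f) (by simp) :=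
    (strictHom_eq_zero_iff (X := (tgt h).obj a) (Y := (tgt h).obj b) _ _ _).1 ht
  have hs₁' := congrArg (· ≫ b.K₁.arrow) hs₁
  have hs₂' := congrArg (cokernel.π a.M.arrow ≫ ·) hs₂
  have ht₁' := congrArg (· ≫ b.M.arrow) ht₁
  have ht₂' := congrArg (cokernel.π a.K₂.arrow ≫ ·) ht₂
  simp only [Category.assoc, factorThru_arrow, cokernel.π_desc] at hs₁' hs₂' ht₁' ht₂'
  let δ := Hom.f f - cokernel.π a.M.arrow ≫ s ≫ b.K₁.arrow - cokernel.π a.K₂.arrow ≫ t ≫ b.M.arrow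
  have hδ : (b.K₂ ⊓ b.M).Factors δ := by
    refine (inf_factors _).2 ⟨factors_of_comp_π _ _ ?_, factors_of_comp_π _ _ ?_⟩
    · simp [δ, ht₂', arrow_comp_π b.le]
    · simp [δ, hs₂']
  have h0 : factorThru _ δ hδ = 0 := by
    refine a.eq_zero_of_arrow_comp h b.free _ ?_ ?_
    · rw [← cancel_mono (arrow _), Category.assoc, factorThru_arrow]
      simp [δ, hs₁', reassoc_of% arrow_comp_π a.le]
    · rw [← cancel_mono (arrow _), Category.assoc, factorThru_arrow]
      simp [δ, ht₁']
  have hδ0 : δ = 0 := by rw [← factorThru_arrow _ δ hδ, h0, zero_comp]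
  rw [quotient_map_eq_zero_iff, factors_iff_exists]
  refine ⟨a.K₂.arrow ≫ cokernel.π a.M.arrow ≫ s, ?_⟩
  have := congrArg (a.K₂.arrow ≫ ·) hδ0
  simp only [δ, Preadditive.comp_sub, cokernel.condition_assoc, zero_comp, sub_zero,
    comp_zero] at this
  simpa using (sub_eq_zero.1 this).symm

/-- The quadruple obtained by replacing `K₂` with `K₁`. -/
noncomputable abbrev collapse (Z : Quad T F) : Quad T F where
  E := Z.E
  K₁ := Z.K₁
  K₂ := Z.K₁
  M := Z.M
  le := le_rfl
  free := h.free_of_mono (ofLE (Z.K₁ ⊓ Z.M) (Z.K₂ ⊓ Z.M) (inf_le_inf_right _ Z.le)) Z.free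
  tors := Z.tors

/-- The canonical morphism from the collapse of a quadruple. -/
noncomputable def collapseHom (Z : Quad T F) : Z.collapse h ⟶ Z where
  f := 𝟙 Z.E
  map₁ := by simpa using Z.K₁.factors_self
  map₂ := by simpa using factors_of_le _ Z.le Z.K₁.factors_self
  mapM := by simpa using Z.M.factors_self

/-- With K₂ = K₁, the second diagonal K₁ ⟶ E ⟶ E/K₁ is short exact too. -/
lemma isIso_hom_collapse (Z : Quad T F) : IsIso ((Z.collapse h).hom h) := by
  refine (ObjectProperty.isIso_hom_iff _).1 (Butterfly.isIso_toHom _ ?_)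
  exact .mk' (ShortComplex.exact_cokernel Z.K₁.arrow) (inferInstanceAs (Mono Z.K₁.arrow))
    (inferInstanceAs (Epi (cokernel.π Z.K₁.arrow)))

lemma exists_comp_collapseHom (f : a ⟶ b) (hf : (quotient T F).map f = 0) :
    ∃ f' : a ⟶ b.collapse h, f' ≫ collapseHom h b = f :=
  ⟨(⟨Hom.f (Z' := b) f, Hom.map₁ (Z' := b) f, (quotient_map_eq_zero_iff f).1 hf,
    Hom.mapM (Z' := b) f⟩ : Hom a (b.collapse h)), Hom.ext (Category.comp_id (Hom.f (Z' := b) f))⟩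

lemma src_map_collapseHom (Z : Quad T F) : (src h).map (collapseHom h Z) = 𝟙 ((src h).obj Z) := by
  refine (strictHom_congr (X := (src h).obj Z) (Y := (src h).obj Z) _ ?_ ?_).trans strictHom_id
  · exact (cancel_mono Z.K₁.arrow).1 ((factorThru_arrow _ _ (Hom.map₁ (collapseHom h Z))).trans
      ((Category.comp_id _).trans (Category.id_comp _).symm))
  · exact (cancel_epi (cokernel.π Z.M.arrow)).1 ((cokernel.π_desc _ _ _).trans
      ((Category.id_comp _).trans (Category.comp_id _).symm))

lemma src_map_eq_add {f g d : a ⟶ b} (hd : Hom.f d = Hom.f f - Hom.f g) :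
    (src h).map f = (src h).map g + (src h).map d := by
  refine Eq.trans ?_ (strictHom_add (X := (src h).obj a) (Y := (src h).obj b) _ _ _ _ _ _).symm
  refine strictHom_congr (X := (src h).obj a) (Y := (src h).obj b) _ ?_ ?_
  · refine (cancel_mono b.K₁.arrow).1 ((factorThru_arrow _ _ (Hom.map₁ f)).trans ?_)
    refine Eq.trans ?_ (Preadditive.add_comp _ _ _ _ _ _).symm
    refine Eq.trans ?_ (congrArg₂ (· + ·) (factorThru_arrow _ _ (Hom.map₁ g)).symm
      (factorThru_arrow _ _ (Hom.map₁ d)).symm)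
    simp [hd]
  · refine (cancel_epi (cokernel.π a.M.arrow)).1 ((cokernel.π_desc _ _ _).trans ?_)
    refine Eq.trans ?_ (Preadditive.comp_add _ _ _ _ _ _).symm
    refine Eq.trans ?_ (congrArg₂ (· + ·) (cokernel.π_desc _ _ _).symm (cokernel.π_desc _ _ _).symm)
    rw [hd, Preadditive.sub_comp]
    exact (add_sub_cancel _ _).symm

lemma tgt_map_eq_add {f g d : a ⟶ b} (hd : Hom.f d = Hom.f f - Hom.f g) :
    (tgt h).map f = (tgt h).map g + (tgt h).map d := by
  refine Eq.trans ?_ (strictHom_add (X := (tgt h).obj a) (Y := (tgt h).obj b) _ _ _ _ _ _).symm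
  refine strictHom_congr (X := (tgt h).obj a) (Y := (tgt h).obj b) _ ?_ ?_
  · refine (cancel_mono b.M.arrow).1 ((factorThru_arrow _ _ (Hom.mapM f)).trans ?_)
    refine Eq.trans ?_ (Preadditive.add_comp _ _ _ _ _ _).symm
    refine Eq.trans ?_ (congrArg₂ (· + ·) (factorThru_arrow _ _ (Hom.mapM g)).symm
      (factorThru_arrow _ _ (Hom.mapM d)).symm)
    simp [hd]
  · refine (cancel_epi (cokernel.π a.K₂.arrow)).1 ((cokernel.π_desc _ _ _).trans ?_)
    refine Eq.trans ?_ (Preadditive.comp_add _ _ _ _ _ _).symm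
    refine Eq.trans ?_ (congrArg₂ (· + ·) (cokernel.π_desc _ _ _).symm (cokernel.π_desc _ _ _).symm)
    rw [hd, Preadditive.sub_comp]
    exact (add_sub_cancel _ _).symm

end Quad

end Tilting

/-! ### The functor to the iterated tilt and the equivalence -/

section Tilting

open scoped ZeroObject

variable {A : Type u} [Category.{v} A] [Abelian A] {T F : ObjectProperty A}

namespace Quad

open HRSTilt

variable (h : IsTorsionPair T F)

lemma toTwoTerm_property (Z : Quad T F) :
    letI := HRSTilt.abelian h
    tiltProperty (tiltTors T F) (tiltFree T F) ((toTwoTerm h).obj Z) :=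
  (tiltProperty_iff h (butterfly h Z)).2 ⟨inferInstance, inferInstance⟩

/-- The functor from quadruples to the iterated tilt. -/
noncomputable def toTilt :
    letI := HRSTilt.abelian h
    Quad T F ⥤ HRSTilt (tiltTors T F) (tiltFree T F) :=
  letI := HRSTilt.abelian h
  (tiltProperty (tiltTors T F) (tiltFree T F)).lift (toTwoTerm h) (toTwoTerm_property h)

variable {h} in
lemma exists_ofButterfly {N : TwoTerm (HRSTilt T F)}
    (hN : letI := HRSTilt.abelian h; tiltProperty (tiltTors T F) (tiltFree T F) N) :
    ∃ (c : Quad T F) (s : (src h).obj c ⟶ N.src) (t : (tgt h).obj c ⟶ N.tgt),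
      IsIso s ∧ IsIso t ∧ s ≫ N.d = c.hom h ≫ t := by
  obtain ⟨X, Y, ⟨⟨P⟩⟩⟩ := N
  obtain ⟨_, _⟩ := (tiltProperty_iff h P).1 hN
  exact ⟨_, srcOfButterfly h P, tgtOfButterfly h P, inferInstance, inferInstance,
    (hom_tgtOfButterfly h P).symm⟩

variable {a b : Quad T F}

lemma hom_naturality (f : a ⟶ b) :
    (src h).map f ≫ b.hom h = a.hom h ≫ (tgt h).map f :=
  Arrow.w ((toArrow h).map f)

/-- The inverse of the isomorphism X ⟶ Y is a null-homotopy of the identity. -/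
lemma isZero_toTilt_collapse (Z : Quad T F) :
    letI := HRSTilt.abelian h
    IsZero ((toTilt h).obj (Z.collapse h)) := by
  let _ := HRSTilt.abelian h
  obtain ⟨⟨s, hs, hs'⟩⟩ := isIso_hom_collapse h Z
  exact (IsZero.iff_id_eq_zero _).2 ((strictHom_eq_zero_iff
    (X := (toTilt h).obj (Z.collapse h)) (Y := (toTilt h).obj (Z.collapse h)) _ _ _).2 ⟨s, hs, hs'⟩)

/-- If K₂/K₁ does not see f, then f factors through the collapse of b, a zero object of the iterated
tilt. Conversely, a null-homotopy s from [M ⟶ E/K₂] to the source of b factors the square of f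
through the collapse of b. That factorization is a fraction of quadruple morphisms, and u ≫ f
differs from its value by a morphism vanishing on both X and Y. -/
lemma toTilt_map_eq_zero_iff (f : a ⟶ b) :
    letI := HRSTilt.abelian h
    (toTilt h).map f = 0 ↔ (quotient T F).map f = 0 := by
  let _ := HRSTilt.abelian h
  constructor
  · intro hf
    obtain ⟨s, hs, ht⟩ : ∃ s : (tgt h).obj a ⟶ (src h).obj b,
        a.hom h ≫ s = (src h).map f ∧ s ≫ b.hom h = (tgt h).map f :=
      (strictHom_eq_zero_iff (X := (toTilt h).obj a) (Y := (toTilt h).obj b) _ _ _).1 hf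
    let b' := b.collapse h
    let j : b' ⟶ b := collapseHom h b
    -- The complex [K₁ ⟶ E/M] does not involve K₂, so the collapse has the same source as b.
    let s' : (tgt h).obj a ⟶ (src h).obj b' := s
    have hj : (src h).map j = 𝟙 _ := src_map_collapseHom h b
    obtain ⟨c, u, g, _, _, _, hg₁, hg₂⟩ := exists_hom_of_square h (a := a) (b := b')
      (a.hom h ≫ s') (s' ≫ b'.hom h) (Category.assoc _ _ _)
    have hj' : s' ≫ b'.hom h ≫ (tgt h).map j = (tgt h).map f := by
      rw [← hom_naturality, hj, ← ht]
      exact congrArg (s' ≫ ·) (Category.id_comp _)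
    obtain ⟨d, hd⟩ := exists_sub (u ≫ f) (g ≫ j)
    have hs0 : (src h).map (u ≫ f) = (src h).map (g ≫ j) := by
      rw [Functor.map_comp, Functor.map_comp, hg₁, hj]
      exact (congrArg ((src h).map u ≫ ·) hs.symm).trans (Category.comp_id _).symm
    have ht0 : (tgt h).map (u ≫ f) = (tgt h).map (g ≫ j) := by
      rw [Functor.map_comp, Functor.map_comp, hg₂, Category.assoc, Category.assoc, hj']
    have hd0 : (quotient T F).map d = 0 := by
      refine quotient_map_eq_zero_of_src_tgt h d ?_ ?_
      · rw [src_map_eq_add h hd] at hs0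
        exact left_eq_add.1 hs0.symm
      · rw [tgt_map_eq_add h hd] at ht0
        exact left_eq_add.1 ht0.symm
    have hj0 : (quotient T F).map j = 0 := by
      rw [quotient_map_eq_zero_iff]
      exact Hom.map₁ j
    have := quotient_map_eq_add hd
    rw [hd0, add_zero, Functor.map_comp, Functor.map_comp, hj0, comp_zero] at this
    -- The denominator u is epi on K₂/K₁, so it can be cancelled from q(u) ≫ q(f) = 0.
    exact zero_of_epi_comp _ this
  · intro hf
    obtain ⟨f', hf'⟩ := exists_comp_collapseHom h f hf
    rw [← hf', Functor.map_comp, (isZero_toTilt_collapse h b).eq_of_tgt ((toTilt h).map f') 0,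
      zero_comp]

lemma toTilt_essSurj :
    letI := HRSTilt.abelian h
    (toTilt h).EssSurj := by
  let _ := HRSTilt.abelian h
  refine ⟨fun N => ?_⟩
  obtain ⟨c, s, t, hs, ht, w⟩ := exists_ofButterfly N.property
  have := isIso_strictHom (X := (toTilt h).obj c) (Y := N) s t w hs ht
  exact ⟨c, ⟨asIso (strictHom (X := (toTilt h).obj c) (Y := N) s t w)⟩⟩

variable {h} in
/-- A two-term complex over the tilt with strict morphisms to the complexes of two quadruples is
dominated by a quadruple. -/
lemma exists_hom_pair {N : TwoTerm (HRSTilt T F)}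
    (hN : letI := HRSTilt.abelian h; tiltProperty (tiltTors T F) (tiltFree T F) N)
    (x : N.src ⟶ (src h).obj a) (x' : N.tgt ⟶ (tgt h).obj a) (wx : x ≫ a.hom h = N.d ≫ x')
    (y : N.src ⟶ (src h).obj b) (y' : N.tgt ⟶ (tgt h).obj b) (wy : y ≫ b.hom h = N.d ≫ y') :
    ∃ (c : Quad T F) (s : (src h).obj c ⟶ N.src) (t : (tgt h).obj c ⟶ N.tgt) (f : c ⟶ a)
      (g : c ⟶ b), IsIso s ∧ IsIso t ∧ s ≫ N.d = c.hom h ≫ t ∧ (src h).map f = s ≫ x ∧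
        (tgt h).map f = t ≫ x' ∧ (src h).map g = s ≫ y ∧ (tgt h).map g = t ≫ y' := by
  obtain ⟨c, s, t, hs, ht, w⟩ := exists_ofButterfly hN
  -- The two legs become quadruple morphisms one after the other: the first needs a refinement of c,
  -- and the second a further refinement, along which the first is pulled back.
  obtain ⟨c₁, u, f, hu, hu', -, hf, hf'⟩ := exists_hom_of_square h (s ≫ x) (t ≫ x')
    (by rw [Category.assoc, wx, reassoc_of% w])
  obtain ⟨c₂, v, g, hv, hv', -, hg, hg'⟩ := exists_hom_of_square h ((src h).map u ≫ s ≫ y)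
    ((tgt h).map u ≫ t ≫ y')
    (by rw [Category.assoc, Category.assoc, wy, reassoc_of% w, reassoc_of% hom_naturality h u])
  refine ⟨c₂, (src h).map v ≫ (src h).map u ≫ s, (tgt h).map v ≫ (tgt h).map u ≫ t, v ≫ f, g,
    inferInstance, inferInstance, ?_, ?_, ?_, ?_, ?_⟩
  · rw [Category.assoc, Category.assoc, w, reassoc_of% hom_naturality h u,
      reassoc_of% hom_naturality h v]
  · simp [hf]
  · simp [hf']
  · simp [hg]
  · simp [hg']

/-- A morphism of the iterated tilt is a butterfly V over B, hence a fraction of strict morphisms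
through its roof N. Being an object of the iterated tilt, N is dominated by a quadruple, on which
both legs come from morphisms of quadruples. -/
lemma toTilt_hasRoofs :
    letI := HRSTilt.abelian h
    Roof.HasRoofs (toTilt h) := by
  let _ := HRSTilt.abelian h
  refine ⟨fun {a b} g => ?_⟩
  obtain ⟨⟨V⟩⟩ := g
  let N : HRSTilt (tiltTors T F) (tiltFree T F) :=
    ⟨V.roof, V.roof_property (HRSTilt.isTorsionPair h) ((toTilt h).obj a).property⟩
  obtain ⟨c, s, t, f, g, hs, ht, w, hf, hf', hg, hg'⟩ := exists_hom_pair (a := a) (b := b)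
    N.property _ _ V.roof_fst_comm _ _ V.roof_snd_comm
  let e : (toTilt h).obj c ⟶ N := strictHom (X := (toTilt h).obj c) (Y := N) s t w
  have he : IsIso e := isIso_strictHom (X := (toTilt h).obj c) (Y := N) s t w hs ht
  have hf : (toTilt h).map f = e ≫ ObjectProperty.homMk V.roofFst :=
    Eq.trans (strictHom_congr (X := (toTilt h).obj c) (Y := (toTilt h).obj a) _ hf hf')
      (strictHom_comp _ _ _ _ _ _).symm
  have hg : (toTilt h).map g = e ≫ ObjectProperty.homMk V.roofSnd :=
    Eq.trans (strictHom_congr (X := (toTilt h).obj c) (Y := (toTilt h).obj b) _ hg hg')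
      (strictHom_comp _ _ _ _ _ _).symm
  have hV : IsIso (ObjectProperty.homMk V.roofFst : N ⟶ (toTilt h).obj a) :=
    (ObjectProperty.isIso_hom_iff _).1 (inferInstanceAs (IsIso V.roofFst))
  refine ⟨c, f, g, ?_, ?_⟩
  · rw [hf]
    infer_instance
  · rw [hf, hg, Category.assoc]
    congr 1
    exact ObjectProperty.hom_ext _ V.roofFst_comp

lemma toTilt_map_eq_add {f g d : a ⟶ b} (hd : Hom.f d = Hom.f f - Hom.f g) :
    letI := HRSTilt.abelian h
    (toTilt h).map f = (toTilt h).map g + (toTilt h).map d := by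
  let _ := HRSTilt.abelian h
  refine Eq.trans ?_
    (strictHom_add (X := (toTilt h).obj a) (Y := (toTilt h).obj b) _ _ _ _ _ _).symm
  exact strictHom_congr (X := (toTilt h).obj a) (Y := (toTilt h).obj b) _ (src_map_eq_add h hd)
    (tgt_map_eq_add h hd)

end Quad

end Tilting

theorem theoremT {A : Type u} [Category.{v} A] [Abelian A] (T F : ObjectProperty A)
    (h : IsTorsionPair T F) (htc : IsTilting T ∨ IsCotilting F) :
    ∃ hB : Abelian (HRSTilt T F),
      hB.toPreadditive = Preadditive.fullSubcategory (tiltProperty T F) ∧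
      IsTorsionPair (tiltTors T F) (tiltFree T F) ∧
      ∃ (hi : ∀ Z : Quad T F,
          tiltProperty (tiltTors T F) (tiltFree T F) ((Quad.toTwoTerm h).obj Z))
        (H : HRSTilt (tiltTors T F) (tiltFree T F) ⥤ A),
        Nonempty ((tiltProperty (tiltTors T F) (tiltFree T F)).lift (Quad.toTwoTerm h) hi ⋙ H ≅
          Quad.quotient T F) ∧
        (∀ H' : HRSTilt (tiltTors T F) (tiltFree T F) ⥤ A,
          Nonempty ((tiltProperty (tiltTors T F) (tiltFree T F)).lift (Quad.toTwoTerm h) hi ⋙ H' ≅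
            Quad.quotient T F) → Nonempty (H' ≅ H)) ∧
        H.Additive ∧ H.IsEquivalence := by
  let _ := HRSTilt.abelian h
  -- The iterated tilt is abelian for the same reason as the first tilt, hence preadditive and
  -- balanced, as the comparison of roofs requires.
  let hC : Abelian (HRSTilt (tiltTors T F) (tiltFree T F)) :=
    HRSTilt.abelian (HRSTilt.isTorsionPair h)
  have := Quad.toTilt_essSurj h
  have := Quad.quotient_essSurj h htc
  obtain ⟨H, hH, huniq, _⟩ := Roof.exists_equivalence (Quad.toTilt h) (Quad.quotient T F)
    (Quad.toTilt_hasRoofs h) (Quad.quotient_hasRoofs h) (Quad.toTilt_map_eq_zero_iff h)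
    (fun f g => by
      obtain ⟨d, hd⟩ := Quad.exists_sub f g
      exact ⟨d, Quad.toTilt_map_eq_add h hd, Quad.quotient_map_eq_add hd⟩)
  -- The abelian structure was built on the given addition of butterflies, so the compatibility is
  -- definitional. An equivalence preserves binary products, which makes H additive.
  exact ⟨HRSTilt.abelian h, rfl, HRSTilt.isTorsionPair h, Quad.toTwoTerm_property h, H, hH, huniq,
    Functor.additive_of_preserves_binary_products H, inferInstance⟩
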